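/- A Bieberbach group in dimension $3$ is a discrete, co-compact subgroup $\Gamma$ of $\mathrm{Isom}(\mathbb R^3)$ acting freely on Euclidean space $\mathbb R^3$; $\mathbb R^3/\Gamma$ is the corresponding Bieberbach manifold, and it is non-orientable when some element of $\Gamma$ reverses orientation. An isometry of $\mathbb R^3/\Gamma$ is called admissible if it is involutive and has no fixed point. Write $t_v$ for the translation by $v$ and, for an affine subspace $V$ and a vector $a$ parallel to $V$, write $\sigma_{V,a}$ for the orthogonal reflection with respect to $V$ followed by $t_a$ (for a line $V$ this is a screw motion of angle $\pi$). (1) For every non-orientable Bieberbach group $\Gamma$ in dimension $3$, the manifold $\mathbb R^3/\Gamma$ is isometric to the (whole) totally geodesic boundary of a compact connected flat Riemannian $4$-manifold, i.e. one that is locally isometric to a Euclidean half-space. (2) A subgroup $\Gamma\subset\mathrm{Isom}(\mathbb R^3)$ is a non-orientable Bieberbach group if and only if it is of one of the following types. - $B_1$: $\Gamma$ is generated by $t_{a_1}$, $t_{a_2}$ and $\sigma_{P,a_3/2}$, where $a_1,a_2,a_3$ are linearly independent, $a_1$ is orthogonal to $a_2$ and $a_3$, and $P$ is a plane with direction spanned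 by $a_2,a_3$. - $B_2$: $\Gamma$ is generated by $\sigma_{P_1,a_1/2}$ and $\sigma_{P_2,a_2/2}$, where $a_1,a_2$ are linearly independent, $P_1\ne P_2$ are parallel planes with direction spanned by $a_1,a_2$, and $d$ denotes the vector orthogonal to the $P_i$ with $P_2=P_1+d$. - $B_3$: $\Gamma$ is generated by $t_{a_3}$, $\sigma_{P,a_1/2}$ and $\sigma_{L,a_2/2}$, where $a_1,a_2,a_3$ are non-zero and pairwise orthogonal, $P$ is a plane with direction spanned by $a_1,a_2$, and $L\subset P$ is a line parallel to $a_2$. - $B_4$: $\Gamma$ is generated by $\sigma_{P,a_1/2}$ and $\sigma_{L,a_2/2}$, where $a_1,a_2,a_3$ are non-zero and pairwise orthogonal, $P$ is a plane with direction spanned by $a_1,a_2$, and $L$ is a line parallel to $a_2$ contained in $P+\tfrac14a_3$ (so $L\not\subset P$ and $|a_3|=4\,\mathrm{dist}(P,L)$). (3) In each case an explicit translation induces an admissible isometry of $\mathbb R^3/\Gamma$: $t_{a_1/2}$ for type $B_1$; $t_{2d}$, and also $t_{(a_1+a_2)/2}$, for type $B_2$; $t_{a_3/2}$ for type $B_3$;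 $t_{a_3/2}$ for type $B_4$. -/

import Mathlib

open scoped Manifold ContDiff

noncomputable section

/-- Euclidean space `Eⁿ`. -/
abbrev Euc (n : ℕ) : Type := EuclideanSpace ℝ (Fin n)

/-- The group `Isom(Eⁿ)` of affine isometries of `Eⁿ`. -/
abbrev EucIsom (n : ℕ) : Type := Euc n ≃ᵃⁱ[ℝ] Euc n

namespace FlatBoundary

/-! ### Bieberbach groups and Bieberbach manifolds -/

/-- `x ∼ y` when `x` and `y` lie in the same orbit of `Γ`. -/
def orbitSetoid {n : ℕ} (Γ : Subgroup (EucIsom n)) : Setoid (Euc n) where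
  r x y := ∃ γ ∈ Γ, γ x = y
  iseqv :=
    { refl := fun _ => ⟨1, Γ.one_mem, rfl⟩
      symm := by
        rintro x y ⟨γ, hγ, rfl⟩
        exact ⟨γ⁻¹, Γ.inv_mem hγ, γ.symm_apply_apply x⟩
      trans := by
        rintro x y z ⟨γ, hγ, rfl⟩ ⟨δ, hδ, rfl⟩
        exact ⟨δ * γ, Γ.mul_mem hδ hγ, rfl⟩ }

/-- The quotient `Eⁿ/Γ`, with the quotient topology. -/
abbrev FlatQuotient {n : ℕ} (Γ : Subgroup (EucIsom n)) : Type := Quotient (orbitSetoid Γ)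

/-- The projection `Eⁿ → Eⁿ/Γ`. -/
def proj {n : ℕ} (Γ : Subgroup (EucIsom n)) (x : Euc n) : FlatQuotient Γ :=
  Quotient.mk (orbitSetoid Γ) x

/-- `Γ` is a discrete subgroup of `Isom(Eⁿ)`: the identity is isolated in `Γ`. An affine map is
determined by its restriction to the unit ball, and the (compact-open) topology of `Isom(Eⁿ)` is
that of uniform convergence on this ball. -/
def IsDiscreteGroup {n : ℕ} (Γ : Subgroup (EucIsom n)) : Prop :=
  ∃ ε : ℝ, 0 < ε ∧ ∀ γ ∈ Γ, (∀ x : Euc n, ‖x‖ ≤ 1 → dist (γ x) x < ε) → γ = 1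

/-- A Bieberbach group: a discrete, co-compact and fixed point free group of affine isometries. -/
structure IsBieberbach {n : ℕ} (Γ : Subgroup (EucIsom n)) : Prop where
  discrete : IsDiscreteGroup Γ
  cocompact : CompactSpace (FlatQuotient Γ)
  free : ∀ γ ∈ Γ, ∀ x : Euc n, γ x = x → γ = 1

/-- `Eⁿ/Γ` is non-orientable: some element of the deck group `Γ` reverses the orientation. -/
def IsNonOrientable {n : ℕ} (Γ : Subgroup (EucIsom n)) : Prop :=
  ∃ γ ∈ Γ, LinearMap.det (γ.linearIsometryEquiv.toLinearEquiv : Euc n →ₗ[ℝ] Euc n) < 0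

/-- The isometry `τ` of `Eⁿ` goes to the quotient `Eⁿ/Γ` as an admissible isometry, that is,
an isometry which is involutive and has no fixed point. -/
def InducesAdmissible {n : ℕ} (Γ : Subgroup (EucIsom n)) (τ : EucIsom n) : Prop :=
  ∃ σ : FlatQuotient Γ → FlatQuotient Γ, (∀ x, σ (proj Γ x) = proj Γ (τ x)) ∧
    Function.Involutive σ ∧ ∀ q, σ q ≠ q

/-! ### Totally geodesic boundaries of compact flat manifolds -/

/-- The Riemannian manifold with boundary `(M, g)` is flat with totally geodesic boundary: it is
locally isometric to the Euclidean half-space `{x | 0 ≤ x 0}`. Explicitly, around each point of `M`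
there is a chart of the smooth structure, with values in the half-space, whose differential
preserves the scalar products. -/
def IsFlatWithGeodesicBoundary {n : ℕ} {M : Type} [TopologicalSpace M]
    [ChartedSpace (EuclideanHalfSpace (n + 1)) M] [IsManifold (𝓡∂ (n + 1)) ∞ M]
    (g : Bundle.ContMDiffRiemannianMetric (𝓡∂ (n + 1)) ∞ (Euc (n + 1))
      (fun x : M => TangentSpace (𝓡∂ (n + 1)) x)) : Prop :=
  ∀ x : M, ∃ e ∈ IsManifold.maximalAtlas (𝓡∂ (n + 1)) ∞ M, x ∈ e.source ∧
    ∀ y ∈ e.source, ∀ v w : TangentSpace (𝓡∂ (n + 1)) y,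
      inner ℝ (E := Euc (n + 1))
          (mfderiv (𝓡∂ (n + 1)) 𝓘(ℝ, Euc (n + 1)) (e.extend (𝓡∂ (n + 1))) y v)
          (mfderiv (𝓡∂ (n + 1)) 𝓘(ℝ, Euc (n + 1)) (e.extend (𝓡∂ (n + 1))) y w)
        = g.inner y v w

/-- `f` is an isometry from `Eⁿ/Γ` onto the whole boundary of `(M, g)`: a homeomorphism whose lift
`Eⁿ → M` is smooth with differential preserving the scalar products. -/
def IsIsometryOntoBoundary {n : ℕ} (Γ : Subgroup (EucIsom n)) {M : Type} [TopologicalSpace M]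
    [ChartedSpace (EuclideanHalfSpace (n + 1)) M] [IsManifold (𝓡∂ (n + 1)) ∞ M]
    (g : Bundle.ContMDiffRiemannianMetric (𝓡∂ (n + 1)) ∞ (Euc (n + 1))
      (fun x : M => TangentSpace (𝓡∂ (n + 1)) x))
    (f : FlatQuotient Γ ≃ₜ (𝓡∂ (n + 1)).boundary M) : Prop :=
  ContMDiff 𝓘(ℝ, Euc n) (𝓡∂ (n + 1)) ∞ (fun x : Euc n => (f (proj Γ x) : M)) ∧
    ∀ x v w : Euc n,
      g.inner (f (proj Γ x) : M)
          (mfderiv 𝓘(ℝ, Euc n) (𝓡∂ (n + 1)) (fun x : Euc n => (f (proj Γ x) : M)) x v)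
          (mfderiv 𝓘(ℝ, Euc n) (𝓡∂ (n + 1)) (fun x : Euc n => (f (proj Γ x) : M)) x w)
        = inner ℝ v w

/-- `Eⁿ/Γ` is (isometric to) the totally geodesic boundary of a compact connected flat Riemannian
manifold of dimension `n + 1`. -/
def IsGeodesicBoundary {n : ℕ} (Γ : Subgroup (EucIsom n)) : Prop :=
  ∃ (M : Type) (_ : TopologicalSpace M) (_ : T2Space M) (_ : CompactSpace M) (_ : ConnectedSpace M)
    (_ : ChartedSpace (EuclideanHalfSpace (n + 1)) M) (_ : IsManifold (𝓡∂ (n + 1)) ∞ M)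
    (g : Bundle.ContMDiffRiemannianMetric (𝓡∂ (n + 1)) ∞ (Euc (n + 1))
      (fun x : M => TangentSpace (𝓡∂ (n + 1)) x))
    (f : FlatQuotient Γ ≃ₜ (𝓡∂ (n + 1)).boundary M),
    IsFlatWithGeodesicBoundary g ∧ IsIsometryOntoBoundary Γ g f

/-! ### The four families of non-orientable groups in dimension three -/

/-- The translation `t_v`. -/
def translation {n : ℕ} (v : Euc n) : EucIsom n := AffineIsometryEquiv.constVAdd ℝ (Euc n) v

/-- The affine subspace through `p` with direction spanned by `s`. -/
def subspaceThrough {n : ℕ} (p : Euc n) (s : Set (Euc n)) : AffineSubspace ℝ (Euc n) :=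
  AffineSubspace.mk' p (Submodule.span ℝ s)

instance {n : ℕ} (p : Euc n) (s : Set (Euc n)) : Nonempty (subspaceThrough p s) :=
  inferInstanceAs (Nonempty (AffineSubspace.mk' p (Submodule.span ℝ s)))

/-- `σ_{V,a}`: the orthogonal reflection with respect to the affine subspace `V`, followed by the
translation `t_a`. When `V` is a line of `E³` parallel to `a`, this is the screw motion of angle `π`
around `V` with translation vector `a`. -/
def glide {n : ℕ} (V : AffineSubspace ℝ (Euc n)) [Nonempty V] (a : Euc n) : EucIsom n :=
  translation a * EuclideanGeometry.reflection V

/-- `Γ` is of type `B₁`: generated by `t_{a₁}`, `t_{a₂}` and `σ_{P,a₃/2}`, where the plane `P` is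
spanned by `a₂, a₃` and `a₁` is orthogonal to `a₂` and `a₃`. -/
def IsTypeB₁ (Γ : Subgroup (EucIsom 3)) (a₁ a₂ a₃ : Euc 3) : Prop :=
  LinearIndependent ℝ ![a₁, a₂, a₃] ∧ inner ℝ a₁ a₂ = 0 ∧ inner ℝ a₁ a₃ = 0 ∧
    ∃ p : Euc 3, Γ = Subgroup.closure
      {translation a₁, translation a₂, glide (subspaceThrough p {a₂, a₃}) ((1 / 2 : ℝ) • a₃)}

/-- `Γ` is of type `B₂`: generated by `σ_{P₁,a₁/2}` and `σ_{P₂,a₂/2}`, where `P₁` and `P₂` are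
distinct parallel planes spanned by `a₁, a₂`, and `d` is the orthogonal vector sending `P₁` to
`P₂`. -/
def IsTypeB₂ (Γ : Subgroup (EucIsom 3)) (a₁ a₂ d : Euc 3) : Prop :=
  LinearIndependent ℝ ![a₁, a₂, d] ∧ inner ℝ a₁ d = 0 ∧ inner ℝ a₂ d = 0 ∧
    ∃ p : Euc 3, Γ = Subgroup.closure
      {glide (subspaceThrough p {a₁, a₂}) ((1 / 2 : ℝ) • a₁),
        glide (subspaceThrough (p + d) {a₁, a₂}) ((1 / 2 : ℝ) • a₂)}

/-- `Γ` is of type `B₃`: generated by `t_{a₃}`, the glide reflection `σ_{P,a₁/2}` and the screw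
motion of angle `π` and translation `a₂/2` around `L`, where `a₁, a₂, a₃` are orthogonal, `P` is
spanned by `a₁, a₂`, and `L` is a line of `P` parallel to `a₂`. -/
def IsTypeB₃ (Γ : Subgroup (EucIsom 3)) (a₁ a₂ a₃ : Euc 3) : Prop :=
  LinearIndependent ℝ ![a₁, a₂, a₃] ∧ inner ℝ a₁ a₂ = 0 ∧ inner ℝ a₁ a₃ = 0 ∧ inner ℝ a₂ a₃ = 0 ∧
    ∃ p : Euc 3, Γ = Subgroup.closure
      {translation a₃, glide (subspaceThrough p {a₁, a₂}) ((1 / 2 : ℝ) • a₁),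
        glide (subspaceThrough p {a₂}) ((1 / 2 : ℝ) • a₂)}

/-- `Γ` is of type `B₄`: generated by the glide reflection `σ_{P,a₁/2}` and the screw motion of
angle `π` and translation `a₂/2` around `L`, where `a₁, a₂, a₃` are orthogonal, `P` is spanned by
`a₁, a₂`, and `L` is a line parallel to `a₂` which is the translate by `a₃/4` of a line of `P`
(so that `L` is not contained in `P` and `|a₃| = 4 dist(P, L)`). -/
def IsTypeB₄ (Γ : Subgroup (EucIsom 3)) (a₁ a₂ a₃ : Euc 3) : Prop :=
  LinearIndependent ℝ ![a₁, a₂, a₃] ∧ inner ℝ a₁ a₂ = 0 ∧ inner ℝ a₁ a₃ = 0 ∧ inner ℝ a₂ a₃ = 0 ∧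
    ∃ p : Euc 3, Γ = Subgroup.closure
      {glide (subspaceThrough p {a₁, a₂}) ((1 / 2 : ℝ) • a₁),
        glide (subspaceThrough (p + (1 / 4 : ℝ) • a₃) {a₂}) ((1 / 2 : ℝ) • a₂)}

end FlatBoundary

end

/-!
Suppose that an isometry `τ` of `Eⁿ` normalizes `Γ`, that its square belongs to `Γ`, and that it
moves each point outside of its `Γ`-orbit (`IsAdmissibleLift`). It induces a free isometric
involution `σ` of `Eⁿ/Γ`, and the mapping cylinder of the double covering `Eⁿ/Γ → (Eⁿ/Γ)/σ` is a
compact flat manifold with boundary `Eⁿ/Γ`. Concretely, this cylinder is obtained from the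
slab `0 ≤ t < 2` of the half-space of `Eⁿ⁺¹` by identifying the points in a same orbit of the group
generated by `Γ`, acting on the last `n` coordinates, and by `(t, x) ↦ (2 - t, τ x)`. This group
acts freely and properly discontinuously, so that local inverses of the projection are charts with
isometric transition maps
(`IsAdmissibleLift.isGeodesicBoundary`). The first assertion thus follows from the two others.

In suitable affine coordinates, the groups of the four types consist of isometries
`(x, y, z) ↦ (± x + i, y + j, ± z + l)`, with integers `i, j, l` on which the signs depend
(`IsStd`). This explicit form shows that the groups are discrete, cocompact, free and non-orientable, and that the given
translations are admissible.

Conversely, let `Γ` be a non-orientable Bieberbach group. As `Γ` acts freely, the linear part of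
each element fixes a line, so that the orientation-reversing elements have the reflection in a
plane as linear part. The planes of two such reflections are equal or orthogonal: otherwise the
commutator of the two elements would have a linear part which is a nontrivial rotation and no
translation component along its axis, hence a fixed point. There cannot be three orthogonal planes,
whose reflections have the central symmetry as product. Hence all the linear parts are diagonal in
an orthonormal basis, with eigenvalues `(± 1, 1, ± 1)` (`exists_orthonormalBasis_diagonal`). In
particular there are finitely many of them, and the translations of `Γ` form a lattice.

If the linear parts are the identity and one reflection, one chooses a basis of the planar part of
the lattice in which some element is a glide reflection along half of the first vector; the type is
`B₁` or `B₂` according to whether the lattice is the sum of its planar and normal parts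
(`IsAdaptedFrame.isTypeB₁_or_isTypeB₂`). Otherwise there are four linear parts. The absence of
fixed points forces the lattice to be generated by three orthogonal vectors, and the group is
determined by the relative position of the plane of a glide reflection and the axis of a screw
motion, which gives the types `B₃` and `B₄` (`IsOrthogonalFrame.isTypeB₃_or_isTypeB₄`).
-/

noncomputable section

open Filter Topology

namespace FlatBoundary

section

/-! ### Gluing an open set of a half-space along a group of isometries -/

/-- Two points of the open subset `U` of the half-space are identified when an element of `G` sends
one to the other. The group `G` need not preserve `U`. -/
def gluingSetoid {m : ℕ} [NeZero m] (G : Subgroup (EucIsom m))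
    (U : TopologicalSpace.Opens (EuclideanHalfSpace m)) : Setoid U where
  r x y := ∃ g ∈ G, g x.1.1 = y.1.1
  iseqv :=
    { refl := fun _ => ⟨1, G.one_mem, rfl⟩
      symm := by
        rintro x y ⟨g, hg, h⟩
        exact ⟨g⁻¹, G.inv_mem hg, by rw [← h]; exact g.symm_apply_apply _⟩
      trans := by
        rintro x y z ⟨g, hg, h⟩ ⟨k, hk, h'⟩
        exact ⟨k * g, G.mul_mem hk hg, by rw [← h', ← h]; rfl⟩ }

/-- The space obtained from `U` by identifying the points of a same `G`-orbit. -/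
def Glued {m : ℕ} [NeZero m] (G : Subgroup (EucIsom m))
    (U : TopologicalSpace.Opens (EuclideanHalfSpace m)) : Type := Quotient (gluingSetoid G U)

/-- The conditions on `G` and `U` under which the gluing is a flat manifold with boundary: `G` acts
properly discontinuously and freely, and identifies a neighbourhood in `U` of each point with a
neighbourhood in `U` of any equivalent point. -/
class IsGluing {m : ℕ} [NeZero m] (G : Subgroup (EucIsom m))
    (U : TopologicalSpace.Opens (EuclideanHalfSpace m)) : Prop where
  separated : ∀ x y : Euc m, ∃ ε : ℝ, 0 < ε ∧
    ∀ g ∈ G, ∀ z, dist z x < ε → dist (g z) y < ε → g x = y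
  free : ∀ g ∈ G, ∀ x : Euc m, g x = x → g = 1
  stable : ∀ g ∈ G, ∀ x y : U, g x.1.1 = y.1.1 →
    ∀ᶠ z : U in 𝓝 x, ∃ w : U, g z.1.1 = w.1.1

namespace Glued

variable {m : ℕ} [NeZero m] (G : Subgroup (EucIsom m))
  (U : TopologicalSpace.Opens (EuclideanHalfSpace m))

instance : TopologicalSpace (Glued G U) :=
  inferInstanceAs (TopologicalSpace (Quotient (gluingSetoid G U)))

/-- The projection of `U` onto the glued space. -/
def mk (x : U) : Glued G U := Quotient.mk (gluingSetoid G U) x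

variable {G U}

theorem mk_eq_mk {x y : U} : mk G U x = mk G U y ↔ ∃ g ∈ G, g x.1.1 = y.1.1 := Quotient.eq

theorem mk_surjective : Function.Surjective (mk G U) := Quotient.mk_surjective

theorem continuous_mk : Continuous (mk G U) := continuous_quotient_mk'

theorem isInducing_val : IsInducing (fun x : U => (x.1.1 : Euc m)) :=
  IsInducing.subtypeVal.comp IsInducing.subtypeVal

variable [hG : IsGluing G U]

/-- An element of `G` relating two points of `U` is a local homeomorphism of `U` between them. -/
theorem eventually_exists_mem {g : EucIsom m} (hg : g ∈ G) {x y : U} (h : g x.1.1 = y.1.1)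
    {N : Set U} (hN : N ∈ 𝓝 y) : ∀ᶠ z : U in 𝓝 x, ∃ w ∈ N, g z.1.1 = w.1.1 := by
  obtain ⟨N', hN', hsub⟩ := (isInducing_val.nhds_eq_comap y ▸ hN : N ∈ comap _ _)
  have hc : Tendsto (fun z : U => g z.1.1) (𝓝 x) (𝓝 y.1.1) := by
    rw [← h]
    exact (g.continuous.tendsto _).comp (isInducing_val.continuous.tendsto x)
  filter_upwards [hG.stable g hg x y h, hc hN'] with z hz hz'
  obtain ⟨w, hw⟩ := hz
  refine ⟨w, hsub ?_, hw⟩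
  change w.1.1 ∈ N'
  rw [← hw]; exact hz'

theorem isOpenMap_mk : IsOpenMap (mk G U) := by
  intro V hV
  have hq : IsQuotientMap (mk G U) := isQuotientMap_quotient_mk'
  rw [← hq.isOpen_preimage, isOpen_iff_mem_nhds]
  rintro z ⟨y, hy, hyz⟩
  obtain ⟨g, hg, h⟩ := mk_eq_mk.1 hyz.symm
  filter_upwards [eventually_exists_mem hg h (hV.mem_nhds hy)] with z' hz'
  obtain ⟨w, hw, hgw⟩ := hz'
  exact ⟨w, hw, (mk_eq_mk.2 ⟨g, hg, hgw⟩).symm⟩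

theorem isLocallyInjective_mk : IsLocallyInjective (mk G U) := by
  intro x
  obtain ⟨ε, hε, h⟩ := hG.separated x.1.1 x.1.1
  refine ⟨(fun x : U => (x.1.1 : Euc m)) ⁻¹' Metric.ball x.1.1 ε,
    Metric.isOpen_ball.preimage isInducing_val.continuous, Metric.mem_ball_self hε, ?_⟩
  intro a ha b hb hab
  obtain ⟨g, hg, hgab⟩ := mk_eq_mk.1 hab
  have := hG.free g hg _ (h g hg a.1.1 ha (by rw [hgab]; exact hb))
  subst this
  exact Subtype.ext (Subtype.ext hgab)

theorem isLocalHomeomorph_mk : IsLocalHomeomorph (mk G U) := by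
  rw [isLocalHomeomorph_iff_isOpenEmbedding_restrict]
  intro x
  obtain ⟨V, hV, hx, hinj⟩ := isLocallyInjective_mk (G := G) (U := U) x
  exact ⟨V, hV.mem_nhds hx, IsOpenEmbedding.of_continuous_injective_isOpenMap
    (continuous_mk.comp continuous_subtype_val) (Set.injOn_iff_injective.1 hinj)
    (isOpenMap_mk.domRestrict hV)⟩

instance : T2Space (Glued G U) := by
  refine ⟨fun p q hpq => ?_⟩
  obtain ⟨x, rfl⟩ := mk_surjective p
  obtain ⟨y, rfl⟩ := mk_surjective q
  obtain ⟨ε, hε, h⟩ := hG.separated x.1.1 y.1.1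
  let V (u : U) : Set U := (fun x : U => (x.1.1 : Euc m)) ⁻¹' Metric.ball u.1.1 ε
  have hV (u : U) : IsOpen (V u) := Metric.isOpen_ball.preimage isInducing_val.continuous
  have hu (u : U) : u ∈ V u := Metric.mem_ball_self hε
  refine ⟨_, _, isOpenMap_mk _ (hV x), isOpenMap_mk _ (hV y), ⟨x, hu x, rfl⟩, ⟨y, hu y, rfl⟩, ?_⟩
  rw [Set.disjoint_left]
  rintro _ ⟨a, ha, rfl⟩ ⟨b, hb, hab⟩
  obtain ⟨g, hg, hgab⟩ := mk_eq_mk.1 hab.symm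
  exact hpq (mk_eq_mk.2 ⟨g, hg, h g hg _ ha (by rw [hgab]; exact hb)⟩)

variable (G) in
/-- The chart of the glued space around the image of `x`: a local inverse of the projection. -/
def chart (x : U) : OpenPartialHomeomorph (Glued G U) (EuclideanHalfSpace m) :=
  (isLocalHomeomorph_mk.localInverseAt x) ≫ₕ U.openPartialHomeomorphSubtypeCoe ⟨x⟩

theorem chart_source (x : U) :
    (chart G x : OpenPartialHomeomorph (Glued G U) _).source =
      (isLocalHomeomorph_mk.localInverseAt x).source := by
  simp [chart]

theorem chart_apply (x : U) (q : Glued G U) :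
    chart G x q = ((isLocalHomeomorph_mk.localInverseAt x q : U) : EuclideanHalfSpace m) := rfl

instance : ChartedSpace (EuclideanHalfSpace m) (Glued G U) where
  atlas := Set.range (chart G)
  chartAt q := chart G (Quotient.out q)
  mem_chart_source q := by
    rw [chart_source]
    convert IsLocalHomeomorph.apply_self_mem_localInverseAt_source _
    exact (Quotient.out_eq q).symm
  chart_mem_atlas q := ⟨_, rfl⟩

/-- A point of the source of a chart is the class of its image under the chart. -/
theorem exists_chart_eq {x : U} {q : Glued G U}
    (hq : q ∈ (chart G x : OpenPartialHomeomorph (Glued G U) _).source) :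
    ∃ a : U, chart G x q = a.1 ∧ mk G U a = q :=
  ⟨_, rfl, IsLocalHomeomorph.apply_localInverseAt_of_mem _ (chart_source (G := G) x ▸ hq)⟩

/-- In a chart, the projection from `U` coincides locally with an element of `G`. -/
theorem exists_eventually_chart_mk_eq {x a : U}
    (ha : mk G U a ∈ (chart G x : OpenPartialHomeomorph (Glued G U) _).source) :
    ∃ g ∈ G, ∀ᶠ z in 𝓝 a, (chart G x (mk G U z)).1 = g z.1.1 := by
  rw [chart_source] at ha
  set L := (isLocalHomeomorph_mk (G := G) (U := U)).localInverseAt x with hL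
  obtain ⟨g, hg, h⟩ := mk_eq_mk.1
    (IsLocalHomeomorph.apply_localInverseAt_of_mem isLocalHomeomorph_mk ha).symm
  refine ⟨g, hg, ?_⟩
  filter_upwards [eventually_exists_mem hg h (L.open_target.mem_nhds (L.map_source ha))]
    with z hz
  obtain ⟨w, hw, hgw⟩ := hz
  have h1 : L (mk G U z) = w := by
    rw [mk_eq_mk.2 ⟨g, hg, hgw⟩]
    have := L.right_inv hw
    rwa [hL, IsLocalHomeomorph.localInverseAt_symm] at this
  rw [chart_apply, ← hL, h1, hgw]

/-- Read in the model vector space, a change of charts coincides locally with an element of `G`. -/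
theorem exists_transition_eventuallyEq {x x' : U} {q : Glued G U}
    (hq : q ∈ (chart G x : OpenPartialHomeomorph (Glued G U) _).source)
    (hq' : q ∈ (chart G x' : OpenPartialHomeomorph (Glued G U) _).source) :
    ∃ g ∈ G, (chart G x').extend (𝓡∂ m) ∘ ((chart G x).extend (𝓡∂ m)).symm
      =ᶠ[𝓝[Set.range (𝓡∂ m)] ((chart G x).extend (𝓡∂ m) q)] g := by
  obtain ⟨a, ha, rfl⟩ := exists_chart_eq (G := G) hq
  obtain ⟨g, hg, h⟩ := exists_eventually_chart_mk_eq (G := G) hq'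
  refine ⟨g, hg, ?_⟩
  set L := (isLocalHomeomorph_mk (G := G) (U := U)).localInverseAt x with hL
  have haL : L (mk G U a) = a := Subtype.ext ha
  have hsrc : mk G U a ∈ L.source := chart_source (G := G) x ▸ hq
  -- near `mk a` the local inverse `L` takes values near `a`
  have h1 : ∀ᶠ p : Glued G U in 𝓝 (mk G U a), p ∈ L.source ∧
      (chart G x' p).1 = g (chart G x p).1 := by
    have hc : Tendsto L (𝓝 (mk G U a)) (𝓝 a) := by
      have := L.continuousAt hsrc
      rwa [ContinuousAt, haL] at this
    filter_upwards [hc.eventually h, L.open_source.mem_nhds hsrc] with p hp hps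
    refine ⟨hps, ?_⟩
    rw [IsLocalHomeomorph.apply_localInverseAt_of_mem isLocalHomeomorph_mk hps] at hp
    exact hp
  have h2 := ((chart G x).continuousAt_extend_symm (I := 𝓡∂ m) hq)
  rw [ContinuousAt, (chart G x).extend_left_inv hq] at h2
  filter_upwards [h2.mono_left nhdsWithin_le_nhds |>.eventually h1,
    (chart G x).extend_target_mem_nhdsWithin (I := 𝓡∂ m) hq] with z hz hzt
  have h3 := ((chart G x).extend (𝓡∂ m)).right_inv hzt
  simp only [Function.comp_apply]
  conv_rhs => rw [← h3]
  exact hz.2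

end Glued

end

section

/-! ### The flat metric of a glued space -/

theorem apply_eq_linear_add {m : ℕ} (g : EucIsom m) (z : Euc m) :
    g z = g.linearIsometryEquiv z + g 0 := by
  have := g.map_vadd 0 z
  simpa using this

theorem hasFDerivAt_isometry {m : ℕ} (g : EucIsom m) (z : Euc m) :
    HasFDerivAt g (g.linearIsometryEquiv.toContinuousLinearEquiv : Euc m →L[ℝ] Euc m) z := by
  have h : (g : Euc m → Euc m) = fun z => g.linearIsometryEquiv z + g 0 :=
    funext (apply_eq_linear_add g)
  rw [h]
  exact (g.linearIsometryEquiv.toContinuousLinearEquiv.hasFDerivAt).add_const _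

theorem contDiff_isometry {m : ℕ} (g : EucIsom m) {k : WithTop ℕ∞} : ContDiff ℝ k g := by
  have h : (g : Euc m → Euc m) = fun z => g.linearIsometryEquiv z + g 0 :=
    funext (apply_eq_linear_add g)
  rw [h]
  exact g.linearIsometryEquiv.toContinuousLinearEquiv.contDiff.add contDiff_const

/-- The Euclidean scalar product, as a continuous bilinear form. -/
def innerForm (m : ℕ) : Euc m →L[ℝ] Euc m →L[ℝ] ℝ := innerSL ℝ

theorem innerForm_apply {m : ℕ} (v w : Euc m) : innerForm m v w = inner ℝ v w :=
  innerSL_apply_apply ℝ v w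

theorem innerForm_comm {m : ℕ} (v w : Euc m) : innerForm m v w = innerForm m w v := by
  rw [innerForm_apply, innerForm_apply, real_inner_comm]

theorem innerForm_pos {m : ℕ} {v : Euc m} (hv : v ≠ 0) : 0 < innerForm m v v := by
  rw [innerForm_apply]
  exact real_inner_self_pos.2 hv

namespace Glued

variable {m : ℕ} [NeZero m] {G : Subgroup (EucIsom m)}
  {U : TopologicalSpace.Opens (EuclideanHalfSpace m)} [hG : IsGluing G U]

instance : IsManifold (𝓡∂ m) ∞ (Glued G U) := by
  refine isManifold_of_contDiffOn _ _ _ ?_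
  rintro _ _ ⟨x, rfl⟩ ⟨x', rfl⟩ z ⟨hz, y, rfl⟩
  rw [Set.mem_preimage, (𝓡∂ m).left_inv] at hz
  have hz1 : y ∈ (chart G x).target := hz.1
  have hz2 : (chart G x).symm y ∈ (chart G x').source := hz.2
  obtain ⟨g, -, h⟩ := exists_transition_eventuallyEq ((chart G x).map_target hz1) hz2
  have h1 : (chart G x).extend (𝓡∂ m) ((chart G x).symm y) = (𝓡∂ m) y := by
    simp [(chart G x).right_inv hz1]
  rw [h1] at h
  exact ((contDiff_isometry g).contDiffWithinAt.congr_of_eventuallyEq h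
    (h.self_of_nhdsWithin ⟨y, rfl⟩)).mono Set.inter_subset_right

/-- The changes of coordinates of the tangent bundle are linear isometries. -/
theorem exists_tangentCoordChange_eq {p p' q : Glued G U}
    (hq : q ∈ (chartAt (EuclideanHalfSpace m) p).source)
    (hq' : q ∈ (chartAt (EuclideanHalfSpace m) p').source) :
    ∃ g ∈ G, tangentCoordChange (𝓡∂ m) p p' q =
      (g.linearIsometryEquiv.toContinuousLinearEquiv : Euc m →L[ℝ] Euc m) := by
  obtain ⟨g, hg, h⟩ := exists_transition_eventuallyEq (G := G) hq hq'
  refine ⟨g, hg, ?_⟩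
  have hmem : (chartAt (EuclideanHalfSpace m) p).extend (𝓡∂ m) q ∈ Set.range (𝓡∂ m) := ⟨_, rfl⟩
  exact ((hasFDerivAt_isometry g _).hasFDerivWithinAt.congr_of_eventuallyEq h
    (h.self_of_nhdsWithin hmem)).fderivWithin ((𝓡∂ m).uniqueDiffOn _ hmem)

theorem inner_tangentCoordChange {p p' q : Glued G U}
    (hq : q ∈ (chartAt (EuclideanHalfSpace m) p).source)
    (hq' : q ∈ (chartAt (EuclideanHalfSpace m) p').source) (v w : Euc m) :
    inner ℝ (tangentCoordChange (𝓡∂ m) p p' q v) (tangentCoordChange (𝓡∂ m) p p' q w) =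
      inner ℝ v w := by
  obtain ⟨g, -, h⟩ := exists_tangentCoordChange_eq hq hq'
  rw [h]
  exact g.linearIsometryEquiv.inner_map_map v w

variable (G U) in
/-- The flat metric: in the coordinates given by the preferred chart, it is the Euclidean scalar
product at each point. -/
def metric : Bundle.ContMDiffRiemannianMetric (𝓡∂ m) ∞ (Euc m)
    (fun x : Glued G U => TangentSpace (𝓡∂ m) x) where
  inner _ := innerForm m
  symm _ v w := innerForm_comm v w
  pos _ _ hv := innerForm_pos hv
  isVonNBounded x := by
    change Bornology.IsVonNBounded ℝ {v : Euc m | innerForm m v v < 1}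
    refine (NormedSpace.isVonNBounded_ball ℝ (Euc m) 1).subset fun v hv => ?_
    have hv' : innerForm m v v < 1 := hv
    rw [innerForm_apply, real_inner_self_eq_norm_sq] at hv'
    rw [Metric.mem_ball, dist_zero_right]
    nlinarith [norm_nonneg v]
  contMDiff := by
    intro x
    refine (Bundle.contMDiffAt_section _).2 ?_
    refine (contMDiffAt_const (c := innerForm m)).congr_of_eventuallyEq ?_
    filter_upwards [(chartAt (EuclideanHalfSpace m) x).open_source.mem_nhds
      (mem_chart_source (EuclideanHalfSpace m) x)] with y hy
    rw [hom_trivializationAt_apply]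
    ext1 v
    ext1 w
    rw [inCoordinates_apply_eq₂ (by simpa using hy) (by simpa using hy) (Set.mem_univ _)]
    simp only [Bundle.Trivial.linearMapAt_trivialization, LinearMap.id_coe, id_eq,
      Bundle.Trivial.fiberBundle_trivializationAt']
    have h (u : Euc m) : (trivializationAt (Euc m) (TangentSpace (𝓡∂ m)) x).symm y u =
        tangentCoordChange (𝓡∂ m) x y y u :=
      (Bundle.Trivialization.symmL_apply (R := ℝ) _ (by simpa using hy) u).symm.trans <|
        DFunLike.congr_fun (TangentBundle.symmL_trivializationAt_eq_core (𝕜 := ℝ) (I := 𝓡∂ m) hy) u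
    rw [h, h]
    exact (innerForm_apply _ _).trans
      ((inner_tangentCoordChange hy (mem_chart_source _ y) v w).trans (innerForm_apply v w).symm)

theorem metric_inner (x : Glued G U) (v w : TangentSpace (𝓡∂ m) x) :
    (metric G U).inner x v w = inner ℝ (E := Euc m) v w := innerForm_apply v w

theorem isFlatWithGeodesicBoundary {n : ℕ} (G : Subgroup (EucIsom (n + 1)))
    (U : TopologicalSpace.Opens (EuclideanHalfSpace (n + 1))) [IsGluing G U] :
    IsFlatWithGeodesicBoundary (metric G U) := by
  intro x
  refine ⟨chartAt _ x, IsManifold.chart_mem_maximalAtlas x, mem_chart_source _ x, ?_⟩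
  intro y hy v w
  have h : mfderiv (𝓡∂ (n + 1)) 𝓘(ℝ, Euc (n + 1))
      ((chartAt (EuclideanHalfSpace (n + 1)) x).extend (𝓡∂ (n + 1))) y =
        tangentCoordChange (𝓡∂ (n + 1)) y x y :=
    (TangentBundle.continuousLinearMapAt_trivializationAt hy).symm.trans
      (TangentBundle.continuousLinearMapAt_trivializationAt_eq_core hy)
  rw [h, metric_inner]
  exact inner_tangentCoordChange (mem_chart_source _ y) hy v w

/-- The image in the glued space of a smooth map with values in `U`, read in the preferred chart at
a point, is the composition of this map with an element of `G`. -/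
theorem exists_eventuallyEq_extChartAt_comp {k : ℕ} {s : Euc k → U} (hs : Continuous s)
    (x : Euc k) : ∃ g ∈ G, (extChartAt (𝓡∂ m) (mk G U (s x)) ∘ fun x => mk G U (s x)) =ᶠ[𝓝 x]
      fun x => g (s x).1.1 := by
  obtain ⟨g, hg, h⟩ := exists_eventually_chart_mk_eq (G := G)
    (mem_chart_source (EuclideanHalfSpace m) (mk G U (s x)))
  exact ⟨g, hg, (hs.tendsto x).eventually h⟩

theorem contMDiff_mk_comp {k : ℕ} {s : Euc k → U}
    (hs : ContDiff ℝ ∞ (fun x => (s x).1.1)) :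
    ContMDiff 𝓘(ℝ, Euc k) (𝓡∂ m) ∞ (fun x => mk G U (s x)) := by
  intro x
  have hc : Continuous s := isInducing_val.continuous_iff.2 hs.continuous
  obtain ⟨g, -, h⟩ := exists_eventuallyEq_extChartAt_comp (G := G) hc x
  rw [contMDiffAt_iff_target]
  exact ⟨(continuous_mk.comp hc).continuousAt,
    (((contDiff_isometry g).comp hs).contMDiff.contMDiffAt).congr_of_eventuallyEq h⟩

theorem metric_inner_mfderiv_mk_comp {k : ℕ} {s : Euc k → U}
    (hs : ContDiff ℝ ∞ (fun x => (s x).1.1)) (x v w : Euc k) :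
    (metric G U).inner (mk G U (s x))
        (mfderiv 𝓘(ℝ, Euc k) (𝓡∂ m) (fun x => mk G U (s x)) x v)
        (mfderiv 𝓘(ℝ, Euc k) (𝓡∂ m) (fun x => mk G U (s x)) x w) =
      inner ℝ (fderiv ℝ (fun x => (s x).1.1) x v) (fderiv ℝ (fun x => (s x).1.1) x w) := by
  have hc : Continuous s := isInducing_val.continuous_iff.2 hs.continuous
  obtain ⟨g, -, h⟩ := exists_eventuallyEq_extChartAt_comp (G := G) hc x
  have hd : mfderiv 𝓘(ℝ, Euc k) (𝓡∂ m) (fun x => mk G U (s x)) x =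
      (g.linearIsometryEquiv.toContinuousLinearEquiv : Euc m →L[ℝ] Euc m).comp
        (fderiv ℝ (fun x => (s x).1.1) x) := by
    rw [((contMDiff_mk_comp hs).mdifferentiable (by simp) x).mfderiv]
    have h2 : HasFDerivAt (extChartAt (𝓡∂ m) (mk G U (s x)) ∘ fun x => mk G U (s x)) _ x :=
      ((hasFDerivAt_isometry g _).comp x
        (hs.differentiable (by simp) x).hasFDerivAt).congr_of_eventuallyEq h
    rw [← h2.fderiv]
    rw [writtenInExtChartAt, extChartAt_model_space_eq_id]
    simp
    rfl
  rw [metric_inner, hd]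
  exact g.linearIsometryEquiv.inner_map_map _ _

/-- Boundary points are the classes of the points of `U` on the boundary hyperplane, when `G` does
not move them inside the half-space. -/
theorem mk_mem_boundary_iff {n : ℕ} {G : Subgroup (EucIsom (n + 1))}
    {U : TopologicalSpace.Opens (EuclideanHalfSpace (n + 1))} [IsGluing G U]
    (hb : ∀ g ∈ G, ∀ x y : U, g x.1.1 = y.1.1 → x.1.1 0 = 0 → y.1.1 0 = 0) (a : U) :
    mk G U a ∈ (𝓡∂ (n + 1)).boundary (Glued G U) ↔ a.1.1 0 = 0 := by
  obtain ⟨b, hb1, hb2⟩ := exists_chart_eq (G := G)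
    (mem_chart_source (EuclideanHalfSpace (n + 1)) (mk G U a))
  have h : extChartAt (𝓡∂ (n + 1)) (mk G U a) (mk G U a) = b.1.1 := congrArg Subtype.val hb1
  change (𝓡∂ (n + 1)).IsBoundaryPoint _ ↔ _
  rw [ModelWithCorners.isBoundaryPoint_iff, h, frontier_range_modelWithCornersEuclideanHalfSpace,
    Set.mem_ofPred_eq, eq_comm]
  constructor
  · obtain ⟨g, hg, hgx⟩ := mk_eq_mk.1 hb2
    exact hb g hg b a hgx
  · obtain ⟨g, hg, hgx⟩ := mk_eq_mk.1 hb2.symm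
    exact hb g hg a b hgx

end Glued

end

section

/-! ### Proper discontinuity of discrete groups -/

/-- A discrete group of isometries acts properly discontinuously: an isometry is determined by its
linear part and the image of one point, which vary in a bounded set of a finite-dimensional space
when this image does. -/
theorem finite_setOf_dist_le {n : ℕ} {Γ : Subgroup (EucIsom n)} (hΓ : IsDiscreteGroup Γ)
    (x y : Euc n) (r : ℝ) : {γ : EucIsom n | γ ∈ Γ ∧ dist (γ x) y ≤ r}.Finite := by
  obtain ⟨ε, hε, h⟩ := hΓ
  let Φ : EucIsom n → (Euc n →L[ℝ] Euc n) × Euc n := fun γ =>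
    ((γ.linearIsometryEquiv.toContinuousLinearEquiv : Euc n →L[ℝ] Euc n), γ x)
  set S := {γ : EucIsom n | γ ∈ Γ ∧ dist (γ x) y ≤ r}
  have hb : TotallyBounded (Φ '' S) := by
    refine ((isCompact_closedBall (0 : Euc n →L[ℝ] Euc n) 1).prod
      (isCompact_closedBall y r)).totallyBounded.subset ?_
    rintro _ ⟨γ, hγ, rfl⟩
    refine ⟨?_, hγ.2⟩
    rw [mem_closedBall_zero_iff]
    exact γ.linearIsometryEquiv.toLinearIsometry.norm_toContinuousLinearMap_le
  set δ : ℝ := ε / (2 * (3 + ‖x‖)) with hδ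
  have hpos : 0 < 3 + ‖x‖ := by positivity
  have hδpos : 0 < δ := by positivity
  obtain ⟨t, ht, hcov⟩ := Metric.totallyBounded_iff.1 hb δ hδpos
  refine (ht.biUnion (t := fun c => {γ ∈ S | Φ γ ∈ Metric.ball c δ}) fun c _ => ?_).subset ?_
  · refine Set.Subsingleton.finite fun γ hγ γ' hγ' => ?_
    have hd : dist (Φ γ) (Φ γ') < 2 * δ := by
      have h1 := hγ.2
      have h2 := hγ'.2
      rw [Metric.mem_ball] at h1 h2
      linarith [dist_triangle_right (Φ γ) (Φ γ') c]
    rw [Prod.dist_eq, max_lt_iff] at hd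
    have hone : γ'⁻¹ * γ = 1 := by
      refine h _ (Γ.mul_mem (Γ.inv_mem hγ'.1.1) hγ.1.1) fun z hz => ?_
      have e1 : dist ((γ'⁻¹ * γ) z) z = dist (γ z) (γ' z) := by
        rw [← γ'.dist_map]
        exact congrArg (dist · _) (γ'.apply_symm_apply _)
      have e2 (g : EucIsom n) : g z = g.linearIsometryEquiv (z - x) + g x := by
        rw [apply_eq_linear_add g z, apply_eq_linear_add g x, map_sub]
        abel
      have e3 : γ z - γ' z = ((Φ γ).1 - (Φ γ').1) (z - x) + (γ x - γ' x) := by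
        rw [e2 γ, e2 γ']
        change _ = (γ.linearIsometryEquiv (z - x) - γ'.linearIsometryEquiv (z - x)) + _
        abel
      have e4 : ‖z - x‖ ≤ 1 + ‖x‖ := (norm_sub_le _ _).trans (by linarith)
      have e5 : ‖((Φ γ).1 - (Φ γ').1) (z - x)‖ ≤ 2 * δ * (1 + ‖x‖) := by
        refine (ContinuousLinearMap.le_opNorm _ _).trans ?_
        have := hd.1.le
        rw [dist_eq_norm] at this
        gcongr
      have e6 : ‖γ x - γ' x‖ ≤ 2 * δ := by
        rw [← dist_eq_norm]; exact hd.2.le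
      rw [e1, dist_eq_norm, e3]
      refine (norm_add_le _ _).trans_lt ?_
      have : 2 * δ * (3 + ‖x‖) = ε := by rw [hδ]; field_simp
      nlinarith
    exact (inv_mul_eq_one.1 hone).symm
  · intro γ hγ
    obtain ⟨c, hc, hc'⟩ := Set.mem_iUnion₂.1 (hcov ⟨γ, hγ, rfl⟩)
    exact Set.mem_biUnion hc ⟨hγ, hc'⟩

/-- A cocompact group has a compact set meeting all its orbits. -/
theorem exists_radius_of_compactSpace {n : ℕ} {Γ : Subgroup (EucIsom n)}
    (h : CompactSpace (FlatQuotient Γ)) :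
    ∃ R : ℝ, ∀ x : Euc n, ∃ γ ∈ Γ, ‖γ x‖ ≤ R := by
  have hopen : IsOpenMap (proj Γ) := by
    intro V hV
    have hq : IsQuotientMap (proj Γ) := isQuotientMap_quotient_mk'
    rw [← hq.isOpen_preimage]
    have : proj Γ ⁻¹' (proj Γ '' V) = ⋃ γ ∈ Γ, (γ : Euc n → Euc n) ⁻¹' V := by
      ext x
      simp only [Set.mem_preimage, Set.mem_image, Set.mem_iUnion, exists_prop]
      constructor
      · rintro ⟨y, hy, hxy⟩
        obtain ⟨γ, hγ, rfl⟩ := Quotient.exact hxy.symm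
        exact ⟨γ, hγ, hy⟩
      · rintro ⟨γ, hγ, hy⟩
        exact ⟨γ x, hy, Quotient.sound ⟨γ⁻¹, Γ.inv_mem hγ, γ.symm_apply_apply x⟩⟩
    rw [this]
    exact isOpen_biUnion fun γ _ => hV.preimage γ.continuous
  obtain ⟨t, ht⟩ := isCompact_univ.elim_finite_subcover
    (fun k : ℕ => proj Γ '' Metric.ball 0 (k : ℝ)) (fun k => hopen _ Metric.isOpen_ball) (by
      intro q _
      obtain ⟨x, rfl⟩ := Quotient.exists_rep q
      obtain ⟨k, hk⟩ := exists_nat_gt ‖x‖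
      exact Set.mem_iUnion.2 ⟨k, x, by simpa using hk, rfl⟩)
  refine ⟨(t.sup id : ℕ), fun x => ?_⟩
  obtain ⟨k, hk, y, hy, hyx⟩ := Set.mem_iUnion₂.1 (ht (Set.mem_univ (proj Γ x)))
  obtain ⟨γ, hγ, rfl⟩ := Quotient.exact hyx.symm
  refine ⟨γ, hγ, ?_⟩
  have h1 : k ≤ t.sup id := Finset.le_sup (f := id) hk
  have h2 : ‖γ x‖ < k := by simpa using hy
  exact h2.le.trans (by exact_mod_cast h1)

/-! ### Isometries of `E¹ × Eⁿ` -/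

/-- The point of `Eⁿ⁺¹` with first coordinate `t` and other coordinates those of `x`. -/
def cons {n : ℕ} (t : ℝ) (x : Euc n) : Euc (n + 1) := WithLp.toLp 2 (Fin.cons t x.ofLp)

/-- The last `n` coordinates of a point of `Eⁿ⁺¹`. -/
def tail {n : ℕ} (z : Euc (n + 1)) : Euc n := WithLp.toLp 2 (fun i => z i.succ)

section cons

variable {n : ℕ}

@[simp] theorem cons_zero (t : ℝ) (x : Euc n) : cons t x 0 = t := rfl

@[simp] theorem cons_succ (t : ℝ) (x : Euc n) (i : Fin n) : cons t x i.succ = x i := rfl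

@[simp] theorem tail_cons (t : ℝ) (x : Euc n) : tail (cons t x) = x := rfl

@[simp] theorem cons_tail (z : Euc (n + 1)) : cons (z 0) (tail z) = z := by
  ext i
  exact Fin.cases rfl (fun _ => rfl) i

theorem dist_cons_sq (t s : ℝ) (x y : Euc n) :
    dist (cons t x) (cons s y) ^ 2 = dist t s ^ 2 + dist x y ^ 2 := by
  rw [EuclideanSpace.dist_eq, EuclideanSpace.dist_eq, Real.sq_sqrt (by positivity),
    Real.sq_sqrt (by positivity), Fin.sum_univ_succ]
  rfl

theorem dist_tail_le (z w : Euc (n + 1)) : dist (tail z) (tail w) ≤ dist z w := by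
  refine le_of_sq_le_sq ?_ dist_nonneg
  have := dist_cons_sq (z 0) (w 0) (tail z) (tail w)
  rw [cons_tail, cons_tail] at this
  rw [this]
  nlinarith [sq_nonneg (dist (z 0) (w 0))]

theorem continuous_cons : Continuous (fun p : ℝ × Euc n => cons p.1 p.2) := by
  refine (PiLp.continuous_toLp 2 _).comp (continuous_pi fun i => ?_)
  refine Fin.cases ?_ (fun j => ?_) i
  · exact continuous_fst
  · exact (continuous_apply j).comp ((PiLp.continuous_ofLp 2 _).comp continuous_snd)

variable (n) in
/-- The inclusion of `Eⁿ` in `Eⁿ⁺¹` as a coordinate hyperplane. -/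
def consZero : Euc n →ₗᵢ[ℝ] Euc (n + 1) where
  toFun := cons 0
  map_add' x y := by
    ext i
    refine Fin.cases ?_ (fun j => ?_) i <;> simp
  map_smul' c x := by
    ext i
    refine Fin.cases ?_ (fun j => ?_) i <;> simp
  norm_map' x := by
    change ‖cons 0 x‖ = ‖x‖
    have h0 : (cons 0 0 : Euc (n + 1)) = 0 := by
      ext i
      refine Fin.cases ?_ (fun j => ?_) i <;> simp
    have := dist_cons_sq 0 0 x 0
    rw [h0] at this
    rw [← sq_eq_sq₀ (norm_nonneg _) (norm_nonneg _)]
    simpa using this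

/-- The product of an isometry of the line and an isometry of `Eⁿ`. -/
def prodIsom (e : ℝ ≃ᵢ ℝ) (γ : EucIsom n) : EucIsom (n + 1) :=
  IsometryEquiv.toRealAffineIsometryEquiv
    { toFun := fun z => cons (e (z 0)) (γ (tail z))
      invFun := fun z => cons (e.symm (z 0)) (γ.symm (tail z))
      left_inv := fun z => by simp
      right_inv := fun z => by simp
      isometry_toFun := Isometry.of_dist_eq fun z w => by
        rw [← sq_eq_sq₀ dist_nonneg dist_nonneg, dist_cons_sq, e.dist_eq, γ.dist_map,
          ← dist_cons_sq, cons_tail, cons_tail] }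

@[simp] theorem prodIsom_apply (e : ℝ ≃ᵢ ℝ) (γ : EucIsom n) (z : Euc (n + 1)) :
    prodIsom e γ z = cons (e (z 0)) (γ (tail z)) := rfl

theorem tail_prodIsom (e : ℝ ≃ᵢ ℝ) (γ : EucIsom n) (z : Euc (n + 1)) :
    tail (prodIsom e γ z) = γ (tail z) := rfl

theorem prodIsom_mul (e e' : ℝ ≃ᵢ ℝ) (γ γ' : EucIsom n) :
    prodIsom e γ * prodIsom e' γ' = prodIsom (e * e') (γ * γ') := by
  ext1 z
  change prodIsom e γ (prodIsom e' γ' z) = _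
  simp only [prodIsom_apply, cons_zero, tail_cons]
  rfl

theorem prodIsom_one : prodIsom 1 (1 : EucIsom n) = 1 := by
  ext1 z
  exact cons_tail z

theorem prodIsom_inv (e : ℝ ≃ᵢ ℝ) (γ : EucIsom n) :
    (prodIsom e γ)⁻¹ = prodIsom e⁻¹ γ⁻¹ := by
  rw [inv_eq_iff_mul_eq_one, prodIsom_mul, mul_inv_cancel, mul_inv_cancel, prodIsom_one]

end cons

end

section

/-! ### Admissible isometries and geodesic boundaries -/

/-- The isometry `τ` normalizes `Γ`, its square belongs to `Γ`, and it moves each point outside of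
its `Γ`-orbit: the algebraic conditions under which `τ` induces an admissible isometry. -/
structure IsAdmissibleLift {n : ℕ} (Γ : Subgroup (EucIsom n)) (τ : EucIsom n) : Prop where
  conj : ∀ γ ∈ Γ, τ * γ * τ⁻¹ ∈ Γ
  sq : τ * τ ∈ Γ
  ne : ∀ γ ∈ Γ, ∀ x, γ (τ x) ≠ x

variable {n : ℕ} {Γ : Subgroup (EucIsom n)} {τ : EucIsom n}

theorem IsAdmissibleLift.inducesAdmissible (h : IsAdmissibleLift Γ τ) : InducesAdmissible Γ τ := by
  refine ⟨Quotient.map τ ?_, fun x => rfl, fun q => ?_, fun q => ?_⟩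
  · rintro x _ ⟨γ, hγ, rfl⟩
    refine ⟨τ * γ * τ⁻¹, h.conj γ hγ, ?_⟩
    exact congrArg (fun y => τ (γ y)) (τ.symm_apply_apply x)
  · induction q using Quotient.inductionOn with
    | h x => exact Quotient.sound ⟨(τ * τ)⁻¹, Γ.inv_mem h.sq, (τ * τ).symm_apply_apply x⟩
  · induction q using Quotient.inductionOn with
    | h x =>
      intro hx
      obtain ⟨γ, hγ, hγx⟩ := Quotient.exact hx
      exact h.ne γ hγ x hγx

/-- The group of isometries of `E¹ × Eⁿ` generated by `Γ`, acting on the second factor, and the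
product of the reflection of `E¹` in `1` with `τ`. The quotient of `[0, 2] × Eⁿ` by this group is
the mapping cylinder of the projection from `Eⁿ/Γ` to its quotient by the isometry induced by `τ`. -/
def cylinderGroup (h : IsAdmissibleLift Γ τ) : Subgroup (EucIsom (n + 1)) where
  carrier := {g | ∃ γ ∈ Γ, g = prodIsom 1 γ ∨ g = prodIsom (IsometryEquiv.subLeft 2) (γ * τ)}
  one_mem' := ⟨1, Γ.one_mem, Or.inl prodIsom_one.symm⟩
  mul_mem' := by
    have hs : IsometryEquiv.subLeft (2 : ℝ) * IsometryEquiv.subLeft 2 = 1 := by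
      ext x
      change (2 : ℝ) - (2 - x) = x
      ring
    rintro _ _ ⟨γ, hγ, rfl | rfl⟩ ⟨δ, hδ, rfl | rfl⟩
    · exact ⟨γ * δ, Γ.mul_mem hγ hδ, Or.inl (by rw [prodIsom_mul, one_mul])⟩
    · exact ⟨γ * δ, Γ.mul_mem hγ hδ, Or.inr (by rw [prodIsom_mul, one_mul, mul_assoc])⟩
    · refine ⟨γ * (τ * δ * τ⁻¹), Γ.mul_mem hγ (h.conj δ hδ), Or.inr ?_⟩
      rw [prodIsom_mul, mul_one]
      congr 1
      group
    · refine ⟨γ * (τ * δ * τ⁻¹) * (τ * τ),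
        Γ.mul_mem (Γ.mul_mem hγ (h.conj δ hδ)) h.sq, Or.inl ?_⟩
      rw [prodIsom_mul, hs]
      congr 1
      group
  inv_mem' := by
    rintro _ ⟨γ, hγ, rfl | rfl⟩
    · exact ⟨γ⁻¹, Γ.inv_mem hγ, Or.inl (by rw [prodIsom_inv, inv_one])⟩
    · refine ⟨(τ * τ)⁻¹ * (τ * γ⁻¹ * τ⁻¹),
        Γ.mul_mem (Γ.inv_mem h.sq) (h.conj _ (Γ.inv_mem hγ)), Or.inr ?_⟩
      have hs : (IsometryEquiv.subLeft (2 : ℝ))⁻¹ = IsometryEquiv.subLeft 2 := by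
        rw [inv_eq_iff_mul_eq_one]
        ext x
        change (2 : ℝ) - (2 - x) = x
        ring
      rw [prodIsom_inv, hs]
      congr 1
      group

theorem mem_cylinderGroup {h : IsAdmissibleLift Γ τ} {g : EucIsom (n + 1)} :
    g ∈ cylinderGroup h ↔
      ∃ γ ∈ Γ, g = prodIsom 1 γ ∨ g = prodIsom (IsometryEquiv.subLeft 2) (γ * τ) := Iff.rfl

variable (n) in
/-- The part `x 0 < 2` of the half-space. Its points with `1 < x 0` are all glued to points with
`x 0 < 1`, but this open collar makes the gluing a local homeomorphism. -/
def slab : TopologicalSpace.Opens (EuclideanHalfSpace (n + 1)) where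
  carrier := {x | x.1 0 < 2}
  is_open' := isOpen_lt ((EuclideanSpace.proj (0 : Fin (n + 1))).continuous.comp
    continuous_subtype_val) continuous_const

theorem mem_slab {x : EuclideanHalfSpace (n + 1)} : x ∈ slab n ↔ x.1 0 < 2 := Iff.rfl

/-- The point of the slab with first coordinate `t` and other coordinates those of `x`. -/
def slabPoint (p : Set.Ico (0 : ℝ) 2 × Euc n) : slab n := ⟨⟨cons p.1 p.2, p.1.2.1⟩, p.1.2.2⟩

theorem continuous_slabPoint : Continuous (slabPoint (n := n)) :=
  ((continuous_cons.comp (continuous_subtype_val.prodMap continuous_id)).subtype_mk _).subtype_mk _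

theorem isGluing_cylinderGroup (hΓ : IsBieberbach Γ) (h : IsAdmissibleLift Γ τ) :
    IsGluing (cylinderGroup h) (slab n) where
  separated x y := by
    have hfin : {g | g ∈ cylinderGroup h ∧ dist (g x) y ≤ 1}.Finite := by
      refine (((finite_setOf_dist_le hΓ.discrete (tail x) (tail y) 1).image (prodIsom 1)).union
        ((finite_setOf_dist_le hΓ.discrete (τ (tail x)) (tail y) 1).image
          fun γ => prodIsom (IsometryEquiv.subLeft 2) (γ * τ))).subset ?_
      rintro g ⟨⟨γ, hγ, rfl | rfl⟩, hg⟩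
      · refine Or.inl ⟨γ, ⟨hγ, ?_⟩, rfl⟩
        rw [← tail_prodIsom 1 γ]
        exact (dist_tail_le _ _).trans hg
      · refine Or.inr ⟨γ, ⟨hγ, ?_⟩, rfl⟩
        have := (dist_tail_le _ _).trans hg
        rwa [tail_prodIsom] at this
    have hev : ∀ᶠ ε : ℝ in 𝓝[>] 0,
        ∀ g ∈ {g | g ∈ cylinderGroup h ∧ dist (g x) y ≤ 1}, g x ≠ y → 2 * ε < dist (g x) y := by
      rw [eventually_all_finite hfin]
      intro g _
      by_cases hg : g x = y
      · simp [hg]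
      · have hpos : 0 < dist (g x) y / 2 := half_pos (dist_pos.2 hg)
        filter_upwards [Ioo_mem_nhdsGT hpos] with ε hε _
        linarith [hε.2]
    obtain ⟨ε, hε, hε0, hε1⟩ := (hev.and (Ioo_mem_nhdsGT (show (0 : ℝ) < 1 / 2 by norm_num))).exists
    refine ⟨ε, hε0, fun g hg z hz hz' => ?_⟩
    have hd : dist (g x) y < 2 * ε := by
      have := dist_triangle (g x) (g z) y
      rw [g.dist_map, dist_comm x z] at this
      linarith
    by_contra hne
    have := hε g ⟨hg, by linarith⟩ hne
    linarith
  free g hg x hx := by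
    obtain ⟨γ, hγ, rfl | rfl⟩ := hg
    · have hx' := congrArg tail hx
      rw [tail_prodIsom] at hx'
      rw [hΓ.free γ hγ (tail x) hx', prodIsom_one]
    · have hx' := congrArg tail hx
      rw [tail_prodIsom] at hx'
      exact absurd hx' (h.ne γ hγ (tail x))
  stable g hg x y hxy := by
    obtain ⟨γ, hγ, rfl | rfl⟩ := hg
    · exact Eventually.of_forall fun z => ⟨⟨⟨prodIsom 1 γ z.1.1, z.1.2⟩, z.2⟩, rfl⟩
    · have h0 : 2 - x.1.1 0 = y.1.1 0 := congrArg (fun z : Euc (n + 1) => z 0) hxy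
      have h1 : y.1.1 0 < 2 := y.2
      have hc : Continuous fun z : slab n => z.1.1 0 :=
        (EuclideanSpace.proj (0 : Fin (n + 1))).continuous.comp Glued.isInducing_val.continuous
      filter_upwards [(hc.tendsto x).eventually (lt_mem_nhds (show 0 < x.1.1 0 by linarith))]
        with z hz
      have h2 : z.1.1 0 < 2 := z.2
      have h3 : prodIsom (IsometryEquiv.subLeft 2) (γ * τ) z.1.1 0 = 2 - z.1.1 0 := rfl
      refine ⟨⟨⟨prodIsom (IsometryEquiv.subLeft 2) (γ * τ) z.1.1, ?_⟩, ?_⟩, rfl⟩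
      · linarith
      · rw [mem_slab]
        change prodIsom (IsometryEquiv.subLeft 2) (γ * τ) z.1.1 0 < 2
        linarith

/-- The group of the cylinder identifies no point of the boundary hyperplane with a point of the
slab outside this hyperplane. -/
theorem boundary_preserved (h : IsAdmissibleLift Γ τ) :
    ∀ g ∈ cylinderGroup h, ∀ x y : slab n, g x.1.1 = y.1.1 → x.1.1 0 = 0 → y.1.1 0 = 0 := by
  rintro _ ⟨γ, hγ, rfl | rfl⟩ x y hxy hx
  · exact (congrArg (fun z : Euc (n + 1) => z 0) hxy).symm.trans hx
  · have h0 : 2 - x.1.1 0 = y.1.1 0 := congrArg (fun z : Euc (n + 1) => z 0) hxy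
    have h1 : y.1.1 0 < 2 := y.2
    linarith

theorem mk_slabPoint_eq_iff {h : IsAdmissibleLift Γ τ} {x y : Euc n} :
    Glued.mk (cylinderGroup h) (slab n) (slabPoint (⟨0, by simp⟩, x)) =
      Glued.mk (cylinderGroup h) (slab n) (slabPoint (⟨0, by simp⟩, y)) ↔ ∃ γ ∈ Γ, γ x = y := by
  rw [Glued.mk_eq_mk]
  constructor
  · rintro ⟨_, ⟨γ, hγ, rfl | rfl⟩, hg⟩
    · exact ⟨γ, hγ, congrArg tail hg⟩
    · have h0 : (2 : ℝ) - 0 = 0 := congrArg (fun z : Euc (n + 1) => z 0) hg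
      norm_num at h0
  · rintro ⟨γ, hγ, rfl⟩
    exact ⟨_, ⟨γ, hγ, Or.inl rfl⟩, rfl⟩

theorem surjective_mk_slabPoint (h : IsAdmissibleLift Γ τ) : Function.Surjective
    fun p => Glued.mk (cylinderGroup h) (slab n) (slabPoint p) := by
  intro q
  obtain ⟨a, rfl⟩ := Glued.mk_surjective q
  refine ⟨(⟨a.1.1 0, a.1.2, a.2⟩, tail a.1.1), congrArg _ (Subtype.ext (Subtype.ext ?_))⟩
  exact cons_tail a.1.1

theorem compactSpace_glued (hΓ : IsBieberbach Γ) (h : IsAdmissibleLift Γ τ) :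
    CompactSpace (Glued (cylinderGroup h) (slab n)) := by
  obtain ⟨R, hR⟩ := exists_radius_of_compactSpace hΓ.cocompact
  have hK : IsCompact ((Set.univ : Set (Set.Icc (0 : ℝ) 1)) ×ˢ Metric.closedBall (0 : Euc n) R) :=
    isCompact_univ.prod (isCompact_closedBall _ _)
  have hinc : Set.Icc (0 : ℝ) 1 ⊆ Set.Ico 0 2 := fun t ht => ⟨ht.1, by linarith [ht.2]⟩
  have hc : Continuous fun p : Set.Icc (0 : ℝ) 1 × Euc n => Glued.mk (cylinderGroup h) (slab n)
      (slabPoint (Set.inclusion hinc p.1, p.2)) :=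
    Glued.continuous_mk.comp (continuous_slabPoint.comp
      ((continuous_inclusion hinc).prodMap continuous_id))
  refine ⟨(hK.image hc).of_isClosed_subset isClosed_univ fun q _ => ?_⟩
  obtain ⟨⟨⟨t, ht⟩, x⟩, rfl⟩ := surjective_mk_slabPoint h q
  by_cases ht1 : t ≤ 1
  · obtain ⟨γ, hγ, hx⟩ := hR x
    refine ⟨(⟨t, ht.1, ht1⟩, γ x), ⟨Set.mem_univ _, by simpa using hx⟩, ?_⟩
    exact (Glued.mk_eq_mk.2 ⟨_, mem_cylinderGroup.2 ⟨γ, hγ, Or.inl rfl⟩, rfl⟩).symm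
  · obtain ⟨γ, hγ, hx⟩ := hR (τ x)
    refine ⟨(⟨2 - t, by linarith [ht.2], by linarith⟩, γ (τ x)),
      ⟨Set.mem_univ _, by simpa using hx⟩, ?_⟩
    exact (Glued.mk_eq_mk.2 ⟨_, mem_cylinderGroup.2 ⟨γ, hγ, Or.inr rfl⟩, rfl⟩).symm

/-- If `τ` induces an admissible isometry of `Eⁿ/Γ`, then `Eⁿ/Γ` is the totally geodesic boundary of
the mapping cylinder of the projection to the quotient by this isometry. -/
theorem IsAdmissibleLift.isGeodesicBoundary (h : IsAdmissibleLift Γ τ) (hΓ : IsBieberbach Γ) :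
    IsGeodesicBoundary Γ := by
  have := isGluing_cylinderGroup hΓ h
  have := compactSpace_glued hΓ h
  have := hΓ.cocompact
  set M := Glued (cylinderGroup h) (slab n)
  have : ConnectedSpace (Set.Ico (0 : ℝ) 2) :=
    isConnected_iff_connectedSpace.1 (isConnected_Ico (by norm_num))
  have : ConnectedSpace M := (surjective_mk_slabPoint h).connectedSpace
    (Glued.continuous_mk.comp continuous_slabPoint)
  let s : Euc n → slab n := fun x => slabPoint (⟨0, by simp⟩, x)
  have hsd : ContDiff ℝ ∞ fun x => (s x).1.1 := (consZero n).contDiff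
  have hfd (x : Euc n) : fderiv ℝ (fun x => (s x).1.1) x = (consZero n).toContinuousLinearMap :=
    (consZero n).toContinuousLinearMap.fderiv
  have hbd (a : slab n) := Glued.mk_mem_boundary_iff (boundary_preserved h) a
  let F : FlatQuotient Γ → (𝓡∂ (n + 1)).boundary M := Quotient.lift
    (fun x => ⟨Glued.mk _ _ (s x), (hbd _).2 rfl⟩)
    (fun x y hxy => Subtype.ext (mk_slabPoint_eq_iff.2 hxy))
  have hF : Continuous F := Continuous.quotient_lift
    ((Glued.continuous_mk.comp
      (Glued.isInducing_val.continuous_iff.2 hsd.continuous)).subtype_mk _) _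
  have hinj : Function.Injective F := by
    intro p q
    induction p using Quotient.inductionOn with
    | h x =>
      induction q using Quotient.inductionOn with
      | h y =>
        intro hxy
        exact Quotient.sound (mk_slabPoint_eq_iff.1 (congrArg Subtype.val hxy))
  have hsurj : Function.Surjective F := by
    rintro ⟨q, hq⟩
    obtain ⟨a, rfl⟩ := Glued.mk_surjective q
    refine ⟨proj Γ (tail a.1.1), Subtype.ext (congrArg (Glued.mk _ _)
      (a₁ := s (tail a.1.1)) (Subtype.ext (Subtype.ext ?_)))⟩
    change cons 0 (tail a.1.1) = a.1.1
    exact (congrArg (cons · (tail a.1.1)) ((hbd a).1 hq).symm).trans (cons_tail a.1.1)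
  let f : FlatQuotient Γ ≃ₜ (𝓡∂ (n + 1)).boundary M :=
    Continuous.homeoOfEquivCompactToT2 (f := Equiv.ofBijective F ⟨hinj, hsurj⟩) hF
  refine ⟨M, inferInstance, inferInstance, inferInstance, inferInstance, inferInstance,
    inferInstance, Glued.metric _ _, f, Glued.isFlatWithGeodesicBoundary _ _,
    Glued.contMDiff_mk_comp hsd, fun x v w => ?_⟩
  refine (Glued.metric_inner_mfderiv_mk_comp hsd x v w).trans ?_
  rw [hfd]
  exact (consZero n).inner_map_map v w

end

section

/-! ### Isometries which are diagonal in an affine frame -/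

/-- In the affine frame with origin `p` and basis `b`, the isometry `γ` multiplies the `i`-th
coordinate by `ε i` and adds `c i` to it. -/
def IsDiag (b : Module.Basis (Fin 3) ℝ (Euc 3)) (p : Euc 3) (γ : EucIsom 3) (ε c : Fin 3 → ℝ) :
    Prop :=
  ∀ x i, b.repr (γ x - p) i = ε i * b.repr (x - p) i + c i

variable {b : Module.Basis (Fin 3) ℝ (Euc 3)} {p q : Euc 3} {γ δ : EucIsom 3}
  {ε ε' c c' : Fin 3 → ℝ}

theorem IsDiag.congr (h : IsDiag b p γ ε c) (hε : ∀ i, ε i = ε' i) (hc : ∀ i, c i = c' i) :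
    IsDiag b p γ ε' c' := by
  rwa [← funext hε, ← funext hc]

theorem isDiag_one : IsDiag b p 1 1 0 := fun x i => by simp

theorem IsDiag.mul (h : IsDiag b p γ ε c) (h' : IsDiag b p δ ε' c') :
    IsDiag b p (γ * δ) (ε * ε') (fun i => ε i * c' i + c i) := fun x i => by
  change b.repr (γ (δ x) - p) i = _
  rw [h, h', Pi.mul_apply]
  ring

theorem IsDiag.inv (h : IsDiag b p γ ε c) (hε : ∀ i, ε i * ε i = 1) :
    IsDiag b p γ⁻¹ ε (fun i => -(ε i * c i)) := fun x i => by
  have h1 := h (γ⁻¹ x) i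
  rw [show γ (γ⁻¹ x) = x from γ.apply_symm_apply x] at h1
  rw [h1]
  linear_combination -(b.repr (γ⁻¹ x - p) i) * hε i

theorem IsDiag.eq (h : IsDiag b p γ ε c) (h' : IsDiag b p δ ε c) : γ = δ := by
  ext1 x
  have : γ x - p = δ x - p := b.repr.injective (Finsupp.ext fun i => by rw [h, h'])
  simpa using this

theorem translation_apply (v x : Euc 3) : translation v x = v + x := rfl

theorem isDiag_translation (v : Euc 3) : IsDiag b p (translation v) 1 (b.repr v) := fun x i => by
  rw [translation_apply, add_sub_assoc, map_add]
  simp [add_comm]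

theorem IsDiag.eq_translation (h : IsDiag b p γ 1 c) {v : Euc 3} (hv : ∀ i, b.repr v i = c i) :
    γ = translation v :=
  h.eq ((isDiag_translation v).congr (fun _ => rfl) hv)

theorem IsDiag.origin (h : IsDiag b p γ ε c) (q : Euc 3) :
    IsDiag b q γ ε (fun i => c i - (1 - ε i) * b.repr (q - p) i) := fun x i => by
  have h1 := h x i
  rw [← sub_add_sub_cancel (γ x) q p, ← sub_add_sub_cancel x q p, map_add, map_add,
    Finsupp.add_apply, Finsupp.add_apply] at h1
  linear_combination h1

theorem isDiag_of_linear (p : Euc 3) (h : ∀ i, γ.linearIsometryEquiv (b i) = ε i • b i) :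
    IsDiag b p γ ε (b.repr (γ p - p)) := fun x i => by
  have h1 (v : Euc 3) : b.repr (γ.linearIsometryEquiv v) i = ε i * b.repr v i := by
    have h2 : (b.coord i).comp (γ.linearIsometryEquiv.toLinearEquiv : Euc 3 →ₗ[ℝ] Euc 3) =
        ε i • b.coord i := by
      refine b.ext fun j => ?_
      change b.repr (γ.linearIsometryEquiv (b j)) i = ε i * b.repr (b j) i
      rw [h]
      by_cases hij : j = i
      · subst hij; simp
      · simp [hij]
    exact DFunLike.congr_fun h2 v
  have h3 : γ x - p = γ.linearIsometryEquiv (x - p) + (γ p - p) := by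
    rw [apply_eq_linear_add γ x, apply_eq_linear_add γ p, map_sub]
    abel
  rw [h3, map_add, Finsupp.add_apply, h1]

theorem IsDiag.linear (h : IsDiag b p γ ε c) (i : Fin 3) :
    γ.linearIsometryEquiv (b i) = ε i • b i := by
  have h1 : γ.linearIsometryEquiv (b i) = (γ (p + b i) - p) - (γ p - p) := by
    rw [apply_eq_linear_add γ (p + b i), apply_eq_linear_add γ p, map_add]
    abel
  rw [h1]
  refine b.repr.injective (Finsupp.ext fun j => ?_)
  rw [map_sub, Finsupp.sub_apply, h, h]
  by_cases hij : i = j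
  · subst hij; simp
  · simp [hij]

/-- A diagonal isometry whose translation components along the fixed directions vanish has a fixed
point. -/
theorem IsDiag.exists_fixed (h : IsDiag b p γ ε c) (hε : ∀ i, ε i = -1 ∨ c i = 0 ∧ ε i = 1) :
    ∃ x, γ x = x := by
  refine ⟨p + b.repr.symm (Finsupp.equivFunOnFinite.symm fun i => c i / 2), ?_⟩
  have : γ (p + b.repr.symm (Finsupp.equivFunOnFinite.symm fun i => c i / 2)) - p =
      p + b.repr.symm (Finsupp.equivFunOnFinite.symm fun i => c i / 2) - p := by
    refine b.repr.injective (Finsupp.ext fun i => ?_)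
    rw [h, add_sub_cancel_left, LinearEquiv.apply_symm_apply,
      Finsupp.equivFunOnFinite_symm_apply_apply]
    rcases hε i with hi | ⟨hi, hi'⟩
    · rw [hi]; ring
    · rw [hi, hi']; ring
  exact sub_left_injective this

theorem IsDiag.det_eq (h : IsDiag b p γ ε c) :
    LinearMap.det (γ.linearIsometryEquiv.toLinearEquiv : Euc 3 →ₗ[ℝ] Euc 3) = ∏ i, ε i := by
  rw [← LinearMap.det_toMatrix b, ← Matrix.det_diagonal]
  congr 1
  ext i j
  rw [LinearMap.toMatrix_apply]
  change b.repr (γ.linearIsometryEquiv (b j)) i = _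
  rw [h.linear]
  by_cases hij : i = j
  · subst hij; simp
  · simp [hij]

/-- The glide along a subspace `V` is diagonal in a basis adapted to the direction of `V` and to its
orthogonal complement. -/
theorem isDiag_glide (q : Euc 3) (s : Set (Euc 3)) (a : Euc 3)
    (h : ∀ i, (ε i = 1 ∧ b i ∈ Submodule.span ℝ s) ∨ (ε i = -1 ∧ ∀ v ∈ s, inner ℝ v (b i) = 0)) :
    IsDiag b p (glide (subspaceThrough (p + q) s) a) ε
      (fun i => b.repr a i + (1 - ε i) * b.repr q i) := by
  set V := subspaceThrough (p + q) s with hV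
  have hdir : V.direction = Submodule.span ℝ s := AffineSubspace.direction_mk' _ _
  have hmem : p + q ∈ V := AffineSubspace.self_mem_mk' _ _
  set ρ := EuclideanGeometry.reflection V
  have hlin (i : Fin 3) : ρ.linearIsometryEquiv (b i) = ε i • b i := by
    have h0 : ρ (p + q) = p + q := (EuclideanGeometry.reflection_eq_self_iff _).2 hmem
    have h1 : ρ (b i + (p + q)) = ρ.linearIsometryEquiv (b i) + (p + q) := by
      conv_rhs => rw [← h0]
      exact ρ.map_vadd (p + q) (b i)
    rcases h i with ⟨h2, h3⟩ | ⟨h2, h3⟩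
    · have h4 : b i + (p + q) ∈ V := by
        rw [← hdir] at h3
        exact AffineSubspace.vadd_mem_of_mem_direction h3 hmem
      rw [(EuclideanGeometry.reflection_eq_self_iff _).2 h4] at h1
      rw [h2, one_smul]
      exact (add_right_cancel h1).symm
    · have h4 : b i ∈ V.directionᗮ := by
        rw [hdir, Submodule.mem_orthogonal]
        intro v hv
        induction hv using Submodule.span_induction with
        | mem v hv => exact h3 v hv
        | zero => exact inner_zero_left _
        | add v w _ _ hv hw => rw [inner_add_left, hv, hw, add_zero]
        | smul r v _ hv => rw [real_inner_smul_left, hv, mul_zero]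
      have h5 : ρ (b i + (p + q)) = -b i + (p + q) :=
        EuclideanGeometry.reflection_orthogonal_vadd hmem h4
      rw [h5] at h1
      rw [h2, neg_one_smul]
      exact (add_right_cancel h1).symm
  have hd := (isDiag_of_linear (p + q) hlin).origin p
  have h0 : ρ (p + q) = p + q := (EuclideanGeometry.reflection_eq_self_iff _).2 hmem
  refine ((isDiag_translation a).mul hd).congr (fun i => by simp) (fun i => ?_)
  rw [h0]
  simp
  ring

/-! ### A family of crystallographic groups -/

/-- The sign `(-1)ᵏ`. -/
def sgn (k : ℤ) : ℤ := (k.negOnePow : ℤˣ)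

theorem sgn_add (k l : ℤ) : sgn (k + l) = sgn k * sgn l := by simp [sgn, Int.negOnePow_add]

theorem sgn_mul_self (k : ℤ) : sgn k * sgn k = 1 := by
  rw [sgn, ← Units.val_mul, Int.units_mul_self, Units.val_one]

theorem sgn_eq_or (k : ℤ) : sgn k = 1 ∨ sgn k = -1 := by
  rcases Int.units_eq_one_or k.negOnePow with h | h <;> simp [sgn, h]

@[simp] theorem sgn_zero : sgn 0 = 1 := by simp [sgn]

@[simp] theorem sgn_one : sgn 1 = -1 := by simp [sgn]

theorem sgn_neg (k : ℤ) : sgn (-k) = sgn k := by simp [sgn, Int.negOnePow_neg]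

theorem sgn_sgn_mul (k l : ℤ) : sgn (sgn k * l) = sgn l := by
  rcases sgn_eq_or k with h | h <;> simp [h, sgn_neg]

theorem even_sgn_mul_sub (k l : ℤ) : Even (sgn k * l - l) := by
  rcases sgn_eq_or k with h | h
  · simp [h]
  · exact ⟨-l, by rw [h]; ring⟩

/-- The isometries `(x, y, z) ↦ ((-1)^(u j) x + i, y + j, (-1)^(i + v j) z + l)` of an affine frame,
where `i`, `j`, `l` are integers with `w (l + j)` even. For suitable parameters `u`, `v`, `w`, the
groups of each of the four types consist of such isometries. -/
def IsStd (b : Module.Basis (Fin 3) ℝ (Euc 3)) (p : Euc 3) (u v w : ℤ) (γ : EucIsom 3) : Prop :=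
  ∃ i j l : ℤ, Even (w * (l + j)) ∧
    IsDiag b p γ ![(sgn (u * j) : ℝ), 1, (sgn (i + v * j) : ℝ)] ![(i : ℝ), (j : ℝ), (l : ℝ)]

variable {u v w : ℤ}

theorem isStd_one : IsStd b p u v w 1 :=
  ⟨0, 0, 0, by simp, isDiag_one.congr (by intro i; fin_cases i <;> simp)
    (by intro i; fin_cases i <;> simp)⟩

theorem IsStd.mul (h : IsStd b p u v w γ) (h' : IsStd b p u v w δ) :
    IsStd b p u v w (γ * δ) := by
  obtain ⟨i, j, l, he, hd⟩ := h
  obtain ⟨i', j', l', he', hd'⟩ := h'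
  refine ⟨i + sgn (u * j) * i', j + j', l + sgn (i + v * j) * l', ?_,
    (hd.mul hd').congr (fun k => ?_) (fun k => ?_)⟩
  · have := (he.add he').add ((even_sgn_mul_sub (i + v * j) l').mul_left w)
    refine (congrArg Even ?_).mpr this
    ring
  · have h3 : sgn (i + sgn (u * j) * i' + v * (j + j')) = sgn (i + v * j) * sgn (i' + v * j') := by
      rw [mul_add, sgn_add, sgn_add, sgn_add, sgn_sgn_mul, sgn_add, sgn_add]
      ring
    rw [h3, mul_add u, sgn_add (u * j)]
    fin_cases k <;> simp
  · fin_cases k <;> simp <;> ring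

theorem IsStd.inv (h : IsStd b p u v w γ) : IsStd b p u v w γ⁻¹ := by
  obtain ⟨i, j, l, he, hd⟩ := h
  refine ⟨-(sgn (u * j) * i), -j, -(sgn (i + v * j) * l), ?_,
    (hd.inv fun k => ?_).congr (fun k => ?_) (fun k => ?_)⟩
  · have := (he.add ((even_sgn_mul_sub (i + v * j) l).mul_left w)).neg
    refine (congrArg Even ?_).mpr this
    ring
  · fin_cases k
    · simp only [Fin.zero_eta, Matrix.cons_val_zero]
      exact_mod_cast sgn_mul_self _
    · simp
    · simp only [Fin.reduceFinMk, Matrix.cons_val]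
      exact_mod_cast sgn_mul_self _
  · have h3 : sgn (-(sgn (u * j) * i) + v * -j) = sgn (i + v * j) := by
      rw [sgn_add, sgn_neg, sgn_sgn_mul, mul_neg, sgn_neg, ← sgn_add]
    rw [h3, mul_neg, sgn_neg]
  · fin_cases k <;> simp

theorem isStd_of_mem_closure {S : Set (EucIsom 3)} (hS : ∀ γ ∈ S, IsStd b p u v w γ)
    (hγ : γ ∈ Subgroup.closure S) : IsStd b p u v w γ := by
  induction hγ using Subgroup.closure_induction with
  | mem γ h => exact hS γ h
  | one => exact isStd_one
  | mul γ δ _ _ h h' => exact h.mul h'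
  | inv γ _ h => exact h.inv

/-- The only element of the family with a fixed point is the identity: a fixed point forces `j = 0`,
then `i = 0`, then `l = 0`. -/
theorem IsStd.eq_one (h : IsStd b p u v w γ) {x : Euc 3} (hx : γ x = x) : γ = 1 := by
  obtain ⟨i, j, l, -, hd⟩ := h
  have h0 := hd x 0
  have h1 := hd x 1
  have h2 := hd x 2
  rw [hx] at h0 h1 h2
  have hj : j = 0 := by
    simp at h1
    exact_mod_cast h1
  subst hj
  have hi : i = 0 := by
    simp at h0
    exact_mod_cast h0
  subst hi
  have hl : l = 0 := by
    simp at h2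
    exact_mod_cast h2
  subst hl
  exact hd.eq (isDiag_one.congr (by intro i; fin_cases i <;> simp)
    (by intro i; fin_cases i <;> simp))

end

section

variable {b : Module.Basis (Fin 3) ℝ (Euc 3)} {p : Euc 3} {u v w : ℤ} {Γ : Subgroup (EucIsom 3)}

/-- The group of vectors `v` such that the translation `t_v` belongs to `Γ`. -/
def translationLattice {n : ℕ} (Γ : Subgroup (EucIsom n)) : AddSubgroup (Euc n) where
  carrier := {v | translation v ∈ Γ}
  zero_mem' := by
    have h : translation (0 : Euc n) = 1 := by
      ext1 x
      exact zero_add x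
    change translation 0 ∈ Γ
    rw [h]
    exact Γ.one_mem
  add_mem' := by
    intro v w hv hw
    have h : translation (v + w) = translation v * translation w := by
      ext1 x
      exact add_assoc v w x
    change translation (v + w) ∈ Γ
    rw [h]
    exact Γ.mul_mem hv hw
  neg_mem' := by
    intro v hv
    have h : translation (-v) = (translation v)⁻¹ := by
      rw [eq_comm, inv_eq_iff_mul_eq_one]
      ext1 x
      exact add_neg_cancel_left v x
    change translation (-v) ∈ Γ
    rw [h]
    exact Γ.inv_mem hv

theorem mem_translationLattice {n : ℕ} {Γ : Subgroup (EucIsom n)} {v : Euc n} :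
    v ∈ translationLattice Γ ↔ translation v ∈ Γ := Iff.rfl

/-- A group of isometries of the family `IsStd`, which contains the translations by the double of
the vectors of the frame and an element reversing the last vector of the frame only. -/
structure IsStdGroup (b : Module.Basis (Fin 3) ℝ (Euc 3)) (p : Euc 3) (u v w : ℤ)
    (Γ : Subgroup (EucIsom 3)) : Prop where
  std : ∀ γ ∈ Γ, IsStd b p u v w γ
  two_smul_mem : ∀ i, (2 : ℝ) • b i ∈ translationLattice Γ
  reflection : ∃ γ ∈ Γ, ∃ c, IsDiag b p γ ![1, 1, -1] c

theorem IsStdGroup.isNonOrientable (h : IsStdGroup b p u v w Γ) : IsNonOrientable Γ := by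
  obtain ⟨γ, hγ, c, hc⟩ := h.reflection
  refine ⟨γ, hγ, ?_⟩
  rw [hc.det_eq, Fin.prod_univ_three]
  simp

theorem exists_abs_repr_le (b : Module.Basis (Fin 3) ℝ (Euc 3)) :
    ∃ C : ℝ, 0 < C ∧ ∀ v i, |b.repr v i| ≤ C * ‖v‖ := by
  have h (i : Fin 3) : ∃ C : ℝ, 0 < C ∧ ∀ v, |b.repr v i| ≤ C * ‖v‖ :=
    ((b.coord i).toContinuousLinearMap).bound
  choose C hC hb using h
  refine ⟨∑ i, C i, Finset.sum_pos (fun i _ => hC i) Finset.univ_nonempty, fun v i => ?_⟩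
  refine (hb i v).trans (mul_le_mul_of_nonneg_right ?_ (norm_nonneg v))
  exact Finset.single_le_sum (fun j _ => (hC j).le) (Finset.mem_univ i)

theorem IsStdGroup.isDiscreteGroup (h : IsStdGroup b p u v w Γ) : IsDiscreteGroup Γ := by
  obtain ⟨C, hC, hb⟩ := exists_abs_repr_le b
  obtain ⟨t, ht, htb⟩ : ∃ t : ℝ, 0 < t ∧ ∀ i, ‖t • b i‖ ≤ 1 := by
    have hpos : 0 < 1 + ∑ i, ‖b i‖ := by positivity
    refine ⟨(1 + ∑ i, ‖b i‖)⁻¹, by positivity, fun i => ?_⟩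
    rw [norm_smul, Real.norm_of_nonneg (by positivity), inv_mul_le_one₀ hpos]
    have := Finset.single_le_sum (fun j _ => norm_nonneg (b j)) (Finset.mem_univ i)
    linarith
  refine ⟨min t 1 / C, by positivity, fun γ hγ hsmall => ?_⟩
  have hcoord (x : Euc 3) (hx : ‖x‖ ≤ 1) (k : Fin 3) :
      |b.repr (γ x - p) k - b.repr (x - p) k| < min t 1 := by
    have h1 : b.repr (γ x - p) k - b.repr (x - p) k = b.repr (γ x - x) k := by
      rw [← Finsupp.sub_apply, ← map_sub]
      congr 2
      abel
    rw [h1]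
    refine (hb _ _).trans_lt ?_
    have := hsmall x hx
    rwa [dist_eq_norm, lt_div_iff₀ hC, mul_comm] at this
  obtain ⟨i, j, l, -, hd⟩ := h.std γ hγ
  -- a reversed frame vector is moved by twice its length
  have hsign (k : Fin 3) (m : ℤ)
      (hm : (![(sgn (u * j) : ℝ), 1, (sgn (i + v * j) : ℝ)] : Fin 3 → ℝ) k = sgn m) : (sgn m : ℝ) = 1 := by
    rcases sgn_eq_or m with h1 | h1
    · simp [h1]
    · exfalso
      have e0 := abs_lt.1 (hcoord 0 (by simp) k)
      have e1 := abs_lt.1 (hcoord (t • b k) (htb k) k)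
      rw [hd, hm, h1] at e0 e1
      have e2 : b.repr (t • b k - p) k = t + b.repr (0 - p) k := by
        rw [zero_sub, sub_eq_add_neg, map_add]
        simp
      rw [e2] at e1
      push_cast at e0 e1
      have := min_le_left t 1
      linarith [e0.1, e0.2, e1.1, e1.2]
  have h0 := hsign 0 (u * j) rfl
  have h2 := hsign 2 (i + v * j) rfl
  have hint (m : ℤ) (hm : |(m : ℝ)| < min t 1) : m = 0 := by
    have h1 : |(m : ℝ)| < 1 := hm.trans_le (min_le_right _ _)
    exact Int.abs_lt_one_iff.1 (by exact_mod_cast h1)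
  rw [h0, h2] at hd
  have e (k : Fin 3) := hcoord 0 (by simp) k
  simp only [hd 0] at e
  have ei : i = 0 := hint i (by simpa using e 0)
  have ej : j = 0 := hint j (by simpa using e 1)
  have el : l = 0 := hint l (by simpa using e 2)
  subst ei ej el
  exact hd.eq (isDiag_one.congr (by intro i; fin_cases i <;> simp)
    (by intro i; fin_cases i <;> simp))

theorem IsStdGroup.compactSpace (h : IsStdGroup b p u v w Γ) : CompactSpace (FlatQuotient Γ) := by
  have hc : Continuous fun t : Fin 3 → ℝ => proj Γ (p + ∑ i, t i • b i) :=
    continuous_quotient_mk'.comp (by fun_prop)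
  have hK : IsCompact (Set.univ.pi fun _ : Fin 3 => Set.Icc (0 : ℝ) 2) :=
    isCompact_univ_pi fun _ => isCompact_Icc
  refine ⟨(hK.image hc).of_isClosed_subset isClosed_univ fun q _ => ?_⟩
  obtain ⟨x, rfl⟩ := Quotient.exists_rep q
  let m : Fin 3 → ℤ := fun i => ⌊b.repr (x - p) i / 2⌋
  refine ⟨fun i => b.repr (x - p) i - 2 * m i, fun i _ => ⟨?_, ?_⟩, ?_⟩
  · have := Int.floor_le (b.repr (x - p) i / 2)
    change 0 ≤ b.repr (x - p) i - 2 * (⌊b.repr (x - p) i / 2⌋ : ℝ)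
    linarith
  · have := Int.lt_floor_add_one (b.repr (x - p) i / 2)
    change b.repr (x - p) i - 2 * (⌊b.repr (x - p) i / 2⌋ : ℝ) ≤ 2
    linarith
  · refine Quotient.sound ⟨translation (∑ i, m i • ((2 : ℝ) • b i)), ?_, ?_⟩
    · exact (translationLattice Γ).sum_mem fun i _ =>
        (translationLattice Γ).zsmul_mem (h.two_smul_mem i) _
    · rw [translation_apply]
      have hx : x = p + ∑ i, b.repr (x - p) i • b i := by rw [b.sum_repr]; abel
      conv_rhs => rw [hx]
      rw [add_left_comm, ← Finset.sum_add_distrib]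
      congr 1
      refine Finset.sum_congr rfl fun i _ => ?_
      rw [← Int.cast_smul_eq_zsmul ℝ, smul_smul, ← add_smul]
      congr 1
      ring

theorem IsStdGroup.isBieberbach (h : IsStdGroup b p u v w Γ) : IsBieberbach Γ where
  discrete := h.isDiscreteGroup
  cocompact := h.compactSpace
  free γ hγ _ hx := (h.std γ hγ).eq_one hx

/-- Criterion for a translation to induce an admissible isometry, for a group of diagonal
isometries. -/
theorem IsStdGroup.isAdmissibleLift (h : IsStdGroup b p u v w Γ) {t : Euc 3}
    (hconj : ∀ i j : ℤ, ∃ t' ∈ translationLattice Γ, ∀ k, b.repr t' k =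
      (1 - (![(sgn (u * j) : ℝ), 1, (sgn (i + v * j) : ℝ)] : Fin 3 → ℝ) k) * b.repr t k)
    (hsq : t + t ∈ translationLattice Γ)
    (hne : ∀ i j l : ℤ, Even (w * (l + j)) → ∀ x : Fin 3 → ℝ, ∃ k,
      (![(sgn (u * j) : ℝ), 1, (sgn (i + v * j) : ℝ)] : Fin 3 → ℝ) k * (x k + b.repr t k)
        + (![(i : ℝ), (j : ℝ), (l : ℝ)] : Fin 3 → ℝ) k ≠ x k) :
    IsAdmissibleLift Γ (translation t) where
  conj γ hγ := by
    obtain ⟨i, j, l, he, hd⟩ := h.std γ hγ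
    obtain ⟨t', ht', hk⟩ := hconj i j
    have h1 : translation t * γ * (translation t)⁻¹ = translation t' * γ := by
      rw [mul_inv_eq_iff_eq_mul]
      refine IsDiag.eq ((isDiag_translation t).mul hd)
        ((((isDiag_translation t').mul hd).mul (isDiag_translation t)).congr (fun k => ?_)
          fun k => ?_)
      · simp
      · simp only [Pi.mul_apply, Pi.one_apply, one_mul, hk]
        ring
    rw [h1]
    exact Γ.mul_mem ht' hγ
  sq := by
    have h1 : translation t * translation t = translation (t + t) := by
      ext1 x
      exact (add_assoc t t x).symm
    rw [h1]
    exact hsq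
  ne γ hγ x hx := by
    obtain ⟨i, j, l, he, hd⟩ := h.std γ hγ
    obtain ⟨k, hk⟩ := hne i j l he (fun k => b.repr (x - p) k)
    refine hk ?_
    have h1 := hd (translation t x) k
    rw [hx, translation_apply, add_sub_assoc, map_add, Finsupp.add_apply, add_comm (b.repr t k)]
      at h1
    exact h1.symm

theorem IsStdGroup.isAdmissibleLift_half (h : IsStdGroup b p u v w Γ)
    (hmem : b 2 ∈ translationLattice Γ) :
    IsAdmissibleLift Γ (translation ((1 / 2 : ℝ) • b 2)) := by
  refine h.isAdmissibleLift (fun i j => ?_) ?_ (fun i j l he x => ?_)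
  · rcases sgn_eq_or (i + v * j) with h1 | h1
    · refine ⟨0, (translationLattice Γ).zero_mem, fun k => ?_⟩
      fin_cases k <;> simp [h1]
    · refine ⟨b 2, hmem, fun k => ?_⟩
      fin_cases k <;> simp [h1]
      norm_num
  · rw [← add_smul]
    norm_num
    exact hmem
  · by_contra! hk
    have h0 := hk 0
    have h1 := hk 1
    have h2 := hk 2
    have hj : j = 0 := by
      simp at h1
      exact_mod_cast h1
    subst hj
    have hi : i = 0 := by
      simp at h0
      exact_mod_cast h0
    subst hi
    simp at h2
    have h3 : ((1 + 2 * l : ℤ) : ℝ) = 0 := by push_cast; linarith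
    have h4 : 1 + 2 * l = 0 := by exact_mod_cast h3
    omega

theorem IsStdGroup.isAdmissibleLift_last (h : IsStdGroup b p u v 1 Γ) :
    IsAdmissibleLift Γ (translation (b 2)) := by
  refine h.isAdmissibleLift (fun i j => ?_) ?_ (fun i j l he x => ?_)
  · rcases sgn_eq_or (i + v * j) with h1 | h1
    · refine ⟨0, (translationLattice Γ).zero_mem, fun k => ?_⟩
      fin_cases k <;> simp [h1]
    · refine ⟨_, h.two_smul_mem 2, fun k => ?_⟩
      fin_cases k <;> simp [h1]
      norm_num
  · rw [← two_smul ℝ]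
    exact h.two_smul_mem 2
  · by_contra! hk
    have h0 := hk 0
    have h1 := hk 1
    have h2 := hk 2
    have hj : j = 0 := by
      simp at h1
      exact_mod_cast h1
    subst hj
    have hi : i = 0 := by
      simp at h0
      exact_mod_cast h0
    subst hi
    simp at h2
    have h3 : ((1 + l : ℤ) : ℝ) = 0 := by push_cast; linarith
    have h4 : 1 + l = 0 := by exact_mod_cast h3
    obtain ⟨r, hr⟩ := he
    omega

theorem IsStdGroup.isAdmissibleLift_sum (h : IsStdGroup b p 0 1 1 Γ) :
    IsAdmissibleLift Γ (translation (b 0 + b 1)) := by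
  refine h.isAdmissibleLift (fun i j => ?_) ?_ (fun i j l he x => ?_)
  · refine ⟨0, (translationLattice Γ).zero_mem, fun k => ?_⟩
    fin_cases k <;> simp
  · rw [← two_smul ℝ, smul_add]
    exact (translationLattice Γ).add_mem (h.two_smul_mem 0) (h.two_smul_mem 1)
  · by_contra! hk
    have h0 := hk 0
    have h1 := hk 1
    have h2 := hk 2
    simp at h0 h1
    have h0' : ((1 + i : ℤ) : ℝ) = 0 := by push_cast; linarith
    have h1' : ((1 + j : ℤ) : ℝ) = 0 := by push_cast; linarith
    have hi : i = -1 := by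
      have : 1 + i = 0 := by exact_mod_cast h0'
      omega
    have hj : j = -1 := by
      have : 1 + j = 0 := by exact_mod_cast h1'
      omega
    subst hi hj
    have hs : sgn (-2) = 1 := by
      rw [show (-2 : ℤ) = -1 + -1 by norm_num, sgn_add, sgn_neg]
      simp
    simp [hs] at h2
    subst h2
    obtain ⟨r, hr⟩ := he
    omega

end

section

/-! ### The groups of the four types -/

variable {p : Euc 3} {u v w : ℤ} {Γ : Subgroup (EucIsom 3)} {a₁ a₂ a₃ d : Euc 3}

/-- The basis of `E³` formed by three linearly independent vectors. -/
def frame {f : Fin 3 → Euc 3} (h : LinearIndependent ℝ f) : Module.Basis (Fin 3) ℝ (Euc 3) :=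
  basisOfLinearIndependentOfCardEqFinrank h (by simp)

@[simp] theorem frame_apply {f : Fin 3 → Euc 3} (h : LinearIndependent ℝ f) (i : Fin 3) :
    frame h i = f i := by simp [frame]

theorem frame_repr_self {f : Fin 3 → Euc 3} (h : LinearIndependent ℝ f) (i j : Fin 3) :
    (frame h).repr (f i) j = if i = j then 1 else 0 := by
  rw [← frame_apply h, Module.Basis.repr_self, Finsupp.single_apply]

theorem linearIndependent_three {x y z : Euc 3}
    (h : ∀ r s t : ℝ, r • x + s • y + t • z = 0 → r = 0 ∧ s = 0 ∧ t = 0) :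
    LinearIndependent ℝ ![x, y, z] := by
  rw [Fintype.linearIndependent_iff]
  intro g hg
  rw [Fin.sum_univ_three] at hg
  obtain ⟨h0, h1, h2⟩ := h _ _ _ hg
  intro i
  fin_cases i
  exacts [h0, h1, h2]

theorem eq_zero_of_three {x y z : Euc 3} (h : LinearIndependent ℝ ![x, y, z]) {r s t : ℝ}
    (h0 : r • x + s • y + t • z = 0) : r = 0 ∧ s = 0 ∧ t = 0 := by
  have := Fintype.linearIndependent_iff.1 h ![r, s, t] (by
    rw [Fin.sum_univ_three]
    exact h0)
  exact ⟨this 0, this 1, this 2⟩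

variable {b : Module.Basis (Fin 3) ℝ (Euc 3)} {γ δ : EucIsom 3} {ε c : Fin 3 → ℝ}

theorem IsDiag.mem_translationLattice (h : IsDiag b p γ ε c) (hγ : γ ∈ Γ) {x : Euc 3}
    (hε : ∀ i, ε i = 1) (hx : ∀ i, b.repr x i = c i) : x ∈ translationLattice Γ := by
  rw [FlatBoundary.mem_translationLattice, ← (h.congr hε fun _ => rfl).eq_translation hx]
  exact hγ

theorem isStd_translation {x : Euc 3} (i j l : ℤ) (h0 : sgn (u * j) = 1)
    (h2 : sgn (i + v * j) = 1) (hl : Even (w * (l + j)))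
    (hx : x = (i : ℝ) • b 0 + (j : ℝ) • b 1 + (l : ℝ) • b 2) :
    IsStd b p u v w (translation x) := by
  refine ⟨i, j, l, hl, (isDiag_translation x).congr (fun k => ?_) (fun k => ?_)⟩
  · fin_cases k <;> simp [h0, h2]
  · rw [hx]
    fin_cases k <;> simp

/-- A glide reflection in a plane, in a basis adapted to this plane. -/
theorem isDiag_glide_plane (q : Euc 3) {s : Set (Euc 3)} (a : Euc 3)
    (h0 : b 0 ∈ Submodule.span ℝ s) (h1 : b 1 ∈ Submodule.span ℝ s)
    (h2 : ∀ v ∈ s, inner ℝ v (b 2) = 0) :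
    IsDiag b p (glide (subspaceThrough (p + q) s) a) ![1, 1, -1]
      ![b.repr a 0, b.repr a 1, b.repr a 2 + 2 * b.repr q 2] := by
  refine (isDiag_glide (ε := ![1, 1, -1]) q s a fun i => ?_).congr (fun _ => rfl) fun i => ?_
  · fin_cases i
    exacts [Or.inl ⟨rfl, h0⟩, Or.inl ⟨rfl, h1⟩, Or.inr ⟨rfl, h2⟩]
  · fin_cases i <;> simp
    norm_num

/-- A screw motion of angle `π` around a line, in a basis adapted to this line. -/
theorem isDiag_glide_line (q : Euc 3) {s : Set (Euc 3)} (a : Euc 3)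
    (h0 : ∀ v ∈ s, inner ℝ v (b 0) = 0) (h1 : b 1 ∈ Submodule.span ℝ s)
    (h2 : ∀ v ∈ s, inner ℝ v (b 2) = 0) :
    IsDiag b p (glide (subspaceThrough (p + q) s) a) ![-1, 1, -1]
      ![b.repr a 0 + 2 * b.repr q 0, b.repr a 1, b.repr a 2 + 2 * b.repr q 2] := by
  refine (isDiag_glide (ε := ![-1, 1, -1]) q s a fun i => ?_).congr (fun _ => rfl) fun i => ?_
  · fin_cases i
    exacts [Or.inr ⟨rfl, h0⟩, Or.inl ⟨rfl, h1⟩, Or.inr ⟨rfl, h2⟩]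
  · fin_cases i <;> simp <;> norm_num

theorem smul_mem_span {s : Set (Euc 3)} {x : Euc 3} (r : ℝ) (h : x ∈ s) :
    r • x ∈ Submodule.span ℝ s :=
  Submodule.smul_mem _ _ (Submodule.subset_span h)

theorem linearIndependent_smul {x y z : Euc 3} {r s t : ℝ} (hr : r ≠ 0) (hs : s ≠ 0) (ht : t ≠ 0)
    (h : LinearIndependent ℝ ![x, y, z]) : LinearIndependent ℝ ![r • x, s • y, t • z] := by
  refine linearIndependent_three fun r' s' t' h' => ?_
  rw [smul_smul, smul_smul, smul_smul] at h'
  obtain ⟨h0, h1, h2⟩ := eq_zero_of_three h h'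
  exact ⟨(mul_eq_zero.1 h0).resolve_right hr, (mul_eq_zero.1 h1).resolve_right hs,
    (mul_eq_zero.1 h2).resolve_right ht⟩

theorem linearIndependent_reverse {x y z : Euc 3} (h : LinearIndependent ℝ ![x, y, z]) :
    LinearIndependent ℝ ![z, y, x] := by
  refine linearIndependent_three fun r s t h' => ?_
  obtain ⟨h0, h1, h2⟩ := eq_zero_of_three h (r := t) (s := s) (t := r) (by rw [← h']; abel)
  exact ⟨h2, h1, h0⟩

theorem IsTypeB₁.exists_isStdGroup (h : IsTypeB₁ Γ a₁ a₂ a₃) :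
    ∃ b p, IsStdGroup b p 0 0 0 Γ ∧ b 2 = a₁ ∧ b 2 ∈ translationLattice Γ := by
  obtain ⟨hli, h12, h13, p, hΓ⟩ := h
  have hli' : LinearIndependent ℝ ![(1 / 2 : ℝ) • a₃, a₂, a₁] := by
    have := linearIndependent_smul (r := 1 / 2) (s := 1) (t := 1) (by norm_num) (by norm_num)
      (by norm_num) (linearIndependent_reverse hli)
    simpa using this
  set b := frame hli'
  have b0 : b 0 = (1 / 2 : ℝ) • a₃ := frame_apply hli' 0
  have b1 : b 1 = a₂ := frame_apply hli' 1
  have b2 : b 2 = a₁ := frame_apply hli' 2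
  set α := glide (subspaceThrough p {a₂, a₃}) ((1 / 2 : ℝ) • a₃) with hα_def
  have hα : IsDiag b p α ![1, 1, -1] ![1, 0, 0] := by
    have := isDiag_glide_plane (b := b) (p := p) (s := {a₂, a₃}) 0 ((1 / 2 : ℝ) • a₃)
      (b0 ▸ smul_mem_span _ (by simp)) (b1 ▸ Submodule.subset_span (by simp)) (by
        rw [b2]
        rintro v (rfl | rfl) <;> rw [real_inner_comm] <;> assumption)
    rw [add_zero, ← hα_def, ← b0] at this
    exact this.congr (fun i => rfl) fun i => by fin_cases i <;> simp
  have hmem : ∀ g ∈ ({translation a₁, translation a₂, α} : Set (EucIsom 3)), g ∈ Γ := by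
    rw [hΓ]; exact fun g hg => Subgroup.subset_closure hg
  have hα' := hmem α (by simp)
  have ha1 : b 2 ∈ translationLattice Γ := b2 ▸ hmem (translation a₁) (by simp)
  have ha2 : b 1 ∈ translationLattice Γ := b1 ▸ hmem (translation a₂) (by simp)
  refine ⟨b, p, ⟨fun γ hγ => ?_, fun i => ?_, _, hα', _, hα⟩, b2, ha1⟩
  · rw [hΓ] at hγ
    refine isStd_of_mem_closure ?_ hγ
    rintro g (rfl | rfl | rfl)
    · exact isStd_translation 0 0 1 (by simp) (by simp) (by simp) (by simp [b2])
    · exact isStd_translation 0 1 0 (by simp) (by simp) (by simp) (by simp [b1])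
    · exact ⟨1, 0, 0, by simp, hα.congr (fun i => by fin_cases i <;> simp)
        (fun i => by fin_cases i <;> simp)⟩
  · fin_cases i
    · exact (hα.mul hα).mem_translationLattice (Γ.mul_mem hα' hα')
        (fun i => by fin_cases i <;> simp) (fun i => by fin_cases i <;> (simp; try norm_num))
    · exact (two_smul ℝ (b 1)).symm ▸ add_mem ha2 ha2
    · exact (two_smul ℝ (b 2)).symm ▸ add_mem ha1 ha1

theorem IsTypeB₂.exists_isStdGroup (h : IsTypeB₂ Γ a₁ a₂ d) :
    ∃ b p, IsStdGroup b p 0 1 1 Γ ∧ b 0 = (1 / 2 : ℝ) • a₁ ∧ b 1 = (1 / 2 : ℝ) • a₂ ∧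
      b 2 = (2 : ℝ) • d := by
  obtain ⟨hli, h13, h23, p, hΓ⟩ := h
  have hli' : LinearIndependent ℝ ![(1 / 2 : ℝ) • a₁, (1 / 2 : ℝ) • a₂, (2 : ℝ) • d] :=
    linearIndependent_smul (by norm_num) (by norm_num) (by norm_num) hli
  set b := frame hli'
  have b0 : b 0 = (1 / 2 : ℝ) • a₁ := frame_apply hli' 0
  have b1 : b 1 = (1 / 2 : ℝ) • a₂ := frame_apply hli' 1
  have b2 : b 2 = (2 : ℝ) • d := frame_apply hli' 2
  have hd : d = (1 / 2 : ℝ) • b 2 := by rw [b2, smul_smul]; norm_num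
  have hs0 : b 0 ∈ Submodule.span ℝ {a₁, a₂} := b0 ▸ smul_mem_span _ (by simp)
  have hs1 : b 1 ∈ Submodule.span ℝ {a₁, a₂} := b1 ▸ smul_mem_span _ (by simp)
  have hs2 : ∀ v ∈ ({a₁, a₂} : Set (Euc 3)), inner ℝ v (b 2) = 0 := by
    rintro v (rfl | rfl) <;> rw [b2, real_inner_smul_right, mul_eq_zero] <;> right <;> assumption
  set α := glide (subspaceThrough p {a₁, a₂}) ((1 / 2 : ℝ) • a₁) with hα_def
  set β := glide (subspaceThrough (p + d) {a₁, a₂}) ((1 / 2 : ℝ) • a₂) with hβ_def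
  have hα : IsDiag b p α ![1, 1, -1] ![1, 0, 0] := by
    have := isDiag_glide_plane (b := b) (p := p) 0 ((1 / 2 : ℝ) • a₁) hs0 hs1 hs2
    rw [add_zero, ← hα_def, ← b0] at this
    exact this.congr (fun i => rfl) fun i => by fin_cases i <;> simp
  have hβ : IsDiag b p β ![1, 1, -1] ![0, 1, 1] := by
    have := isDiag_glide_plane (b := b) (p := p) d ((1 / 2 : ℝ) • a₂) hs0 hs1 hs2
    rw [← hβ_def, ← b1, hd] at this
    exact this.congr (fun i => rfl) fun i => by fin_cases i <;> simp
  have hmem : ∀ g ∈ ({α, β} : Set (EucIsom 3)), g ∈ Γ := by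
    rw [hΓ]; exact fun g hg => Subgroup.subset_closure hg
  have hα' := hmem α (by simp)
  have hβ' := hmem β (by simp)
  have hT0 : (2 : ℝ) • b 0 ∈ translationLattice Γ :=
    (hα.mul hα).mem_translationLattice (Γ.mul_mem hα' hα')
      (fun i => by fin_cases i <;> simp) (fun i => by fin_cases i <;> (simp; try norm_num))
  have hT1 : (2 : ℝ) • b 1 ∈ translationLattice Γ :=
    (hβ.mul hβ).mem_translationLattice (Γ.mul_mem hβ' hβ')
      (fun i => by fin_cases i <;> simp) (fun i => by fin_cases i <;> (simp; try norm_num))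
  have hsum : b 0 + b 1 + b 2 ∈ translationLattice Γ :=
    (hβ.mul hα).mem_translationLattice (Γ.mul_mem hβ' hα')
      (fun i => by fin_cases i <;> simp) (fun i => by fin_cases i <;> simp)
  refine ⟨b, p, ⟨fun γ hγ => ?_, fun i => ?_, _, hα', _, hα⟩, b0, b1, b2⟩
  · rw [hΓ] at hγ
    refine isStd_of_mem_closure ?_ hγ
    rintro g (rfl | rfl)
    · exact ⟨1, 0, 0, by simp, hα.congr (fun i => by fin_cases i <;> simp)
        (fun i => by fin_cases i <;> simp)⟩
    · exact ⟨0, 1, 1, by decide, hβ.congr (fun i => by fin_cases i <;> simp)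
        (fun i => by fin_cases i <;> simp)⟩
  · fin_cases i
    · exact hT0
    · exact hT1
    · have := sub_mem (sub_mem (add_mem hsum hsum) hT0) hT1
      convert this using 1
      simp only [Fin.reduceFinMk, two_smul]
      abel

theorem IsTypeB₃.exists_isStdGroup (h : IsTypeB₃ Γ a₁ a₂ a₃) :
    ∃ b p, IsStdGroup b p 1 1 0 Γ ∧ b 2 = a₃ ∧ b 2 ∈ translationLattice Γ := by
  obtain ⟨hli, h12, h13, h23, p, hΓ⟩ := h
  have hli' : LinearIndependent ℝ ![(1 / 2 : ℝ) • a₁, (1 / 2 : ℝ) • a₂, a₃] := by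
    have := linearIndependent_smul (r := 1 / 2) (s := 1 / 2) (t := 1) (by norm_num) (by norm_num)
      (by norm_num) hli
    simpa using this
  set b := frame hli'
  have b0 : b 0 = (1 / 2 : ℝ) • a₁ := frame_apply hli' 0
  have b1 : b 1 = (1 / 2 : ℝ) • a₂ := frame_apply hli' 1
  have b2 : b 2 = a₃ := frame_apply hli' 2
  set α := glide (subspaceThrough p {a₁, a₂}) ((1 / 2 : ℝ) • a₁) with hα_def
  set β := glide (subspaceThrough p {a₂}) ((1 / 2 : ℝ) • a₂) with hβ_def
  have hα : IsDiag b p α ![1, 1, -1] ![1, 0, 0] := by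
    have := isDiag_glide_plane (b := b) (p := p) (s := {a₁, a₂}) 0 ((1 / 2 : ℝ) • a₁)
      (b0 ▸ smul_mem_span _ (by simp)) (b1 ▸ smul_mem_span _ (by simp)) (by
        rw [b2]
        rintro v (rfl | rfl) <;> assumption)
    rw [add_zero, ← hα_def, ← b0] at this
    exact this.congr (fun i => rfl) fun i => by fin_cases i <;> simp
  have hβ : IsDiag b p β ![-1, 1, -1] ![0, 1, 0] := by
    have := isDiag_glide_line (b := b) (p := p) (s := {a₂}) 0 ((1 / 2 : ℝ) • a₂)
      (by
        rw [b0]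
        rintro v rfl
        rw [real_inner_smul_right, real_inner_comm, h12, mul_zero])
      (b1 ▸ smul_mem_span _ (by simp)) (by
        rw [b2]
        rintro v rfl
        assumption)
    rw [add_zero, ← hβ_def, ← b1] at this
    exact this.congr (fun i => rfl) fun i => by fin_cases i <;> simp
  have hmem : ∀ g ∈ ({translation a₃, α, β} : Set (EucIsom 3)), g ∈ Γ := by
    rw [hΓ]; exact fun g hg => Subgroup.subset_closure hg
  have hα' := hmem α (by simp)
  have hβ' := hmem β (by simp)
  have ha3 : b 2 ∈ translationLattice Γ := b2 ▸ hmem (translation a₃) (by simp)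
  refine ⟨b, p, ⟨fun γ hγ => ?_, fun i => ?_, _, hα', _, hα⟩, b2, ha3⟩
  · rw [hΓ] at hγ
    refine isStd_of_mem_closure ?_ hγ
    rintro g (rfl | rfl | rfl)
    · exact isStd_translation 0 0 1 (by simp) (by simp) (by simp) (by simp [b2])
    · exact ⟨1, 0, 0, by simp, hα.congr (fun i => by fin_cases i <;> simp)
        (fun i => by fin_cases i <;> simp)⟩
    · exact ⟨0, 1, 0, by simp, hβ.congr (fun i => by fin_cases i <;> simp)
        (fun i => by fin_cases i <;> simp)⟩
  · fin_cases i
    · exact (hα.mul hα).mem_translationLattice (Γ.mul_mem hα' hα')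
        (fun i => by fin_cases i <;> simp) (fun i => by fin_cases i <;> (simp; try norm_num))
    · exact (hβ.mul hβ).mem_translationLattice (Γ.mul_mem hβ' hβ')
        (fun i => by fin_cases i <;> simp) (fun i => by fin_cases i <;> (simp; try norm_num))
    · exact (two_smul ℝ (b 2)).symm ▸ add_mem ha3 ha3

theorem IsTypeB₄.exists_isStdGroup (h : IsTypeB₄ Γ a₁ a₂ a₃) :
    ∃ b p, IsStdGroup b p 1 1 1 Γ ∧ b 2 = (1 / 2 : ℝ) • a₃ := by
  obtain ⟨hli, h12, h13, h23, p, hΓ⟩ := h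
  have hli' : LinearIndependent ℝ ![(1 / 2 : ℝ) • a₁, (1 / 2 : ℝ) • a₂, (1 / 2 : ℝ) • a₃] :=
    linearIndependent_smul (by norm_num) (by norm_num) (by norm_num) hli
  set b := frame hli'
  have b0 : b 0 = (1 / 2 : ℝ) • a₁ := frame_apply hli' 0
  have b1 : b 1 = (1 / 2 : ℝ) • a₂ := frame_apply hli' 1
  have b2 : b 2 = (1 / 2 : ℝ) • a₃ := frame_apply hli' 2
  have hd : (1 / 4 : ℝ) • a₃ = (1 / 2 : ℝ) • b 2 := by rw [b2, smul_smul]; norm_num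
  set α := glide (subspaceThrough p {a₁, a₂}) ((1 / 2 : ℝ) • a₁) with hα_def
  set β := glide (subspaceThrough (p + (1 / 4 : ℝ) • a₃) {a₂}) ((1 / 2 : ℝ) • a₂) with hβ_def
  have hα : IsDiag b p α ![1, 1, -1] ![1, 0, 0] := by
    have := isDiag_glide_plane (b := b) (p := p) (s := {a₁, a₂}) 0 ((1 / 2 : ℝ) • a₁)
      (b0 ▸ smul_mem_span _ (by simp)) (b1 ▸ smul_mem_span _ (by simp)) (by
        rw [b2]
        rintro v (rfl | rfl) <;> rw [real_inner_smul_right, mul_eq_zero] <;> right <;> assumption)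
    rw [add_zero, ← hα_def, ← b0] at this
    exact this.congr (fun i => rfl) fun i => by fin_cases i <;> simp
  have hβ : IsDiag b p β ![-1, 1, -1] ![0, 1, 1] := by
    have := isDiag_glide_line (b := b) (p := p) (s := {a₂}) ((1 / 4 : ℝ) • a₃) ((1 / 2 : ℝ) • a₂)
      (by
        rw [b0]
        rintro v rfl
        rw [real_inner_smul_right, real_inner_comm, h12, mul_zero])
      (b1 ▸ smul_mem_span _ (by simp)) (by
        rw [b2]
        rintro v rfl
        rw [real_inner_smul_right, h23, mul_zero])
    rw [← hβ_def, ← b1, hd] at this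
    exact this.congr (fun i => rfl) fun i => by fin_cases i <;> simp
  have hmem : ∀ g ∈ ({α, β} : Set (EucIsom 3)), g ∈ Γ := by
    rw [hΓ]; exact fun g hg => Subgroup.subset_closure hg
  have hα' := hmem α (by simp)
  have hβ' := hmem β (by simp)
  have hT1 : (2 : ℝ) • b 1 ∈ translationLattice Γ :=
    (hβ.mul hβ).mem_translationLattice (Γ.mul_mem hβ' hβ')
      (fun i => by fin_cases i <;> simp) (fun i => by fin_cases i <;> (simp; try norm_num))
  have hαβ := hα.mul hβ
  have hαβ' := Γ.mul_mem hα' hβ'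
  have hT12 : (2 : ℝ) • b 1 - (2 : ℝ) • b 2 ∈ translationLattice Γ :=
    (hαβ.mul hαβ).mem_translationLattice (Γ.mul_mem hαβ' hαβ')
      (fun i => by fin_cases i <;> simp) (fun i => by fin_cases i <;> (simp; try norm_num))
  refine ⟨b, p, ⟨fun γ hγ => ?_, fun i => ?_, _, hα', _, hα⟩, b2⟩
  · rw [hΓ] at hγ
    refine isStd_of_mem_closure ?_ hγ
    rintro g (rfl | rfl)
    · exact ⟨1, 0, 0, by simp, hα.congr (fun i => by fin_cases i <;> simp)
        (fun i => by fin_cases i <;> simp)⟩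
    · exact ⟨0, 1, 1, by decide, hβ.congr (fun i => by fin_cases i <;> simp)
        (fun i => by fin_cases i <;> simp)⟩
  · fin_cases i
    · exact (hα.mul hα).mem_translationLattice (Γ.mul_mem hα' hα')
        (fun i => by fin_cases i <;> simp) (fun i => by fin_cases i <;> (simp; try norm_num))
    · exact hT1
    · simpa using sub_mem hT1 hT12

theorem IsTypeB₁.isAdmissibleLift (h : IsTypeB₁ Γ a₁ a₂ a₃) :
    IsAdmissibleLift Γ (translation ((1 / 2 : ℝ) • a₁)) := by
  obtain ⟨b, p, hs, rfl, hm⟩ := h.exists_isStdGroup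
  exact hs.isAdmissibleLift_half hm

theorem IsTypeB₂.isAdmissibleLift (h : IsTypeB₂ Γ a₁ a₂ d) :
    IsAdmissibleLift Γ (translation ((2 : ℝ) • d)) := by
  obtain ⟨b, p, hs, -, -, h2⟩ := h.exists_isStdGroup
  exact h2 ▸ hs.isAdmissibleLift_last

theorem IsTypeB₂.isAdmissibleLift_sum (h : IsTypeB₂ Γ a₁ a₂ d) :
    IsAdmissibleLift Γ (translation ((1 / 2 : ℝ) • (a₁ + a₂))) := by
  obtain ⟨b, p, hs, h0, h1, -⟩ := h.exists_isStdGroup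
  rw [smul_add, ← h0, ← h1]
  exact hs.isAdmissibleLift_sum

theorem IsTypeB₃.isAdmissibleLift (h : IsTypeB₃ Γ a₁ a₂ a₃) :
    IsAdmissibleLift Γ (translation ((1 / 2 : ℝ) • a₃)) := by
  obtain ⟨b, p, hs, rfl, hm⟩ := h.exists_isStdGroup
  exact hs.isAdmissibleLift_half hm

theorem IsTypeB₄.isAdmissibleLift (h : IsTypeB₄ Γ a₁ a₂ a₃) :
    IsAdmissibleLift Γ (translation ((1 / 2 : ℝ) • a₃)) := by
  obtain ⟨b, p, hs, h2⟩ := h.exists_isStdGroup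
  exact h2 ▸ hs.isAdmissibleLift_last

end

section

/-! ### Linear parts of the elements of a non-orientable group -/

/-- The linear isometry `L` is the orthogonal reflection in the plane with unit normal `n`. -/
def IsPlaneReflection (L : Euc 3 ≃ₗᵢ[ℝ] Euc 3) (n : Euc 3) : Prop :=
  ‖n‖ = 1 ∧ ∀ v, L v = v - (2 * inner ℝ n v) • n

variable {Γ : Subgroup (EucIsom 3)} {L : Euc 3 ≃ₗᵢ[ℝ] Euc 3} {n m k : Euc 3}

theorem IsPlaneReflection.inner_self (h : IsPlaneReflection L n) : inner ℝ n n = 1 := by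
  rw [real_inner_self_eq_norm_sq, h.1, one_pow]

theorem IsPlaneReflection.apply_apply (h : IsPlaneReflection L n) (v : Euc 3) : L (L v) = v := by
  rw [h.2 (L v), h.2 v, inner_sub_right, real_inner_smul_right, h.inner_self]
  module

theorem IsPlaneReflection.apply_of_inner_eq_zero (h : IsPlaneReflection L n) {v : Euc 3}
    (hv : inner ℝ n v = 0) : L v = v := by
  rw [h.2, hv]
  simp

theorem det_lin_mul (L L' : Euc 3 ≃ₗᵢ[ℝ] Euc 3) :
    LinearMap.det ((L * L').toLinearEquiv : Euc 3 →ₗ[ℝ] Euc 3) =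
      LinearMap.det (L.toLinearEquiv : Euc 3 →ₗ[ℝ] Euc 3) *
        LinearMap.det (L'.toLinearEquiv : Euc 3 →ₗ[ℝ] Euc 3) := by
  rw [← LinearMap.det_comp]
  rfl

theorem reflection_span_singleton (v : Euc 3) :
    (ℝ ∙ v)ᗮ.reflection = 1 ∨ (LinearMap.det
      ((ℝ ∙ v)ᗮ.reflection.toLinearEquiv : Euc 3 →ₗ[ℝ] Euc 3) = -1 ∧
        ∃ n, IsPlaneReflection (ℝ ∙ v)ᗮ.reflection n) := by
  by_cases hv : v = 0
  · left
    ext1 x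
    subst hv
    exact (Submodule.reflection_eq_self_iff x).2 (by simp)
  · right
    refine ⟨?_, ‖v‖⁻¹ • v, ?_, fun w => ?_⟩
    · have := Submodule.det_reflection (ℝ ∙ v)ᗮ
      rw [Submodule.orthogonal_orthogonal, finrank_span_singleton hv, pow_one] at this
      exact this
    · rw [norm_smul, norm_inv, norm_norm, inv_mul_cancel₀ (norm_ne_zero_iff.2 hv)]
    · rw [Submodule.reflection_orthogonal_apply, Submodule.reflection_singleton_apply,
        real_inner_smul_left]
      have hv' := norm_ne_zero_iff.2 hv
      simp only [RCLike.ofReal_real_eq_id, id_eq]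
      rw [neg_sub, smul_smul, two_smul ℕ, ← add_smul]
      congr 2
      field_simp
      ring

/-- An orientation-reversing linear isometry of `E³` with a nonzero fixed vector is the reflection
in a plane. -/
theorem exists_isPlaneReflection
    (hdet : LinearMap.det (L.toLinearEquiv : Euc 3 →ₗ[ℝ] Euc 3) < 0) {u : Euc 3} (hu : u ≠ 0)
    (hLu : L u = u) : ∃ n, IsPlaneReflection L n := by
  have hone : LinearMap.det ((1 : Euc 3 ≃ₗᵢ[ℝ] Euc 3).toLinearEquiv : Euc 3 →ₗ[ℝ] Euc 3) = 1 :=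
    LinearMap.det_id
  have hrank : Module.finrank ℝ (ContinuousLinearMap.id ℝ (Euc 3) - L).kerᗮ ≤ 2 := by
    set K := (ContinuousLinearMap.id ℝ (Euc 3) - L).ker
    have h1 : 0 < Module.finrank ℝ K := by
      rw [Module.finrank_pos_iff_exists_ne_zero]
      refine ⟨⟨u, ?_⟩, fun h => hu (congrArg Subtype.val h)⟩
      change u - L u = 0
      rw [hLu, sub_self]
    have h2 := K.finrank_add_finrank_orthogonal
    rw [finrank_euclideanSpace, Fintype.card_fin] at h2
    omega
  obtain ⟨l, hl, rfl⟩ := L.reflections_generate_dim_aux hrank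
  match l, hl with
  | [], _ =>
    rw [List.map_nil, List.prod_nil, hone] at hdet
    norm_num at hdet
  | [a], _ =>
    rw [List.map_singleton, List.prod_singleton] at hdet ⊢
    rcases reflection_span_singleton a with h | ⟨-, h⟩
    · rw [h, hone] at hdet
      norm_num at hdet
    · exact h
  | [a, c], _ =>
    rw [List.map_cons, List.map_singleton, List.prod_cons, List.prod_singleton] at hdet ⊢
    rcases reflection_span_singleton a with h | ⟨h1, h⟩ <;>
      rcases reflection_span_singleton c with h' | ⟨h1', h'⟩
    · rw [h, h', mul_one, hone] at hdet
      norm_num at hdet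
    · rw [h, one_mul]
      exact h'
    · rw [h', mul_one]
      exact h
    · rw [det_lin_mul, h1, h1'] at hdet
      norm_num at hdet

/-- The linear part of an element of a group acting freely fixes a nonzero vector. -/
theorem exists_fixed_vector (hfree : ∀ γ ∈ Γ, ∀ x : Euc 3, γ x = x → γ = 1) {γ : EucIsom 3}
    (hγ : γ ∈ Γ) : ∃ u, u ≠ 0 ∧ γ.linearIsometryEquiv u = u := by
  by_contra! h
  let f : Euc 3 →ₗ[ℝ] Euc 3 := (γ.linearIsometryEquiv.toLinearEquiv : Euc 3 →ₗ[ℝ] Euc 3) -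
    LinearMap.id
  have hf (v : Euc 3) : f v = γ.linearIsometryEquiv v - v := rfl
  have hinj : Function.Injective f := by
    rw [injective_iff_map_eq_zero]
    intro v hv
    by_contra hv0
    rw [hf, sub_eq_zero] at hv
    exact h v hv0 hv
  obtain ⟨x, hx⟩ := LinearMap.injective_iff_surjective.1 hinj (-γ 0)
  rw [hf] at hx
  have hx' : γ x = x := by
    rw [apply_eq_linear_add, sub_eq_iff_eq_add.1 hx]
    abel
  obtain ⟨u, hu⟩ := exists_ne (0 : Euc 3)
  refine h u hu ?_
  rw [hfree γ hγ x hx']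
  rfl

theorem eq_zero_of_inner_eq_zero {x y z w : Euc 3} (h : LinearIndependent ℝ ![x, y, z])
    (hx : inner ℝ x w = 0) (hy : inner ℝ y w = 0) (hz : inner ℝ z w = 0) : w = 0 := by
  rw [← inner_self_eq_zero (𝕜 := ℝ)]
  nth_rewrite 1 [← (frame h).sum_repr w]
  rw [Fin.sum_univ_three]
  simp [inner_add_left, real_inner_smul_left, hx, hy, hz]

theorem linearIndependent_of_orthonormal (hn : ‖n‖ = 1) (hm : ‖m‖ = 1) (hk : ‖k‖ = 1)
    (hnm : inner ℝ n m = 0) (hnk : inner ℝ n k = 0) (hmk : inner ℝ m k = 0) :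
    LinearIndependent ℝ ![n, m, k] := by
  refine linearIndependent_three fun r s t h => ⟨?_, ?_, ?_⟩
  · have := congrArg (inner ℝ n) h
    simpa [inner_add_right, real_inner_smul_right, hnm, hnk, real_inner_self_eq_norm_sq, hn]
      using this
  · have := congrArg (inner ℝ m) h
    rw [real_inner_comm] at hnm
    simpa [inner_add_right, real_inner_smul_right, hnm, hmk, real_inner_self_eq_norm_sq, hm]
      using this
  · have := congrArg (inner ℝ k) h
    rw [real_inner_comm] at hnk hmk
    simpa [inner_add_right, real_inner_smul_right, hnk, hmk, real_inner_self_eq_norm_sq, hk]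
      using this

/-- In a group acting freely, the planes of two reflections which are linear parts of elements of
the group are equal or orthogonal. Otherwise the linear part of the commutator of two such elements
is a nontrivial rotation around the intersection of the two planes, while its translation part is
orthogonal to this intersection, so that it has a fixed point. -/
theorem inner_eq_zero_or_eq (hfree : ∀ γ ∈ Γ, ∀ x : Euc 3, γ x = x → γ = 1) {α β : EucIsom 3}
    (hα : α ∈ Γ) (hβ : β ∈ Γ) (hn : IsPlaneReflection α.linearIsometryEquiv n)
    (hm : IsPlaneReflection β.linearIsometryEquiv m) :
    inner ℝ n m = 0 ∨ m = n ∨ m = -n := by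
  by_contra! hcon
  obtain ⟨hc, hne, hne'⟩ := hcon
  set A := α.linearIsometryEquiv
  set B := β.linearIsometryEquiv
  have hind (s t : ℝ) (hst : s • n = t • m) : s = 0 ∧ t = 0 := by
    have hn0 : n ≠ 0 := norm_ne_zero_iff.1 (hn.1 ▸ one_ne_zero)
    have habs : |s| = |t| := by
      have := congrArg norm hst
      rwa [norm_smul, norm_smul, hn.1, hm.1, mul_one, mul_one] at this
    rcases abs_eq_abs.1 habs with h | h
    · by_cases ht : t = 0
      · exact ⟨h.trans ht, ht⟩
      · rw [h] at hst
        exact absurd (smul_right_injective _ ht hst).symm hne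
    · by_cases ht : t = 0
      · exact ⟨by rw [h, ht, neg_zero], ht⟩
      · rw [h, neg_smul, ← smul_neg] at hst
        exact absurd (smul_right_injective _ ht hst).symm hne'
  obtain ⟨u, hu, hnu, hmu⟩ : ∃ u : Euc 3, u ≠ 0 ∧ inner ℝ n u = 0 ∧ inner ℝ m u = 0 := by
    set K := Submodule.span ℝ (Set.range ![n, m])
    have h1 : Module.finrank ℝ K ≤ 2 := (finrank_range_le_card ![n, m])
    have h2 := K.finrank_add_finrank_orthogonal
    rw [finrank_euclideanSpace, Fintype.card_fin] at h2
    have h3 : 0 < Module.finrank ℝ Kᗮ := by omega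
    obtain ⟨⟨u, hu⟩, hu0⟩ := Module.finrank_pos_iff_exists_ne_zero.1 h3
    rw [Submodule.mem_orthogonal] at hu
    exact ⟨u, fun h => hu0 (Subtype.ext h), hu n (Submodule.subset_span ⟨0, rfl⟩),
      hu m (Submodule.subset_span ⟨1, rfl⟩)⟩
  have huu : inner ℝ u u ≠ 0 := inner_self_ne_zero.2 hu
  have hframe : LinearIndependent ℝ ![n, m, u] := by
    refine linearIndependent_three fun r s t h => ?_
    have ht : t = 0 := by
      have := congrArg (inner ℝ u) h
      rw [inner_add_right, inner_add_right, real_inner_smul_right, real_inner_smul_right,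
        real_inner_smul_right, real_inner_comm, hnu, real_inner_comm, hmu, inner_zero_right] at this
      simpa [hu] using this
    rw [ht, zero_smul, add_zero, ← eq_neg_iff_add_eq_zero, ← neg_smul] at h
    obtain ⟨h1, h2⟩ := hind _ _ h
    exact ⟨h1, neg_eq_zero.1 h2, ht⟩
  set δ : EucIsom 3 := α * β * (β * α)⁻¹ with hδ
  have hδΓ : δ ∈ Γ := Γ.mul_mem (Γ.mul_mem hα hβ) (Γ.inv_mem (Γ.mul_mem hβ hα))
  have hδ' : δ * (β * α) = α * β := inv_mul_cancel_right _ _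
  set M := δ.linearIsometryEquiv
  have hM (v : Euc 3) : M (B (A v)) = A (B v) :=
    DFunLike.congr_fun (congrArg AffineIsometryEquiv.linearIsometryEquiv hδ') v
  have hMu : M u = u := by
    have := hM u
    rwa [hn.apply_of_inner_eq_zero hnu, hm.apply_of_inner_eq_zero hmu,
      hn.apply_of_inner_eq_zero hnu] at this
  have hker (v : Euc 3) (hv : M v = v) : inner ℝ n v = 0 ∧ inner ℝ m v = 0 := by
    have h1 : A (B v) = B (A v) := by
      have h2 := hM (A (B v))
      rw [hn.apply_apply, hm.apply_apply, hv] at h2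
      have h3 := congrArg (fun w => B (A w)) h2
      simp only [hn.apply_apply, hm.apply_apply] at h3
      exact h3.symm
    rw [hn.2 (B v), hm.2 v, hm.2 (A v), hn.2 v, inner_sub_right, inner_sub_right,
      real_inner_smul_right, real_inner_smul_right, real_inner_comm n m] at h1
    have h2 : (inner ℝ m v * inner ℝ n m) • n = (inner ℝ n v * inner ℝ n m) • m := by
      rw [real_inner_comm m n] at h1 ⊢
      linear_combination (norm := module) (1 / 4 : ℝ) • h1
    obtain ⟨h3, h4⟩ := hind _ _ h2
    exact ⟨(mul_eq_zero.1 h4).resolve_right hc, (mul_eq_zero.1 h3).resolve_right hc⟩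
  have hinv (L : Euc 3 ≃ₗᵢ[ℝ] Euc 3) (hL : L u = u) (v : Euc 3) :
      inner ℝ u (L v) = inner ℝ u v := by
    conv_lhs => rw [← hL]
    exact L.inner_map_map u v
  -- the translation part of the commutator is orthogonal to the fixed direction `u`
  have hδ0 : inner ℝ u (δ 0) = 0 := by
    have h1 : δ (β (α 0)) = α (β 0) := DFunLike.congr_fun hδ' 0
    have h2 := congrArg (inner ℝ u) h1
    rw [apply_eq_linear_add δ, apply_eq_linear_add α (β 0), apply_eq_linear_add β (α 0),
      inner_add_right, inner_add_right, hinv M hMu, inner_add_right,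
      hinv B (hm.apply_of_inner_eq_zero hmu), hinv A (hn.apply_of_inner_eq_zero hnu)] at h2
    linarith
  let f : Euc 3 →ₗ[ℝ] Euc 3 := (M.toLinearEquiv : Euc 3 →ₗ[ℝ] Euc 3) - LinearMap.id +
    (innerSL ℝ u : Euc 3 →ₗ[ℝ] ℝ).smulRight u
  have hf (v : Euc 3) : f v = M v - v + inner ℝ u v • u := by
    simp [f]
  have hfu (v : Euc 3) : inner ℝ u (f v) = inner ℝ u v * inner ℝ u u := by
    rw [hf, inner_add_right, inner_sub_right, hinv M hMu, real_inner_smul_right]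
    ring
  have hinj : Function.Injective f := by
    rw [injective_iff_map_eq_zero]
    intro v hv
    have h1 : inner ℝ u v = 0 := by
      have := hfu v
      rw [hv, inner_zero_right] at this
      exact (mul_eq_zero.1 this.symm).resolve_right huu
    rw [hf, h1, zero_smul, add_zero, sub_eq_zero] at hv
    obtain ⟨h2, h3⟩ := hker v hv
    exact eq_zero_of_inner_eq_zero hframe h2 h3 h1
  obtain ⟨x, hx⟩ := LinearMap.injective_iff_surjective.1 hinj (-δ 0)
  have h1 : inner ℝ u x = 0 := by
    have := hfu x
    rw [hx, inner_neg_right, hδ0, neg_zero] at this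
    exact (mul_eq_zero.1 this.symm).resolve_right huu
  rw [hf, h1, zero_smul, add_zero] at hx
  have hx' : δ x = x := by
    rw [apply_eq_linear_add, sub_eq_iff_eq_add.1 hx]
    abel
  have hδ1 := hfree δ hδΓ x hx'
  have hMn : M n = n := by
    change δ.linearIsometryEquiv n = n
    rw [hδ1]
    rfl
  have := (hker n hMn).1
  rw [hn.inner_self] at this
  exact one_ne_zero this

/-- In a group acting freely, the linear parts cannot include the reflections in three orthogonal
planes: their product, the central symmetry, fixes no nonzero vector. -/
theorem not_three_isPlaneReflection (hfree : ∀ γ ∈ Γ, ∀ x : Euc 3, γ x = x → γ = 1)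
    {α β κ : EucIsom 3} (hα : α ∈ Γ) (hβ : β ∈ Γ) (hκ : κ ∈ Γ)
    (hn : IsPlaneReflection α.linearIsometryEquiv n)
    (hm : IsPlaneReflection β.linearIsometryEquiv m)
    (hk : IsPlaneReflection κ.linearIsometryEquiv k)
    (hnm : inner ℝ n m = 0) (hnk : inner ℝ n k = 0) (hmk : inner ℝ m k = 0) : False := by
  obtain ⟨u, hu, h⟩ := exists_fixed_vector hfree (Γ.mul_mem (Γ.mul_mem hα hβ) hκ)
  have hu' : α.linearIsometryEquiv (β.linearIsometryEquiv (κ.linearIsometryEquiv u)) = u := h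
  have hli := linearIndependent_of_orthonormal hn.1 hm.1 hk.1 hnm hnk hmk
  rw [hn.2, hm.2, hk.2] at hu'
  simp only [inner_sub_right, real_inner_smul_right, hnm, hnk, hmk, mul_zero, sub_zero] at hu'
  have h0 : inner ℝ n u • n + inner ℝ m u • m + inner ℝ k u • k = 0 := by
    linear_combination (norm := module) (-(1 / 2 : ℝ)) • hu'
  obtain ⟨h1, h2, h3⟩ := eq_zero_of_three hli h0
  exact hu (eq_zero_of_inner_eq_zero hli h1 h2 h3)

theorem IsPlaneReflection.apply_basis (e : OrthonormalBasis (Fin 3) ℝ (Euc 3)) {j : Fin 3}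
    (h : IsPlaneReflection L k) (hk : k = e j ∨ k = -e j) (i : Fin 3) :
    L (e i) = (if i = j then -1 else 1 : ℝ) • e i := by
  have h1 : L (e i) = e i - (2 * inner ℝ (e j) (e i)) • e j := by
    rcases hk with rfl | rfl
    · exact h.2 _
    · rw [h.2, inner_neg_left]
      module
  rw [h1, e.inner_eq_ite]
  by_cases hij : i = j
  · subst hij
    simp
    module
  · simp [hij, Ne.symm hij]

/-- The linear parts of the elements of a non-orientable group acting freely are simultaneously
diagonal in an orthonormal basis, fix the second vector of this basis, and the reflection reversing
the third vector is one of them. -/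
theorem exists_orthonormalBasis_diagonal (hfree : ∀ γ ∈ Γ, ∀ x : Euc 3, γ x = x → γ = 1)
    (hno : IsNonOrientable Γ) : ∃ e : OrthonormalBasis (Fin 3) ℝ (Euc 3),
      (∀ γ ∈ Γ, ∃ s t : ℝ, (s = 1 ∨ s = -1) ∧ (t = 1 ∨ t = -1) ∧
        ∀ i, γ.linearIsometryEquiv (e i) = (![s, 1, t] : Fin 3 → ℝ) i • e i) ∧
      ∃ α ∈ Γ, ∀ i, α.linearIsometryEquiv (e i) = (![1, 1, -1] : Fin 3 → ℝ) i • e i := by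
  have hneg {γ : EucIsom 3} (hγ : γ ∈ Γ) (hdet : LinearMap.det
      (γ.linearIsometryEquiv.toLinearEquiv : Euc 3 →ₗ[ℝ] Euc 3) < 0) :
      ∃ k, IsPlaneReflection γ.linearIsometryEquiv k := by
    obtain ⟨u, hu, hLu⟩ := exists_fixed_vector hfree hγ
    exact exists_isPlaneReflection hdet hu hLu
  obtain ⟨α, hα, hdet⟩ := hno
  obtain ⟨n, hn⟩ := hneg hα hdet
  obtain ⟨e, he2, he⟩ : ∃ e : OrthonormalBasis (Fin 3) ℝ (Euc 3), e 2 = n ∧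
      ∀ γ ∈ Γ, ∀ k, IsPlaneReflection γ.linearIsometryEquiv k →
        (k = e 2 ∨ k = -e 2) ∨ (k = e 0 ∨ k = -e 0) := by
    have hcard : Module.finrank ℝ (Euc 3) = Fintype.card (Fin 3) := finrank_euclideanSpace
    by_cases hex : ∃ β ∈ Γ, ∃ m, IsPlaneReflection β.linearIsometryEquiv m ∧ inner ℝ n m = 0
    · obtain ⟨β, hβ, m, hm, hnm⟩ := hex
      have hv : Orthonormal ℝ (({0, 2} : Set (Fin 3)).domRestrict ![m, 0, n]) := by
        rw [orthonormal_iff_ite]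
        rintro ⟨i, rfl | rfl⟩ ⟨j, rfl | rfl⟩
        · simpa using hm.inner_self
        · rw [if_neg fun h => absurd (congrArg Subtype.val h) (by decide)]
          exact (real_inner_comm _ _).trans hnm
        · rw [if_neg fun h => absurd (congrArg Subtype.val h) (by decide)]
          exact hnm
        · simpa using hn.inner_self
      obtain ⟨e, he⟩ := hv.exists_orthonormalBasis_extension_of_card_eq hcard
      have e0 : e 0 = m := he 0 (by simp)
      have e2 : e 2 = n := he 2 (by simp)
      refine ⟨e, e2, fun γ hγ k hk => ?_⟩
      rw [e0, e2]
      rcases inner_eq_zero_or_eq hfree hα hγ hn hk with h | h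
      · rcases inner_eq_zero_or_eq hfree hβ hγ hm hk with h' | h'
        · exact (not_three_isPlaneReflection hfree hα hβ hγ hn hm hk hnm h h').elim
        · exact Or.inr h'
      · exact Or.inl h
    · have hv : Orthonormal ℝ (({2} : Set (Fin 3)).domRestrict ![0, 0, n]) := by
        rw [orthonormal_iff_ite]
        rintro ⟨i, rfl⟩ ⟨j, rfl⟩
        simpa using hn.inner_self
      obtain ⟨e, he⟩ := hv.exists_orthonormalBasis_extension_of_card_eq hcard
      have e2 : e 2 = n := he 2 (by simp)
      refine ⟨e, e2, fun γ hγ k hk => Or.inl ?_⟩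
      rw [e2]
      rcases inner_eq_zero_or_eq hfree hα hγ hn hk with h | h
      · exact (hex ⟨γ, hγ, k, hk, h⟩).elim
      · exact h
  have hA (i : Fin 3) : α.linearIsometryEquiv (e i) = (![1, 1, -1] : Fin 3 → ℝ) i • e i := by
    rw [hn.apply_basis e (Or.inl he2.symm)]
    fin_cases i <;> simp
  refine ⟨e, fun γ hγ => ?_, α, hα, hA⟩
  -- an orientation-reversing element is a reflection; a preserving one becomes so after `α`
  have hrev {δ : EucIsom 3} (hδ : δ ∈ Γ) (hdet : LinearMap.det
      (δ.linearIsometryEquiv.toLinearEquiv : Euc 3 →ₗ[ℝ] Euc 3) < 0) :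
      (∀ i, δ.linearIsometryEquiv (e i) = (![1, 1, -1] : Fin 3 → ℝ) i • e i) ∨
      (∀ i, δ.linearIsometryEquiv (e i) = (![-1, 1, 1] : Fin 3 → ℝ) i • e i) := by
    obtain ⟨k, hk⟩ := hneg hδ hdet
    rcases he δ hδ k hk with h | h
    · left
      intro i
      rw [hk.apply_basis e h]
      fin_cases i <;> simp
    · right
      intro i
      rw [hk.apply_basis e h]
      fin_cases i <;> simp
  rcases lt_or_ge (LinearMap.det
    (γ.linearIsometryEquiv.toLinearEquiv : Euc 3 →ₗ[ℝ] Euc 3)) 0 with hγd | hγd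
  · rcases hrev hγ hγd with h | h
    · exact ⟨1, -1, Or.inl rfl, Or.inr rfl, h⟩
    · exact ⟨-1, 1, Or.inr rfl, Or.inl rfl, h⟩
  · have hγd' : 0 < LinearMap.det (γ.linearIsometryEquiv.toLinearEquiv : Euc 3 →ₗ[ℝ] Euc 3) :=
      hγd.lt_of_ne' (LinearEquiv.isUnit_det' γ.linearIsometryEquiv.toLinearEquiv).ne_zero
    have hd : LinearMap.det
        ((α * γ).linearIsometryEquiv.toLinearEquiv : Euc 3 →ₗ[ℝ] Euc 3) < 0 := by
      have := det_lin_mul α.linearIsometryEquiv γ.linearIsometryEquiv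
      exact this.trans_lt (mul_neg_of_neg_of_pos hdet hγd')
    have hback (i : Fin 3) : γ.linearIsometryEquiv (e i) =
        α.linearIsometryEquiv ((α * γ).linearIsometryEquiv (e i)) :=
      (hn.apply_apply _).symm
    rcases hrev (Γ.mul_mem hα hγ) hd with h | h
    · refine ⟨1, 1, Or.inl rfl, Or.inl rfl, fun i => ?_⟩
      rw [hback, h, map_smul, hA, smul_smul]
      fin_cases i <;> simp
    · refine ⟨-1, -1, Or.inr rfl, Or.inr rfl, fun i => ?_⟩
      rw [hback, h, map_smul, hA, smul_smul]
      fin_cases i <;> simp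

end

section

/-! ### The lattice of translations -/

variable {Γ : Subgroup (EucIsom 3)} {b : Module.Basis (Fin 3) ℝ (Euc 3)} {p : Euc 3}
  {γ δ : EucIsom 3} {ε c : Fin 3 → ℝ}

theorem linear_mem_translationLattice (hγ : γ ∈ Γ) {v : Euc 3} (hv : v ∈ translationLattice Γ) :
    γ.linearIsometryEquiv v ∈ translationLattice Γ := by
  have h : translation (γ.linearIsometryEquiv v) = γ * translation v * γ⁻¹ := by
    ext1 x
    have h1 : γ (v + γ⁻¹ x) = γ.linearIsometryEquiv v + γ (γ⁻¹ x) := γ.map_vadd (γ⁻¹ x) v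
    rw [show γ (γ⁻¹ x) = x from γ.apply_symm_apply x] at h1
    exact h1.symm
  rw [mem_translationLattice, h]
  exact Γ.mul_mem (Γ.mul_mem hγ hv) (Γ.inv_mem hγ)

theorem IsDiscreteGroup.exists_pos (h : IsDiscreteGroup Γ) :
    ∃ r : ℝ, 0 < r ∧ ∀ v ∈ translationLattice Γ, ‖v‖ < r → v = 0 := by
  obtain ⟨r, hr, h⟩ := h
  refine ⟨r, hr, fun v hv hvr => ?_⟩
  have h1 := h _ hv fun x _ => by
    rw [translation_apply, dist_eq_norm, add_sub_cancel_right]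
    exact hvr
  have h2 := DFunLike.congr_fun h1 0
  rw [translation_apply, add_zero] at h2
  exact h2

/-- If the linear parts of a cocompact group take finitely many values, some ball meets all the
orbits of its translations: an element bringing a point near the origin is made a translation by
composing it with one of finitely many representatives of the linear parts. -/
theorem exists_norm_add_le (hc : CompactSpace (FlatQuotient Γ))
    (hlin : ∀ γ ∈ Γ, ∃ s t : ℝ, (s = 1 ∨ s = -1) ∧ (t = 1 ∨ t = -1) ∧
      ∀ i, γ.linearIsometryEquiv (b i) = (![s, 1, t] : Fin 3 → ℝ) i • b i) :
    ∃ R : ℝ, ∀ x, ∃ v ∈ translationLattice Γ, ‖x + v‖ ≤ R := by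
  obtain ⟨R, hR⟩ := exists_radius_of_compactSpace hc
  have hrep (σ : ℝ × ℝ) : ∃ g ∈ Γ, ∀ γ ∈ Γ,
      (∀ i, γ.linearIsometryEquiv (b i) = (![σ.1, 1, σ.2] : Fin 3 → ℝ) i • b i) →
      ∀ i, g.linearIsometryEquiv (b i) = (![σ.1, 1, σ.2] : Fin 3 → ℝ) i • b i := by
    by_cases h : ∃ g ∈ Γ, ∀ i, g.linearIsometryEquiv (b i) =
        (![σ.1, 1, σ.2] : Fin 3 → ℝ) i • b i
    · obtain ⟨g, hg, hg'⟩ := h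
      exact ⟨g, hg, fun _ _ _ => hg'⟩
    · exact ⟨1, Γ.one_mem, fun γ hγ hγ' => (h ⟨γ, hγ, hγ'⟩).elim⟩
  choose g hg hg' using hrep
  let S : Finset (ℝ × ℝ) := {1, -1} ×ˢ {1, -1}
  refine ⟨R + ∑ σ ∈ S, ‖g σ 0‖, fun x => ?_⟩
  obtain ⟨γ, hγ, hx⟩ := hR x
  obtain ⟨s, t, hs, ht, hst⟩ := hlin γ hγ
  have hd1 := isDiag_of_linear 0 (hg' (s, t) γ hγ hst)
  have hd := hd1.mul (isDiag_of_linear 0 hst)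
  set w := (g (s, t) * γ) 0 with hw
  have hd' : IsDiag b 0 (g (s, t) * γ) 1 (b.repr w) := by
    refine hd.congr (fun i => ?_) fun i => ?_
    · rcases hs with rfl | rfl <;> rcases ht with rfl | rfl <;> fin_cases i <;> simp
    · have h1 := hd 0 i
      rw [← hw, sub_zero, sub_zero, map_zero] at h1
      simp only [Finsupp.coe_zero, Pi.zero_apply, mul_zero, zero_add] at h1
      exact h1.symm
  have heq := hd'.eq_translation fun _ => rfl
  refine ⟨w, ?_, ?_⟩
  · rw [mem_translationLattice, ← heq]
    exact Γ.mul_mem (hg _) hγ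
  · have h2 : x + w = g (s, t) (γ x) := by
      rw [add_comm, ← translation_apply, ← heq]
      rfl
    rw [h2, apply_eq_linear_add (g (s, t))]
    refine (norm_add_le _ _).trans (add_le_add ?_ ?_)
    · rwa [LinearIsometryEquiv.norm_map]
    · refine Finset.single_le_sum (f := fun σ => ‖g σ 0‖) (fun σ _ => norm_nonneg _) ?_
      simp [S, hs, ht]

theorem exists_inner_ne_zero {R : ℝ} (hR : ∀ x, ∃ v ∈ translationLattice Γ, ‖x + v‖ ≤ R)
    {x : Euc 3} (hx : x ≠ 0) : ∃ v ∈ translationLattice Γ, inner ℝ v x ≠ 0 := by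
  by_contra! h
  have hx' : 0 < ‖x‖ := norm_pos_iff.2 hx
  obtain ⟨v, hv, hvR⟩ := hR (((R + 1) / ‖x‖) • x)
  have h0 : 0 ≤ R := (norm_nonneg _).trans hvR
  have h1 : inner ℝ (((R + 1) / ‖x‖) • x + v) x = (R + 1) * ‖x‖ := by
    rw [inner_add_left, h v hv, add_zero, real_inner_smul_left, real_inner_self_eq_norm_sq]
    field_simp
  have h2 := real_inner_le_norm (((R + 1) / ‖x‖) • x + v) x
  rw [h1] at h2
  have := mul_le_mul_of_nonneg_right hvR hx'.le
  nlinarith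

/-- The translations of a discrete group along a line form an infinite cyclic group, as soon as
there is a non-trivial one. -/
theorem exists_generator {r₀ : ℝ} (hr₀ : 0 < r₀)
    (hd : ∀ v ∈ translationLattice Γ, ‖v‖ < r₀ → v = 0) {e : Euc 3} (he : e ≠ 0)
    {t : ℝ} (ht : t ≠ 0) (hte : t • e ∈ translationLattice Γ) :
    ∃ r : ℝ, r ≠ 0 ∧ r • e ∈ translationLattice Γ ∧
      ∀ s : ℝ, s • r • e ∈ translationLattice Γ → ∃ k : ℤ, s = k := by
  set H : AddSubgroup ℝ :=
    (translationLattice Γ).comap (LinearMap.toSpanSingleton ℝ (Euc 3) e).toAddMonoidHom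
  have hH (s : ℝ) : s ∈ H ↔ s • e ∈ translationLattice Γ := Iff.rfl
  have he' : 0 < ‖e‖ := norm_pos_iff.2 he
  obtain ⟨r, hr⟩ := AddSubgroup.cyclic_of_isolated_zero (H := H) (a := r₀ / ‖e‖) (by positivity) (by
    rw [Set.disjoint_left]
    rintro s hs ⟨h1, h2⟩
    have := hd _ ((hH s).1 hs) (by
      rwa [norm_smul, Real.norm_of_nonneg h1.le, ← lt_div_iff₀ he'])
    exact h1.ne' ((smul_eq_zero.1 this).resolve_right he))
  have hgen {s : ℝ} (hs : s • e ∈ translationLattice Γ) : ∃ k : ℤ, k * r = s := by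
    rw [← hH, hr, AddSubgroup.mem_closure_singleton] at hs
    obtain ⟨k, hk⟩ := hs
    exact ⟨k, by rw [← hk, zsmul_eq_mul]⟩
  have hr0 : r ≠ 0 := by
    rintro rfl
    obtain ⟨k, hk⟩ := hgen hte
    exact ht (by rw [← hk, mul_zero])
  refine ⟨r, hr0, ?_, fun s hs => ?_⟩
  · rw [← hH, hr]
    exact AddSubgroup.mem_closure_singleton_self r
  · rw [smul_smul] at hs
    obtain ⟨k, hk⟩ := hgen hs
    exact ⟨k, mul_right_cancel₀ hr0 hk.symm⟩

theorem translationLattice_le_of_integral {Δ : Subgroup (EucIsom 3)}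
    (hint : ∀ v ∈ translationLattice Γ, ∀ i, ∃ k : ℤ, b.repr v i = k)
    (hb : ∀ i, b i ∈ translationLattice Δ) : translationLattice Γ ≤ translationLattice Δ := by
  intro v hv
  rw [← b.sum_repr v]
  refine sum_mem fun i _ => ?_
  obtain ⟨k, hk⟩ := hint v hv i
  rw [hk, Int.cast_smul_eq_zsmul]
  exact zsmul_mem (hb i) k

/-- Two nested groups with the same translations and the same linear parts are equal. -/
theorem eq_of_translationLattice_le {Δ : Subgroup (EucIsom 3)} (hle : Δ ≤ Γ)
    (hT : translationLattice Γ ≤ translationLattice Δ)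
    (hL : ∀ γ ∈ Γ, ∃ δ ∈ Δ, ∃ ε c c' : Fin 3 → ℝ, IsDiag b p γ ε c ∧ IsDiag b p δ ε c' ∧
      ∀ i, ε i * ε i = 1) : Γ = Δ := by
  refine le_antisymm (fun γ hγ => ?_) hle
  obtain ⟨δ, hδ, ε, c, c', h, h', hε⟩ := hL γ hγ
  have h1 := (h'.mul h).congr (ε' := 1) (c' := b.repr (b.equivFun.symm
    fun i => ε i * c i + c' i)) hε fun i => by
      rw [← b.equivFun_apply, LinearEquiv.apply_symm_apply]
  have h2 := h1.eq_translation fun _ => rfl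
  have h3 : translation (b.equivFun.symm fun i => ε i * c i + c' i) ∈ Δ :=
    hT (show translation _ ∈ Γ from h2 ▸ Γ.mul_mem (hle hδ) hγ)
  rw [← h2] at h3
  exact (Subgroup.mul_mem_cancel_left Δ hδ).1 h3

theorem repr_linear (h : ∀ i, γ.linearIsometryEquiv (b i) = ε i • b i) (v : Euc 3) (i : Fin 3) :
    b.repr (γ.linearIsometryEquiv v) i = ε i * b.repr v i := by
  have h1 := isDiag_of_linear 0 h v i
  rw [sub_zero, sub_zero, sub_zero, apply_eq_linear_add, map_add, Finsupp.add_apply] at h1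
  exact add_right_cancel h1

theorem IsDiag.ne_one (h : IsDiag b p γ ε c) {i : Fin 3} (hi : ε i ≠ 1) : γ ≠ 1 := by
  rintro rfl
  have h1 : (1 : ℝ) • b i = ε i • b i := (one_smul ℝ (b i)).trans (h.linear i)
  exact hi (smul_left_injective ℝ (b.ne_zero i) h1).symm

/-- In a group acting freely, a diagonal isometry with a negative sign has a translation component
along one of its fixed directions. -/
theorem IsDiag.exists_ne_zero (hfree : ∀ γ ∈ Γ, ∀ x : Euc 3, γ x = x → γ = 1) (hγ : γ ∈ Γ)
    (h : IsDiag b p γ ε c) {i : Fin 3} (hi : ε i = -1) (hε : ∀ j, ε j = -1 ∨ ε j = 1) :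
    ∃ j, ε j = 1 ∧ c j ≠ 0 := by
  by_contra! hc
  obtain ⟨x, hx⟩ := h.exists_fixed fun j => (hε j).imp_right fun h1 => ⟨hc j h1, h1⟩
  exact h.ne_one (i := i) (by rw [hi]; norm_num) (hfree γ hγ x hx)

/-- A real number whose double is an integer is an integer, or an integer plus one half. -/
theorem fract_eq_of_two_mul {x : ℝ} {k : ℤ} (h : 2 * x = k) :
    Int.fract x = 0 ∨ Int.fract x = 1 / 2 := by
  have h1 : 2 * Int.fract x = ((k - 2 * ⌊x⌋ : ℤ) : ℝ) := by
    rw [Int.fract]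
    push_cast
    linarith
  have h2 := Int.fract_nonneg x
  have h3 := Int.fract_lt_one x
  have h4 : 0 ≤ k - 2 * ⌊x⌋ := by
    have : (0 : ℝ) ≤ ((k - 2 * ⌊x⌋ : ℤ) : ℝ) := by rw [← h1]; linarith
    exact_mod_cast this
  have h5 : k - 2 * ⌊x⌋ < 2 := by
    have : ((k - 2 * ⌊x⌋ : ℤ) : ℝ) < 2 := by rw [← h1]; linarith
    exact_mod_cast this
  obtain h6 | h6 : k - 2 * ⌊x⌋ = 0 ∨ k - 2 * ⌊x⌋ = 1 := by omega
  · left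
    rw [h6] at h1
    push_cast at h1
    linarith
  · right
    rw [h6] at h1
    push_cast at h1
    linarith

end

section

/-! ### Groups with holonomy of order two -/

variable {Γ : Subgroup (EucIsom 3)} {f₀ f₁ f₂ n p : Euc 3} {α γ : EucIsom 3}

/-- A basis of `E³` consisting of a `ℤ`-basis `f₀, f₁` of the group of translations of `Γ` in the
plane orthogonal to `f₂`, and of a generator `f₂` of the group of translations along this normal. -/
structure IsAdaptedFrame (Γ : Subgroup (EucIsom 3)) (f₀ f₁ f₂ : Euc 3) : Prop where
  li : LinearIndependent ℝ ![f₀, f₁, f₂]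
  mem₀ : f₀ ∈ translationLattice Γ
  mem₁ : f₁ ∈ translationLattice Γ
  mem₂ : f₂ ∈ translationLattice Γ
  inner₀ : inner ℝ f₂ f₀ = 0
  inner₁ : inner ℝ f₂ f₁ = 0
  plane : ∀ v ∈ translationLattice Γ, inner ℝ f₂ v = 0 → ∃ k l : ℤ, v = (k : ℝ) • f₀ + (l : ℝ) • f₁
  normal : ∀ s : ℝ, s • f₂ ∈ translationLattice Γ → ∃ k : ℤ, s = k

theorem IsAdaptedFrame.swap (h : IsAdaptedFrame Γ f₀ f₁ f₂) : IsAdaptedFrame Γ f₁ f₀ f₂ where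
  li := linearIndependent_three fun r s t h' => by
    obtain ⟨h0, h1, h2⟩ := eq_zero_of_three h.li (r := s) (s := r) (t := t) (by rw [← h']; abel)
    exact ⟨h1, h0, h2⟩
  mem₀ := h.mem₁
  mem₁ := h.mem₀
  mem₂ := h.mem₂
  inner₀ := h.inner₁
  inner₁ := h.inner₀
  plane v hv hn := by
    obtain ⟨k, l, hkl⟩ := h.plane v hv hn
    exact ⟨l, k, by rw [hkl, add_comm]⟩
  normal := h.normal

theorem IsAdaptedFrame.add (h : IsAdaptedFrame Γ f₀ f₁ f₂) :
    IsAdaptedFrame Γ (f₀ + f₁) f₁ f₂ where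
  li := linearIndependent_three fun r s t h' => by
    obtain ⟨h0, h1, h2⟩ := eq_zero_of_three h.li (r := r) (s := r + s) (t := t) (by
      rw [← h', smul_add, add_smul]; abel)
    exact ⟨h0, by rwa [h0, zero_add] at h1, h2⟩
  mem₀ := add_mem h.mem₀ h.mem₁
  mem₁ := h.mem₁
  mem₂ := h.mem₂
  inner₀ := by rw [inner_add_right, h.inner₀, h.inner₁, add_zero]
  inner₁ := h.inner₁
  plane v hv hn := by
    obtain ⟨k, l, hkl⟩ := h.plane v hv hn
    refine ⟨k, l - k, ?_⟩
    rw [hkl]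
    push_cast
    module
  normal := h.normal

/-- `γ` fixes the plane orthogonal to `n`, and preserves `n` up to sign. -/
def IsNormalSign (n : Euc 3) (γ : EucIsom 3) (t : ℝ) : Prop :=
  γ.linearIsometryEquiv n = t • n ∧ ∀ v, inner ℝ n v = 0 → γ.linearIsometryEquiv v = v

/-- The translations orthogonal to `n` form a lattice in the plane orthogonal to `n`. -/
theorem exists_plane_basis (hn : n ≠ 0) {r : ℝ} (hr : 0 < r)
    (hd : ∀ v ∈ translationLattice Γ, ‖v‖ < r → v = 0)
    (hspan : ∀ x : Euc 3, x ≠ 0 → ∃ v ∈ translationLattice Γ, inner ℝ v x ≠ 0)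
    (hα : α ∈ Γ) (hαn : IsNormalSign n α (-1)) :
    ∃ f : Fin 2 → Euc 3, LinearIndependent ℝ f ∧
      (∀ i, f i ∈ translationLattice Γ ∧ inner ℝ n (f i) = 0) ∧
      ∀ v ∈ translationLattice Γ, inner ℝ n v = 0 →
        ∃ k l : ℤ, v = (k : ℝ) • f 0 + (l : ℝ) • f 1 := by
  set L : Submodule ℤ (Euc 3) := AddSubgroup.toIntSubmodule
    (translationLattice Γ ⊓ (Submodule.span ℝ {n})ᗮ.toAddSubgroup) with hL
  have hmem (v : Euc 3) : v ∈ L ↔ v ∈ translationLattice Γ ∧ inner ℝ n v = 0 := by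
    rw [← Submodule.mem_orthogonal_singleton_iff_inner_right]
    rfl
  have hdisc : DiscreteTopology L := by
    refine discreteTopology_of_isOpen_singleton_zero ?_
    rw [Metric.isOpen_singleton_iff]
    refine ⟨r, hr, fun v hv => Subtype.ext (hd _ ((hmem _).1 v.2).1 ?_)⟩
    rwa [dist_zero_right] at hv
  -- a vector orthogonal to `n` and to `v + α v`, for all `v` in the lattice, vanishes
  have hspanL : Submodule.span ℝ (L : Set (Euc 3)) = (Submodule.span ℝ {n})ᗮ := by
    refine le_antisymm (Submodule.span_le.2 fun v hv =>
      (Submodule.mem_orthogonal_singleton_iff_inner_right).2 ((hmem v).1 hv).2) ?_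
    rw [← Submodule.orthogonal_orthogonal (Submodule.span ℝ (L : Set (Euc 3)))]
    refine Submodule.orthogonal_le fun x hx => ?_
    rw [Submodule.mem_orthogonal] at hx
    rw [Submodule.mem_span_singleton]
    have hnn : inner ℝ n n ≠ 0 := inner_self_ne_zero.2 hn
    refine ⟨inner ℝ n x / inner ℝ n n, ?_⟩
    by_contra hne
    obtain ⟨v, hv, hvx⟩ := hspan (x - (inner ℝ n x / inner ℝ n n) • n)
      (sub_ne_zero.2 fun h => hne h.symm)
    have hvα : α.linearIsometryEquiv v = v - (2 * (inner ℝ n v / inner ℝ n n)) • n := by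
      have h1 := hαn.2 (v - (inner ℝ n v / inner ℝ n n) • n) (by
        rw [inner_sub_right, real_inner_smul_right, div_mul_cancel₀ _ hnn, sub_self])
      rw [map_sub, map_smul, hαn.1] at h1
      rw [sub_eq_iff_eq_add.1 h1]
      module
    have hw : v + α.linearIsometryEquiv v ∈ L := by
      rw [hmem]
      refine ⟨add_mem hv (linear_mem_translationLattice hα hv), ?_⟩
      rw [hvα, inner_add_right, inner_sub_right, real_inner_smul_right]
      field_simp
      ring
    have h2 := hx _ (Submodule.subset_span hw)
    rw [hvα] at h2
    refine hvx ?_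
    rw [inner_add_left, inner_sub_left, real_inner_smul_left] at h2
    rw [inner_sub_right, real_inner_smul_right, real_inner_comm n v]
    field_simp at h2 ⊢
    linarith
  have hfin2 : Module.finrank ℝ (Submodule.span ℝ (L : Set (Euc 3))) = 2 := by
    rw [hspanL]
    have : Fact (Module.finrank ℝ (Euc 3) = 2 + 1) := ⟨finrank_euclideanSpace⟩
    exact Submodule.finrank_orthogonal_span_singleton hn
  have hLL : Submodule.span ℤ (L : Set (Euc 3)) = L := Submodule.span_eq L
  have hrank : Module.finrank ℤ L = 2 := by
    have h1 := Real.finrank_eq_int_finrank_of_discrete (s := (L : Set (Euc 3)))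
      (by rw [hLL]; exact hdisc)
    rw [Set.finrank, Set.finrank, hfin2, hLL] at h1
    exact h1.symm
  let B := Module.finBasisOfFinrankEq ℤ L hrank
  have hB (v : Euc 3) (hv : v ∈ L) : v = (B.repr ⟨v, hv⟩ 0 : ℝ) • (B 0 : Euc 3) +
      (B.repr ⟨v, hv⟩ 1 : ℝ) • (B 1 : Euc 3) := by
    have h1 := congrArg Subtype.val (B.sum_repr ⟨v, hv⟩)
    rw [Fin.sum_univ_two] at h1
    rw [Int.cast_smul_eq_zsmul, Int.cast_smul_eq_zsmul]
    exact h1.symm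
  refine ⟨fun i => B i, ?_, fun i => (hmem _).1 (B i).2, fun v hv hvn =>
    ⟨_, _, hB v ((hmem v).2 ⟨hv, hvn⟩)⟩⟩
  rw [linearIndependent_iff_card_eq_finrank_span]
  have h1 : Submodule.span ℝ (Set.range fun i => (B i : Euc 3)) =
      Submodule.span ℝ (L : Set (Euc 3)) := by
    refine le_antisymm (Submodule.span_mono ?_) (Submodule.span_le.2 fun v hv => ?_)
    · rintro _ ⟨i, rfl⟩
      exact (B i).2
    · rw [hB v hv]
      exact add_mem (Submodule.smul_mem _ _ (Submodule.subset_span ⟨0, rfl⟩))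
        (Submodule.smul_mem _ _ (Submodule.subset_span ⟨1, rfl⟩))
  rw [Set.finrank, h1, hfin2]
  rfl

theorem exists_isAdaptedFrame (hn : n ≠ 0) {r : ℝ} (hr : 0 < r)
    (hd : ∀ v ∈ translationLattice Γ, ‖v‖ < r → v = 0)
    (hspan : ∀ x : Euc 3, x ≠ 0 → ∃ v ∈ translationLattice Γ, inner ℝ v x ≠ 0)
    (hα : α ∈ Γ) (hαn : IsNormalSign n α (-1)) :
    ∃ (f₀ f₁ : Euc 3) (s : ℝ), s ≠ 0 ∧ IsAdaptedFrame Γ f₀ f₁ (s • n) := by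
  obtain ⟨f, hf, hfmem, hfgen⟩ := exists_plane_basis hn hr hd hspan hα hαn
  have hnn : inner ℝ n n ≠ 0 := inner_self_ne_zero.2 hn
  obtain ⟨v, hv, hvn⟩ := hspan n hn
  rw [real_inner_comm] at hvn
  -- `v - α v` is a translation along the normal
  have hvα : v - α.linearIsometryEquiv v = (2 * (inner ℝ n v / inner ℝ n n)) • n := by
    have h1 := hαn.2 (v - (inner ℝ n v / inner ℝ n n) • n) (by
      rw [inner_sub_right, real_inner_smul_right, div_mul_cancel₀ _ hnn, sub_self])
    rw [map_sub, map_smul, hαn.1] at h1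
    rw [sub_eq_iff_eq_add.1 h1]
    module
  obtain ⟨s, hs, hsn, hgen⟩ := exists_generator hr hd hn
    (mul_ne_zero two_ne_zero (div_ne_zero hvn hnn))
    (hvα ▸ sub_mem hv (linear_mem_translationLattice hα hv))
  refine ⟨f 0, f 1, s, hs, ?_, (hfmem 0).1, (hfmem 1).1, hsn, ?_, ?_, fun w hw hwn => ?_, hgen⟩
  · refine linearIndependent_three fun x y z h => ?_
    have h1 : z * s = 0 := by
      have h2 := congrArg (inner ℝ n) h
      rw [inner_add_right, inner_add_right, real_inner_smul_right, real_inner_smul_right,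
        real_inner_smul_right, real_inner_smul_right, (hfmem 0).2, (hfmem 1).2, inner_zero_right,
        mul_zero, mul_zero, zero_add, zero_add, ← mul_assoc] at h2
      exact (mul_eq_zero.1 h2).resolve_right hnn
    have hz : z = 0 := (mul_eq_zero.1 h1).resolve_right hs
    rw [hz, zero_smul, add_zero] at h
    have h3 := Fintype.linearIndependent_iff.1 hf ![x, y] (by rw [Fin.sum_univ_two]; exact h)
    exact ⟨h3 0, h3 1, hz⟩
  · rw [real_inner_smul_left, (hfmem 0).2, mul_zero]
  · rw [real_inner_smul_left, (hfmem 1).2, mul_zero]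
  · refine hfgen w hw ?_
    rw [real_inner_smul_left] at hwn
    exact (mul_eq_zero.1 hwn).resolve_left hs

theorem IsNormalSign.smul {s t : ℝ} (hs : s ≠ 0) (h : IsNormalSign n γ t) :
    IsNormalSign (s • n) γ t := by
  refine ⟨by rw [map_smul, h.1, smul_comm], fun v hv => h.2 v ?_⟩
  rw [real_inner_smul_left] at hv
  exact (mul_eq_zero.1 hv).resolve_left hs

theorem IsNormalSign.linear (h : IsAdaptedFrame Γ f₀ f₁ f₂) {t : ℝ} (hγ : IsNormalSign f₂ γ t)
    (i : Fin 3) :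
    γ.linearIsometryEquiv (frame h.li i) = (![1, 1, t] : Fin 3 → ℝ) i • frame h.li i := by
  fin_cases i
  · simpa using hγ.2 _ h.inner₀
  · simpa using hγ.2 _ h.inner₁
  · simpa using hγ.1

theorem frame_repr_eq {v : Euc 3} (h : LinearIndependent ℝ ![f₀, f₁, f₂]) {x y z : ℝ}
    (hv : v = x • f₀ + y • f₁ + z • f₂) (i : Fin 3) :
    (frame h).repr v i = (![x, y, z] : Fin 3 → ℝ) i := by
  have h0 := frame_repr_self h 0 i
  have h1 := frame_repr_self h 1 i
  have h2 := frame_repr_self h 2 i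
  simp only [Matrix.cons_val] at h0 h1 h2
  rw [hv, map_add, map_add, map_smul, map_smul, map_smul, Finsupp.add_apply, Finsupp.add_apply,
    Finsupp.smul_apply, Finsupp.smul_apply, Finsupp.smul_apply, h0, h1, h2]
  fin_cases i <;> simp

theorem eq_frame_sum (h : LinearIndependent ℝ ![f₀, f₁, f₂]) (v : Euc 3) :
    v = (frame h).repr v 0 • f₀ + (frame h).repr v 1 • f₁ + (frame h).repr v 2 • f₂ := by
  conv_lhs => rw [← (frame h).sum_repr v, Fin.sum_univ_three]
  rw [frame_apply, frame_apply, frame_apply]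
  rfl

/-- Up to a change of basis of the planar lattice, the reflections of the group contain a glide
reflection along half of the first basis vector. The change of basis depends on the parity of the
coordinates of the square of a given reflection; they are not both even because the group acts
freely. -/
theorem IsAdaptedFrame.exists_glide (h : IsAdaptedFrame Γ f₀ f₁ f₂)
    (hfree : ∀ γ ∈ Γ, ∀ x : Euc 3, γ x = x → γ = 1) (hα : α ∈ Γ) (hαn : IsNormalSign f₂ α (-1)) :
    ∃ g₀ g₁, IsAdaptedFrame Γ g₀ g₁ f₂ ∧ ∃ γ ∈ Γ, IsNormalSign f₂ γ (-1) ∧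
      ∃ p, γ p - p = (1 / 2 : ℝ) • g₀ := by
  -- the square of `α` is the translation by `P • f₀ + Q • f₁`
  have key (g₀ g₁ : Euc 3) (h : IsAdaptedFrame Γ g₀ g₁ f₂) (P Q : ℤ)
      (hPQ : α 0 + α.linearIsometryEquiv (α 0) = (P : ℝ) • g₀ + (Q : ℝ) • g₁) :
      ∃ c₂ : ℝ, IsDiag (frame h.li) 0 α ![1, 1, -1] ![P / 2, Q / 2, c₂] := by
    have h1 := isDiag_of_linear 0 (hαn.linear h)
    rw [sub_zero] at h1
    refine ⟨_, h1.congr (fun _ => rfl) (c' := ![P / 2, Q / 2, (frame h.li).repr (α 0) 2])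
      fun i => ?_⟩
    have h2 := repr_linear (hαn.linear h) (α 0) i
    have h3 := frame_repr_eq h.li (v := α 0 + α.linearIsometryEquiv (α 0)) (x := P) (y := Q)
      (z := 0)
      (by rw [hPQ, zero_smul, add_zero]) i
    rw [map_add, Finsupp.add_apply, h2] at h3
    fin_cases i
    · simp at h3 ⊢
      linarith
    · simp at h3 ⊢
      linarith
    · rfl
  have hsq : α 0 + α.linearIsometryEquiv (α 0) ∈ translationLattice Γ := by
    have hd := isDiag_of_linear 0 (hαn.linear h)
    rw [sub_zero] at hd
    refine (hd.mul hd).mem_translationLattice (Γ.mul_mem hα hα) (fun i => ?_) fun i => ?_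
    · fin_cases i <;> simp
    · rw [map_add, Finsupp.add_apply, repr_linear (hαn.linear h), add_comm]
  have hplane : inner ℝ f₂ (α 0 + α.linearIsometryEquiv (α 0)) = 0 := by
    have h1 := α.linearIsometryEquiv.inner_map_map f₂ (α 0)
    rw [hαn.1, neg_one_smul, inner_neg_left] at h1
    rw [inner_add_right, ← h1, neg_add_cancel]
  -- the case of an odd first coordinate and an even second one
  have main (g₀ g₁ : Euc 3) (h : IsAdaptedFrame Γ g₀ g₁ f₂) (P Q : ℤ)
      (hPQ : α 0 + α.linearIsometryEquiv (α 0) = (P : ℝ) • g₀ + (Q : ℝ) • g₁) (hP : Odd P)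
      (hQ : Even Q) : ∃ g₀ g₁, IsAdaptedFrame Γ g₀ g₁ f₂ ∧ ∃ γ ∈ Γ, IsNormalSign f₂ γ (-1) ∧
        ∃ p, γ p - p = (1 / 2 : ℝ) • g₀ := by
    obtain ⟨c₂, hc⟩ := key g₀ g₁ h P Q hPQ
    obtain ⟨k, rfl⟩ := hP
    obtain ⟨l, rfl⟩ := hQ
    have hmem : -((k : ℝ) • g₀ + (l : ℝ) • g₁) ∈ translationLattice Γ := by
      rw [Int.cast_smul_eq_zsmul, Int.cast_smul_eq_zsmul]
      exact neg_mem (add_mem (zsmul_mem h.mem₀ k) (zsmul_mem h.mem₁ l))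
    have hd := ((isDiag_translation (-((k : ℝ) • g₀ + (l : ℝ) • g₁))).mul hc).origin
      ((c₂ / 2) • frame h.li 2)
    refine ⟨g₀, g₁, h, _, Γ.mul_mem hmem hα, hαn, (c₂ / 2) • frame h.li 2, ?_⟩
    refine (frame h.li).repr.injective (Finsupp.ext fun i => ?_)
    have h1 := frame_repr_eq h.li (v := (1 / 2 : ℝ) • g₀) (x := 1 / 2) (y := 0) (z := 0)
      (by simp) i
    have h2 := frame_repr_eq h.li (v := -((k : ℝ) • g₀ + (l : ℝ) • g₁)) (x := -k) (y := -l) (z := 0)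
      (by module) i
    have h3 := frame_repr_self h.li 2 i
    rw [hd, sub_self, sub_zero, map_zero, h1]
    beta_reduce
    rw [h2, map_smul, Finsupp.smul_apply, frame_apply, h3]
    fin_cases i <;> simp <;> ring
  obtain ⟨P, Q, hPQ⟩ := h.plane _ hsq hplane
  rcases Int.even_or_odd P with hP | hP <;> rcases Int.even_or_odd Q with hQ | hQ
  · exfalso
    obtain ⟨c₂, hc⟩ := key f₀ f₁ h P Q hPQ
    obtain ⟨k, rfl⟩ := hP
    obtain ⟨l, rfl⟩ := hQ
    have hmem : -((k : ℝ) • f₀ + (l : ℝ) • f₁) ∈ translationLattice Γ := by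
      rw [Int.cast_smul_eq_zsmul, Int.cast_smul_eq_zsmul]
      exact neg_mem (add_mem (zsmul_mem h.mem₀ k) (zsmul_mem h.mem₁ l))
    have hd := (isDiag_translation (-((k : ℝ) • f₀ + (l : ℝ) • f₁))).mul hc
    have h2 := frame_repr_eq h.li (v := -((k : ℝ) • f₀ + (l : ℝ) • f₁)) (x := -k) (y := -l) (z := 0)
      (by module)
    obtain ⟨i, hi, hci⟩ := hd.exists_ne_zero hfree (Γ.mul_mem hmem hα) (i := 2) (by simp)
      fun i => by fin_cases i <;> simp
    rw [h2] at hci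
    fin_cases i <;> simp at hi hci
    norm_num at hi
  · exact main f₁ f₀ h.swap Q P (by rw [hPQ, add_comm]) hQ hP
  · exact main f₀ f₁ h P Q hPQ hP hQ
  · refine main (f₀ + f₁) f₁ h.add P (Q - P) (by rw [hPQ]; push_cast; module) hP (hQ.sub_odd hP)

end

section

variable {Γ : Subgroup (EucIsom 3)} {f₀ f₁ f₂ n p : Euc 3} {α γ : EucIsom 3}

/-- The coordinates of a translation of the group are integers or half-integers: in the frame,
`v + α v` is the double of the planar part of `v`, and `v - α v` the double of its normal part. -/
theorem IsAdaptedFrame.two_mul_repr (h : IsAdaptedFrame Γ f₀ f₁ f₂) (hα : α ∈ Γ)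
    (hαn : IsNormalSign f₂ α (-1)) {v : Euc 3} (hv : v ∈ translationLattice Γ) (i : Fin 3) :
    ∃ k : ℤ, 2 * (frame h.li).repr v i = k := by
  have hαv := linear_mem_translationLattice hα hv
  have hr := repr_linear (hαn.linear h) v
  have h1 : inner ℝ f₂ (v + α.linearIsometryEquiv v) = 0 := by
    have h1 := α.linearIsometryEquiv.inner_map_map f₂ v
    rw [hαn.1, neg_one_smul, inner_neg_left] at h1
    rw [inner_add_right, ← h1, neg_add_cancel]
  obtain ⟨k, l, hkl⟩ := h.plane _ (add_mem hv hαv) h1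
  have h2 := frame_repr_eq h.li (v := v + α.linearIsometryEquiv v) (x := k) (y := l) (z := 0)
    (by rw [hkl, zero_smul, add_zero])
  have h3 : v - α.linearIsometryEquiv v = (2 * (frame h.li).repr v 2) • f₂ := by
    refine (frame h.li).repr.injective (Finsupp.ext fun j => ?_)
    have h4 := frame_repr_eq h.li (v := (2 * (frame h.li).repr v 2) • f₂) (x := 0) (y := 0)
      (z := 2 * (frame h.li).repr v 2) (by simp) j
    rw [h4, map_sub, Finsupp.sub_apply, hr]
    fin_cases j <;> simp
    ring
  obtain ⟨m, hm⟩ := h.normal _ (h3 ▸ sub_mem hv hαv)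
  have h5 := h2 i
  rw [map_add, Finsupp.add_apply, hr] at h5
  fin_cases i
  · refine ⟨k, ?_⟩
    simp at h5 ⊢
    linarith
  · refine ⟨l, ?_⟩
    simp at h5 ⊢
    linarith
  · exact ⟨m, hm⟩

/-- A translation whose normal coordinate is an integer has integral coordinates. -/
theorem IsAdaptedFrame.integral (h : IsAdaptedFrame Γ f₀ f₁ f₂) {v : Euc 3}
    (hv : v ∈ translationLattice Γ) (h2 : ∃ k : ℤ, (frame h.li).repr v 2 = k) (i : Fin 3) :
    ∃ k : ℤ, (frame h.li).repr v i = k := by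
  obtain ⟨k, hk⟩ := h2
  have hs := eq_frame_sum h.li v
  have h1 : v - (k : ℝ) • f₂ ∈ translationLattice Γ := by
    rw [Int.cast_smul_eq_zsmul]
    exact sub_mem hv (zsmul_mem h.mem₂ k)
  have h3 : inner ℝ f₂ (v - (k : ℝ) • f₂) = 0 := by
    rw [hs, hk, add_sub_cancel_right, inner_add_right, real_inner_smul_right, real_inner_smul_right,
      h.inner₀, h.inner₁, mul_zero, mul_zero, add_zero]
  obtain ⟨l, m, hlm⟩ := h.plane _ h1 h3
  have h4 := frame_repr_eq h.li (v := v) (x := l) (y := m) (z := k)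
    (by rw [← hlm, sub_add_cancel]) i
  rw [h4]
  fin_cases i
  exacts [⟨l, rfl⟩, ⟨m, rfl⟩, ⟨k, rfl⟩]

theorem IsAdaptedFrame.isDiag (h : IsAdaptedFrame Γ f₀ f₁ f₂) (hαn : IsNormalSign f₂ α (-1))
    (hp : α p - p = (1 / 2 : ℝ) • f₀) : IsDiag (frame h.li) p α ![1, 1, -1] ![1 / 2, 0, 0] :=
  (isDiag_of_linear p (hαn.linear h)).congr (fun _ => rfl)
    (frame_repr_eq h.li (by rw [hp]; simp))

/-- A group all of whose elements preserve a vector up to sign and the orthogonal plane pointwise is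
determined by its translations and one of its reflections. -/
theorem IsAdaptedFrame.eq_of_le (h : IsAdaptedFrame Γ f₀ f₁ f₂) {Δ : Subgroup (EucIsom 3)}
    (hsign : ∀ γ ∈ Γ, ∃ t : ℝ, (t = 1 ∨ t = -1) ∧ IsNormalSign f₂ γ t) (hle : Δ ≤ Γ)
    (hT : translationLattice Γ ≤ translationLattice Δ) (hα : α ∈ Δ)
    (hαn : IsNormalSign f₂ α (-1)) : Γ = Δ := by
  refine eq_of_translationLattice_le (b := frame h.li) (p := 0) hle hT fun γ hγ => ?_
  obtain ⟨t, rfl | rfl, ht⟩ := hsign γ hγ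
  · refine ⟨1, Δ.one_mem, 1, _, _, (isDiag_of_linear 0 (ht.linear h)).congr (fun i => ?_)
      fun _ => rfl, isDiag_one, fun i => one_mul 1⟩
    fin_cases i <;> rfl
  · refine ⟨α, hα, _, _, _, isDiag_of_linear 0 (ht.linear h),
      isDiag_of_linear 0 (hαn.linear h), fun i => ?_⟩
    fin_cases i <;> simp

theorem IsAdaptedFrame.isTypeB₁ (h : IsAdaptedFrame Γ f₀ f₁ f₂)
    (hsign : ∀ γ ∈ Γ, ∃ t : ℝ, (t = 1 ∨ t = -1) ∧ IsNormalSign f₂ γ t) (hα : α ∈ Γ)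
    (hαn : IsNormalSign f₂ α (-1)) (hp : α p - p = (1 / 2 : ℝ) • f₀)
    (hint : ∀ v ∈ translationLattice Γ, ∃ k : ℤ, (frame h.li).repr v 2 = k) :
    IsTypeB₁ Γ f₂ f₁ f₀ := by
  refine ⟨linearIndependent_reverse h.li, h.inner₁, h.inner₀, p, ?_⟩
  set b := frame h.li with hb
  have b0 : b 0 = f₀ := frame_apply h.li 0
  have b1 : b 1 = f₁ := frame_apply h.li 1
  have b2 : b 2 = f₂ := frame_apply h.li 2
  have hαd : IsDiag b p α ![1, 1, -1] ![1 / 2, 0, 0] := h.isDiag hαn hp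
  have hα_eq : glide (subspaceThrough p {f₁, f₀}) ((1 / 2 : ℝ) • f₀) = α := by
    have := isDiag_glide_plane (b := b) (p := p) (s := {f₁, f₀}) 0 ((1 / 2 : ℝ) • f₀)
      (b0 ▸ Submodule.subset_span (by simp)) (b1 ▸ Submodule.subset_span (by simp)) (by
        rw [b2]
        rintro v (rfl | rfl) <;> rw [real_inner_comm]
        exacts [h.inner₁, h.inner₀])
    rw [add_zero, ← b0] at this
    rw [← b0]
    exact (this.congr (fun _ => rfl) fun i => by fin_cases i <;> simp).eq hαd
  rw [hα_eq]
  set Δ := Subgroup.closure {translation f₂, translation f₁, α}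
  have hmem : ∀ g ∈ ({translation f₂, translation f₁, α} : Set (EucIsom 3)), g ∈ Δ :=
    fun g hg => Subgroup.subset_closure hg
  have hα' := hmem α (by simp)
  refine h.eq_of_le hsign ((Subgroup.closure_le _).2 ?_) ?_ hα' hαn
  · rintro g (rfl | rfl | rfl)
    exacts [h.mem₂, h.mem₁, hα]
  · refine translationLattice_le_of_integral (fun v hv => h.integral hv (hint v hv)) fun i => ?_
    rw [← hb]
    fin_cases i
    · exact (hαd.mul hαd).mem_translationLattice (Γ := Δ) (Δ.mul_mem hα' hα')
        (fun i => by fin_cases i <;> simp) (fun i => by fin_cases i <;> (simp; try norm_num))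
    · exact b1 ▸ hmem (translation f₁) (by simp)
    · exact b2 ▸ hmem (translation f₂) (by simp)

theorem IsAdaptedFrame.isTypeB₂ (h : IsAdaptedFrame Γ f₀ f₁ f₂)
    (hsign : ∀ γ ∈ Γ, ∃ t : ℝ, (t = 1 ∨ t = -1) ∧ IsNormalSign f₂ γ t) (hα : α ∈ Γ)
    (hαn : IsNormalSign f₂ α (-1)) (hp : α p - p = (1 / 2 : ℝ) • f₀)
    (hv : (1 / 2 : ℝ) • (f₀ + f₁ + f₂) ∈ translationLattice Γ) :
    IsTypeB₂ Γ f₀ f₁ ((1 / 4 : ℝ) • f₂) := by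
  set b := frame h.li with hb
  have b0 : b 0 = f₀ := frame_apply h.li 0
  have b1 : b 1 = f₁ := frame_apply h.li 1
  have b2 : b 2 = f₂ := frame_apply h.li 2
  have hαd : IsDiag b p α ![1, 1, -1] ![1 / 2, 0, 0] := h.isDiag hαn hp
  have hglide (q a : Euc 3) := isDiag_glide_plane (b := b) (p := p) (s := {f₀, f₁}) q a
      (b0 ▸ Submodule.subset_span (by simp)) (b1 ▸ Submodule.subset_span (by simp)) (by
        rw [b2]
        rintro v (rfl | rfl) <;> rw [real_inner_comm]
        exacts [h.inner₀, h.inner₁])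
  have hα_eq : glide (subspaceThrough p {f₀, f₁}) ((1 / 2 : ℝ) • f₀) = α := by
    have := hglide 0 ((1 / 2 : ℝ) • f₀)
    rw [add_zero, ← b0] at this
    rw [← b0]
    exact (this.congr (fun _ => rfl) fun i => by fin_cases i <;> simp).eq hαd
  -- the second glide reflection is `α` followed by the translation by `(-f₀ + f₁ + f₂) / 2`
  set w := (1 / 2 : ℝ) • (f₀ + f₁ + f₂) - f₀ with hw
  have hwmem : w ∈ translationLattice Γ := sub_mem hv h.mem₀
  have hwr := frame_repr_eq h.li (v := w) (x := -1 / 2) (y := 1 / 2) (z := 1 / 2)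
    (by rw [hw]; module)
  have hδd : IsDiag b p (translation w * α) ![1, 1, -1] ![0, 1 / 2, 1 / 2] :=
    ((isDiag_translation w).mul hαd).congr (fun i => by simp) fun i => by
      rw [hwr]
      fin_cases i <;> simp
      norm_num
  have hδ_eq : glide (subspaceThrough (p + (1 / 4 : ℝ) • f₂) {f₀, f₁}) ((1 / 2 : ℝ) • f₁) =
      translation w * α := by
    have := hglide ((1 / 4 : ℝ) • f₂) ((1 / 2 : ℝ) • f₁)
    rw [← b1, ← b2] at this
    rw [← b1, ← b2]
    refine (this.congr (fun _ => rfl) fun i => ?_).eq hδd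
    fin_cases i <;> simp
    norm_num
  refine ⟨?_, ?_, ?_, p, ?_⟩
  · have := linearIndependent_smul (r := 1) (s := 1) (t := 1 / 4) (by norm_num) (by norm_num)
      (by norm_num) h.li
    simpa using this
  · rw [real_inner_smul_right, real_inner_comm, h.inner₀, mul_zero]
  · rw [real_inner_smul_right, real_inner_comm, h.inner₁, mul_zero]
  rw [hα_eq, hδ_eq]
  set Δ := Subgroup.closure {α, translation w * α}
  have hmem : ∀ g ∈ ({α, translation w * α} : Set (EucIsom 3)), g ∈ Δ :=
    fun g hg => Subgroup.subset_closure hg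
  have hα' := hmem α (by simp)
  have hδ' := hmem (translation w * α) (by simp)
  have hw' : w ∈ translationLattice Δ := (Subgroup.mul_mem_cancel_right Δ hα').1 hδ'
  have h0 : b 0 ∈ translationLattice Δ :=
    (hαd.mul hαd).mem_translationLattice (Γ := Δ) (Δ.mul_mem hα' hα')
      (fun i => by fin_cases i <;> simp) (fun i => by fin_cases i <;> (simp; try norm_num))
  have h1 : b 1 ∈ translationLattice Δ :=
    (hδd.mul hδd).mem_translationLattice (Γ := Δ) (Δ.mul_mem hδ' hδ')
      (fun i => by fin_cases i <;> simp) (fun i => by fin_cases i <;> (simp; try norm_num))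
  have h2 : b 2 ∈ translationLattice Δ := by
    have := sub_mem (add_mem (add_mem hw' hw') h0) h1
    convert this using 1
    rw [hw, b0, b1, b2]
    module
  have hb' (i : Fin 3) : b i ∈ translationLattice Δ := by
    fin_cases i
    exacts [h0, h1, h2]
  refine h.eq_of_le hsign ((Subgroup.closure_le _).2 ?_) (fun v hv' => ?_) hα' hαn
  · rintro g (rfl | rfl)
    exacts [hα, Γ.mul_mem hwmem hα]
  -- modulo `w`, a translation has integral coordinates
  have hcomb {x : Euc 3} (hx : x ∈ translationLattice Γ) (hx2 : ∃ k : ℤ, b.repr x 2 = k) :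
      x ∈ translationLattice Δ := by
    rw [← b.sum_repr x]
    refine sum_mem fun i _ => ?_
    obtain ⟨k, hk⟩ := h.integral hx hx2 i
    rw [hk, Int.cast_smul_eq_zsmul]
    exact zsmul_mem (hb' i) k
  obtain ⟨k, hk⟩ := h.two_mul_repr hα hαn hv' 2
  rcases fract_eq_of_two_mul hk with hf | hf
  · exact hcomb hv' ⟨⌊b.repr v 2⌋, by rw [Int.fract] at hf; exact sub_eq_zero.1 hf⟩
  · have h3 := hcomb (sub_mem hv' hwmem) ⟨⌊b.repr v 2⌋, by
      rw [map_sub, Finsupp.sub_apply, hwr]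
      rw [Int.fract] at hf
      simp only [Matrix.cons_val]
      linarith⟩
    have h4 := add_mem h3 hw'
    rwa [sub_add_cancel] at h4

/-- The classification of the groups all of whose elements preserve a vector up to sign and the
orthogonal plane pointwise: the type is `B₁` or `B₂` according to whether the lattice of
translations is the sum of its parts in the plane and along the normal, or not. -/
theorem IsAdaptedFrame.isTypeB₁_or_isTypeB₂ (h : IsAdaptedFrame Γ f₀ f₁ f₂)
    (hfree : ∀ γ ∈ Γ, ∀ x : Euc 3, γ x = x → γ = 1)
    (hsign : ∀ γ ∈ Γ, ∃ t : ℝ, (t = 1 ∨ t = -1) ∧ IsNormalSign f₂ γ t) (hα : α ∈ Γ)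
    (hαn : IsNormalSign f₂ α (-1)) (hp : α p - p = (1 / 2 : ℝ) • f₀) :
    (∃ a₁ a₂ a₃, IsTypeB₁ Γ a₁ a₂ a₃) ∨ ∃ a₁ a₂ d, IsTypeB₂ Γ a₁ a₂ d := by
  by_cases hint : ∀ v ∈ translationLattice Γ, ∃ k : ℤ, (frame h.li).repr v 2 = k
  · exact Or.inl ⟨_, _, _, h.isTypeB₁ hsign hα hαn hp hint⟩
  refine Or.inr ?_
  push Not at hint
  obtain ⟨v, hv, hv2⟩ := hint
  set b := frame h.li with hb
  set w := v - (⌊b.repr v 0⌋ • f₀ + ⌊b.repr v 1⌋ • f₁ + ⌊b.repr v 2⌋ • f₂) with hw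
  have hwmem : w ∈ translationLattice Γ := sub_mem hv (add_mem (add_mem (zsmul_mem h.mem₀ _)
    (zsmul_mem h.mem₁ _)) (zsmul_mem h.mem₂ _))
  have hws : w = Int.fract (b.repr v 0) • f₀ + Int.fract (b.repr v 1) • f₁ +
      Int.fract (b.repr v 2) • f₂ := by
    have hs := eq_frame_sum h.li v
    rw [← hb] at hs
    rw [hw]
    nth_rewrite 1 [hs]
    rw [← Int.cast_smul_eq_zsmul ℝ, ← Int.cast_smul_eq_zsmul ℝ, ← Int.cast_smul_eq_zsmul ℝ,
      Int.fract, Int.fract, Int.fract]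
    module
  have hcase (i : Fin 3) : Int.fract (b.repr v i) = 0 ∨ Int.fract (b.repr v i) = 1 / 2 := by
    obtain ⟨k, hk⟩ := h.two_mul_repr hα hαn hv i
    exact fract_eq_of_two_mul hk
  have h2 : Int.fract (b.repr v 2) = 1 / 2 := (hcase 2).resolve_left fun h0 =>
    hv2 ⌊b.repr v 2⌋ (by rw [Int.fract] at h0; exact sub_eq_zero.1 h0)
  rw [h2] at hws
  rcases hcase 1 with h1 | h1
  · exfalso
    rcases hcase 0 with h0 | h0
    · rw [h0, h1, zero_smul, zero_smul, zero_add, zero_add] at hws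
      obtain ⟨k, hk⟩ := h.normal _ (hws ▸ hwmem)
      have h3 : ((2 * k : ℤ) : ℝ) = 1 := by push_cast; linarith
      have h4 : 2 * k = 1 := by exact_mod_cast h3
      omega
    · -- the composition of `α` with the translation by `-w` has a fixed point
      have hr := frame_repr_eq h.li (v := -w) (x := -1 / 2) (y := 0) (z := -1 / 2) (by
        rw [hws, h0, h1]; module)
      have hneg : -w ∈ translationLattice Γ := neg_mem hwmem
      have hd := (isDiag_translation (-w)).mul (h.isDiag hαn hp)
      obtain ⟨i, hi, hci⟩ := hd.exists_ne_zero hfree (Γ.mul_mem hneg hα) (i := 2)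
        (by simp) fun i => by fin_cases i <;> simp
      rw [hr] at hci
      fin_cases i <;> simp at hi hci
      · norm_num at hci
      · norm_num at hi
  · rcases hcase 0 with h0 | h0
    · have h' : IsAdaptedFrame Γ f₀ (f₁ + f₀) f₂ := h.swap.add.swap
      refine ⟨_, _, _, h'.isTypeB₂ hsign hα hαn hp ?_⟩
      have h3 := add_mem hwmem h.mem₀
      rw [hws, h0, h1] at h3
      convert h3 using 1
      module
    · refine ⟨_, _, _, h.isTypeB₂ hsign hα hαn hp ?_⟩
      rw [hws, h0, h1] at hwmem
      convert hwmem using 1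
      module

end

section

/-! ### Groups with holonomy of order four -/

variable {Γ : Subgroup (EucIsom 3)} {b : Module.Basis (Fin 3) ℝ (Euc 3)} {p : Euc 3}
  {α β γ : EucIsom 3} {c : Fin 3 → ℝ}

/-- An orthogonal basis of `E³` in which the linear parts of the elements of `Γ` are diagonal and
fix `b 1`, each vector `b i` being a generator of the group of translations of `Γ` along it. -/
structure IsOrthogonalFrame (Γ : Subgroup (EucIsom 3)) (b : Module.Basis (Fin 3) ℝ (Euc 3)) :
    Prop where
  mem : ∀ i, b i ∈ translationLattice Γ
  orth : ∀ i j, i ≠ j → inner ℝ (b i) (b j) = 0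
  gen : ∀ i (s : ℝ), s • b i ∈ translationLattice Γ → ∃ k : ℤ, s = k
  sign : ∀ γ ∈ Γ, ∃ s t : ℝ, (s = 1 ∨ s = -1) ∧ (t = 1 ∨ t = -1) ∧
    ∀ i, γ.linearIsometryEquiv (b i) = (![s, 1, t] : Fin 3 → ℝ) i • b i

/-- Exchanging the first and third vectors exchanges the roles of the reflections reversing them. -/
theorem IsOrthogonalFrame.swap (h : IsOrthogonalFrame Γ b) :
    IsOrthogonalFrame Γ (b.reindex (Equiv.swap 0 2)) where
  mem i := by rw [Module.Basis.reindex_apply]; exact h.mem _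
  orth i j hij := by
    rw [Module.Basis.reindex_apply, Module.Basis.reindex_apply]
    exact h.orth _ _ fun h' => hij ((Equiv.injective _) h')
  gen i := by rw [Module.Basis.reindex_apply]; exact h.gen _
  sign γ hγ := by
    obtain ⟨s, t, hs, ht, hst⟩ := h.sign γ hγ
    refine ⟨t, s, ht, hs, fun i => ?_⟩
    rw [Module.Basis.reindex_apply, hst]
    fin_cases i <;> rfl

theorem exists_eq_add_half {x : ℝ} {k : ℤ} (h : 2 * x = k) (hx : ∀ l : ℤ, x ≠ l) :
    ∃ l : ℤ, x = l + 1 / 2 := by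
  refine ⟨⌊x⌋, ?_⟩
  have h1 := (fract_eq_of_two_mul h).resolve_left fun h0 =>
    hx ⌊x⌋ (by rw [Int.fract] at h0; exact sub_eq_zero.1 h0)
  rw [Int.fract] at h1
  linarith

/-- The translation component of a rotation of angle `π` along its axis is a half-integer but not an
integer, as otherwise a translate of this rotation would have a fixed point. -/
theorem IsOrthogonalFrame.screw_component (h : IsOrthogonalFrame Γ b)
    (hfree : ∀ γ ∈ Γ, ∀ x : Euc 3, γ x = x → γ = 1) (hγ : γ ∈ Γ)
    (hd : IsDiag b p γ ![-1, 1, -1] c) : ∃ k : ℤ, c 1 = k + 1 / 2 := by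
  obtain ⟨k, hk⟩ := h.gen 1 (2 * c 1) ((hd.mul hd).mem_translationLattice (Γ.mul_mem hγ hγ)
    (fun i => by fin_cases i <;> simp) (fun i => by fin_cases i <;> simp; ring))
  refine exists_eq_add_half hk fun l hl => ?_
  have hmem : -((l : ℝ) • b 1) ∈ translationLattice Γ := by
    rw [Int.cast_smul_eq_zsmul]
    exact neg_mem (zsmul_mem (h.mem 1) l)
  obtain ⟨i, hi, hci⟩ := ((isDiag_translation _).mul hd).exists_ne_zero hfree
    (Γ.mul_mem hmem hγ) (i := 0) (by simp) fun i => by fin_cases i <;> simp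
  fin_cases i <;> simp at hi hci
  · norm_num at hi
  · exact hci (by linarith)
  · norm_num at hi

/-- If the translation component of a reflection along `b 1` is an integer, the one along `b 0` is a
half-integer but not an integer, for the same reason. -/
theorem IsOrthogonalFrame.glide_component (h : IsOrthogonalFrame Γ b)
    (hfree : ∀ γ ∈ Γ, ∀ x : Euc 3, γ x = x → γ = 1) (hγ : γ ∈ Γ)
    (hd : IsDiag b p γ ![1, 1, -1] c) {m : ℤ} (hm : c 1 = m) : ∃ k : ℤ, c 0 = k + 1 / 2 := by
  have hmem : -((m : ℝ) • b 1) ∈ translationLattice Γ := by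
    rw [Int.cast_smul_eq_zsmul]
    exact neg_mem (zsmul_mem (h.mem 1) m)
  have hd' := (isDiag_translation (-((m : ℝ) • b 1))).mul hd
  have hγ' := Γ.mul_mem hmem hγ
  obtain ⟨k, hk⟩ := h.gen 0 (2 * c 0) ((hd'.mul hd').mem_translationLattice (Γ.mul_mem hγ' hγ')
    (fun i => by fin_cases i <;> simp) (fun i => by fin_cases i <;> simp [hm]; ring))
  refine exists_eq_add_half hk fun l hl => ?_
  have hmem' : -((l : ℝ) • b 0) ∈ translationLattice Γ := by
    rw [Int.cast_smul_eq_zsmul]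
    exact neg_mem (zsmul_mem (h.mem 0) l)
  obtain ⟨i, hi, hci⟩ := ((isDiag_translation _).mul hd').exists_ne_zero hfree
    (Γ.mul_mem hmem' hγ') (i := 2) (by simp) fun i => by fin_cases i <;> simp
  fin_cases i <;> simp at hi hci
  · exact hci (by linarith)
  · exact hci (by linarith)
  · norm_num at hi

theorem IsOrthogonalFrame.linearIndependent (b : Module.Basis (Fin 3) ℝ (Euc 3)) :
    LinearIndependent ℝ ![b 0, b 1, b 2] := by
  convert b.linearIndependent using 1
  ext1 i
  fin_cases i <;> rfl

/-- A group with an orthogonal frame is determined by its translations, a reflection and a rotation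
of angle `π`. -/
theorem IsOrthogonalFrame.eq_of_le (h : IsOrthogonalFrame Γ b) {Δ : Subgroup (EucIsom 3)}
    (hle : Δ ≤ Γ) (hint : ∀ v ∈ translationLattice Γ, ∀ i, ∃ k : ℤ, b.repr v i = k)
    (hb : ∀ i, b i ∈ translationLattice Δ) {cα cβ : Fin 3 → ℝ} (hα : α ∈ Δ)
    (hαd : IsDiag b p α ![1, 1, -1] cα) (hβ : β ∈ Δ) (hβd : IsDiag b p β ![-1, 1, -1] cβ) :
    Γ = Δ := by
  refine eq_of_translationLattice_le (b := b) (p := p) hle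
    (translationLattice_le_of_integral hint hb) fun γ hγ => ?_
  obtain ⟨s, t, hs, ht, hst⟩ := h.sign γ hγ
  have hd := isDiag_of_linear p hst
  rcases hs with rfl | rfl <;> rcases ht with rfl | rfl
  · exact ⟨1, Δ.one_mem, 1, _, _, hd.congr (fun i => by fin_cases i <;> rfl) fun _ => rfl,
      isDiag_one, fun i => one_mul 1⟩
  · exact ⟨α, hα, _, _, _, hd, hαd, fun i => by fin_cases i <;> simp⟩
  · refine ⟨α * β, Δ.mul_mem hα hβ, _, _, _, hd, (hαd.mul hβd).congr (fun i => ?_) fun _ => rfl,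
      fun i => ?_⟩ <;> fin_cases i <;> simp
  · exact ⟨β, hβ, _, _, _, hd, hβd, fun i => by fin_cases i <;> simp⟩

theorem IsOrthogonalFrame.glide_plane_eq (h : IsOrthogonalFrame Γ b)
    (hαd : IsDiag b p α ![1, 1, -1] ![1 / 2, 0, 0]) :
    glide (subspaceThrough p {b 0, b 1}) ((1 / 2 : ℝ) • b 0) = α := by
  have := isDiag_glide_plane (b := b) (p := p) (s := {b 0, b 1}) 0 ((1 / 2 : ℝ) • b 0)
    (Submodule.subset_span (by simp)) (Submodule.subset_span (by simp)) (by
      rintro v (rfl | rfl)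
      exacts [h.orth 0 2 (by decide), h.orth 1 2 (by decide)])
  rw [add_zero] at this
  exact (this.congr (fun _ => rfl) fun i => by fin_cases i <;> simp).eq hαd

theorem IsOrthogonalFrame.glide_line_eq (h : IsOrthogonalFrame Γ b) {r : ℝ}
    (hβd : IsDiag b p β ![-1, 1, -1] ![0, 1 / 2, 2 * r]) :
    glide (subspaceThrough (p + r • b 2) {b 1}) ((1 / 2 : ℝ) • b 1) = β := by
  have := isDiag_glide_line (b := b) (p := p) (s := {b 1}) (r • b 2) ((1 / 2 : ℝ) • b 1)
    (by rintro v rfl; exact h.orth 1 0 (by decide)) (Submodule.subset_span (by simp))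
    (by rintro v rfl; exact h.orth 1 2 (by decide))
  exact (this.congr (fun _ => rfl) fun i => by fin_cases i <;> simp).eq hβd

theorem IsOrthogonalFrame.isTypeB₃ (h : IsOrthogonalFrame Γ b)
    (hint : ∀ v ∈ translationLattice Γ, ∀ i, ∃ k : ℤ, b.repr v i = k) (hα : α ∈ Γ)
    (hαd : IsDiag b p α ![1, 1, -1] ![1 / 2, 0, 0]) (hβ : β ∈ Γ)
    (hβd : IsDiag b p β ![-1, 1, -1] ![0, 1 / 2, 0]) : IsTypeB₃ Γ (b 0) (b 1) (b 2) := by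
  refine ⟨IsOrthogonalFrame.linearIndependent b, h.orth 0 1 (by decide), h.orth 0 2 (by decide),
    h.orth 1 2 (by decide), p, ?_⟩
  have hβ_eq := h.glide_line_eq (r := 0) (hβd.congr (fun _ => rfl) fun i => by
    fin_cases i <;> simp)
  rw [zero_smul, add_zero] at hβ_eq
  rw [h.glide_plane_eq hαd, hβ_eq]
  set Δ := Subgroup.closure {translation (b 2), α, β}
  have hmem : ∀ g ∈ ({translation (b 2), α, β} : Set (EucIsom 3)), g ∈ Δ :=
    fun g hg => Subgroup.subset_closure hg
  have hα' := hmem α (by simp)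
  have hβ' := hmem β (by simp)
  refine h.eq_of_le ((Subgroup.closure_le _).2 ?_) hint (fun i => ?_) hα' hαd hβ' hβd
  · rintro g (rfl | rfl | rfl)
    exacts [h.mem 2, hα, hβ]
  · fin_cases i
    · exact (hαd.mul hαd).mem_translationLattice (Γ := Δ) (Δ.mul_mem hα' hα')
        (fun i => by fin_cases i <;> simp) (fun i => by fin_cases i <;> (simp; try norm_num))
    · exact (hβd.mul hβd).mem_translationLattice (Γ := Δ) (Δ.mul_mem hβ' hβ')
        (fun i => by fin_cases i <;> simp) (fun i => by fin_cases i <;> (simp; try norm_num))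
    · exact hmem (translation (b 2)) (by simp)

theorem IsOrthogonalFrame.isTypeB₄ (h : IsOrthogonalFrame Γ b)
    (hint : ∀ v ∈ translationLattice Γ, ∀ i, ∃ k : ℤ, b.repr v i = k) (hα : α ∈ Γ)
    (hαd : IsDiag b p α ![1, 1, -1] ![1 / 2, 0, 0]) (hβ : β ∈ Γ)
    (hβd : IsDiag b p β ![-1, 1, -1] ![0, 1 / 2, 1 / 2]) : IsTypeB₄ Γ (b 0) (b 1) (b 2) := by
  refine ⟨IsOrthogonalFrame.linearIndependent b, h.orth 0 1 (by decide), h.orth 0 2 (by decide),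
    h.orth 1 2 (by decide), p, ?_⟩
  have hβ_eq := h.glide_line_eq (r := 1 / 4) (hβd.congr (fun _ => rfl) fun i => by
    fin_cases i <;> simp
    norm_num)
  rw [h.glide_plane_eq hαd, hβ_eq]
  set Δ := Subgroup.closure {α, β}
  have hmem : ∀ g ∈ ({α, β} : Set (EucIsom 3)), g ∈ Δ :=
    fun g hg => Subgroup.subset_closure hg
  have hα' := hmem α (by simp)
  have hβ' := hmem β (by simp)
  have h1 : b 1 ∈ translationLattice Δ :=
    (hβd.mul hβd).mem_translationLattice (Γ := Δ) (Δ.mul_mem hβ' hβ')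
      (fun i => by fin_cases i <;> simp) (fun i => by fin_cases i <;> (simp; try norm_num))
  have hαβ := hαd.mul hβd
  have hαβ' := Δ.mul_mem hα' hβ'
  have h12 : b 1 - b 2 ∈ translationLattice Δ :=
    (hαβ.mul hαβ).mem_translationLattice (Γ := Δ) (Δ.mul_mem hαβ' hαβ')
      (fun i => by fin_cases i <;> simp) (fun i => by fin_cases i <;> (simp; try norm_num))
  refine h.eq_of_le ((Subgroup.closure_le _).2 ?_) hint (fun i => ?_) hα' hαd hβ' hβd
  · rintro g (rfl | rfl)
    exacts [hα, hβ]
  · fin_cases i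
    · exact (hαd.mul hαd).mem_translationLattice (Γ := Δ) (Δ.mul_mem hα' hα')
        (fun i => by fin_cases i <;> simp) (fun i => by fin_cases i <;> (simp; try norm_num))
    · exact h1
    · simpa using sub_mem h1 h12

/-- The case of a reflection whose translation component along the common fixed direction is
integral. The type is `B₃` or `B₄` according to whether the axis of a suitable rotation of angle `π`
lies on the plane of a suitable glide reflection, or at a quarter of the third period from it. -/
theorem IsOrthogonalFrame.isTypeB₃_or_isTypeB₄_of_integral (h : IsOrthogonalFrame Γ b)
    (hfree : ∀ γ ∈ Γ, ∀ x : Euc 3, γ x = x → γ = 1) (hα : α ∈ Γ)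
    (hαl : ∀ i, α.linearIsometryEquiv (b i) = (![1, 1, -1] : Fin 3 → ℝ) i • b i) (hβ : β ∈ Γ)
    (hβl : ∀ i, β.linearIsometryEquiv (b i) = (![-1, 1, -1] : Fin 3 → ℝ) i • b i) {m : ℤ}
    (hm : b.repr (α 0) 1 = m) :
    (∃ a₁ a₂ a₃, IsTypeB₃ Γ a₁ a₂ a₃) ∨ ∃ a₁ a₂ a₃, IsTypeB₄ Γ a₁ a₂ a₃ := by
  have hαd := isDiag_of_linear 0 hαl
  have hβd := isDiag_of_linear 0 hβl
  rw [sub_zero] at hαd hβd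
  obtain ⟨k, hk⟩ := h.glide_component hfree hα hαd hm
  obtain ⟨l, hl⟩ := h.screw_component hfree hβ hβd
  -- the translation components of the translates of `α` and `β` show that the lattice is integral
  have hint1 {v : Euc 3} (hv : v ∈ translationLattice Γ) : ∃ j : ℤ, b.repr v 1 = j := by
    obtain ⟨j, hj⟩ := h.screw_component hfree (Γ.mul_mem hv hβ)
      ((isDiag_translation v).mul hβd |>.congr
      (ε' := ![-1, 1, -1]) (fun i => by simp) fun _ => rfl)
    refine ⟨j - l, ?_⟩
    push_cast
    simp only [Pi.one_apply, one_mul] at hj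
    linarith
  have hint0 {v : Euc 3} (hv : v ∈ translationLattice Γ) : ∃ j : ℤ, b.repr v 0 = j := by
    obtain ⟨n, hn⟩ := hint1 hv
    obtain ⟨j, hj⟩ := h.glide_component (m := m + n) hfree (Γ.mul_mem hv hα)
      ((isDiag_translation v).mul hαd |>.congr
      (ε' := ![1, 1, -1]) (fun i => by simp) fun _ => rfl) (by
        simp only [Pi.one_apply, one_mul]
        rw [hm, hn]
        push_cast
        ring)
    refine ⟨j - k, ?_⟩
    push_cast
    simp only [Pi.one_apply, one_mul] at hj
    linarith
  have hint (v : Euc 3) (hv : v ∈ translationLattice Γ) (i : Fin 3) :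
      ∃ j : ℤ, b.repr v i = j := by
    obtain ⟨n₀, h0⟩ := hint0 hv
    obtain ⟨n₁, h1⟩ := hint1 hv
    fin_cases i
    · exact ⟨n₀, h0⟩
    · exact ⟨n₁, h1⟩
    · refine h.gen 2 _ ?_
      have h2 : b.repr v 2 • b 2 = v - (n₀ • b 0 + n₁ • b 1) := by
        rw [← Int.cast_smul_eq_zsmul ℝ, ← Int.cast_smul_eq_zsmul ℝ, ← h0, ← h1, eq_sub_iff_add_eq]
        conv_rhs => rw [← b.sum_repr v, Fin.sum_univ_three]
        abel
      exact h2 ▸ sub_mem hv (add_mem (zsmul_mem (h.mem 0) _) (zsmul_mem (h.mem 1) _))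
  -- translates of `α` and `β` in a new origin, chosen on the plane of `α` and the axis of `β`
  set r := b.repr (α 0) 2
  set x := b.repr (β 0) 0
  set ρ := b.repr (β 0) 2 - r with hρ
  set q := (x / 2) • b 0 + (r / 2) • b 2 with hq
  have hmemα : -((k : ℝ) • b 0 + (m : ℝ) • b 1) ∈ translationLattice Γ := by
    rw [Int.cast_smul_eq_zsmul, Int.cast_smul_eq_zsmul]
    exact neg_mem (add_mem (zsmul_mem (h.mem 0) k) (zsmul_mem (h.mem 1) m))
  have hα' := Γ.mul_mem hmemα hα
  have hαd' : IsDiag b q _ ![1, 1, -1] ![1 / 2, 0, 0] :=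
    ((isDiag_translation (-((k : ℝ) • b 0 + (m : ℝ) • b 1))).mul hαd).origin q |>.congr
      (fun i => by simp) fun i => by
        fin_cases i <;> simp [hq, hk, hm]
        change r - _ = 0
        ring
  have hβd' (j : ℤ) : IsDiag b q (translation (-((l : ℝ) • b 1 + (j : ℝ) • b 2)) * β)
      ![-1, 1, -1] ![0, 1 / 2, ρ - j] :=
    ((isDiag_translation (-((l : ℝ) • b 1 + (j : ℝ) • b 2))).mul hβd).origin q |>.congr
      (fun i => by simp) fun i => by
        fin_cases i <;> simp [hq, hl]
        · change x - _ = 0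
          ring
        · rw [hρ]
          ring
  have hβ' (j : ℤ) : translation (-((l : ℝ) • b 1 + (j : ℝ) • b 2)) * β ∈ Γ := by
    refine Γ.mul_mem (show -((l : ℝ) • b 1 + (j : ℝ) • b 2) ∈ translationLattice Γ from ?_) hβ
    rw [Int.cast_smul_eq_zsmul, Int.cast_smul_eq_zsmul]
    exact neg_mem (add_mem (zsmul_mem (h.mem 1) l) (zsmul_mem (h.mem 2) j))
  obtain ⟨n, hn⟩ : ∃ n : ℤ, 2 * ρ = n := by
    have hαβ := hαd'.mul (hβd' 0)
    have hαβ' := Γ.mul_mem hα' (hβ' 0)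
    refine h.gen 2 _ ?_
    have h1 : b 1 - (2 * ρ) • b 2 ∈ translationLattice Γ :=
      (hαβ.mul hαβ).mem_translationLattice (Γ.mul_mem hαβ' hαβ')
        (fun i => by fin_cases i <;> simp) (fun i => by fin_cases i <;> simp <;> ring)
    simpa using sub_mem (h.mem 1) h1
  rcases fract_eq_of_two_mul hn with hf | hf
  · exact Or.inl ⟨_, _, _, h.isTypeB₃ hint hα' hαd' (hβ' ⌊ρ⌋) (by
      have := hβd' ⌊ρ⌋
      rwa [← Int.fract, hf] at this)⟩
  · exact Or.inr ⟨_, _, _, h.isTypeB₄ hint hα' hαd' (hβ' ⌊ρ⌋) (by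
      have := hβd' ⌊ρ⌋
      rwa [← Int.fract, hf] at this)⟩

/-- The classification of the groups which contain a reflection and a rotation of angle `π`. If the
translation component of the reflection `α` along the common fixed direction is not integral, then
the one of the reflection `α * β` is. -/
theorem IsOrthogonalFrame.isTypeB₃_or_isTypeB₄ (h : IsOrthogonalFrame Γ b)
    (hfree : ∀ γ ∈ Γ, ∀ x : Euc 3, γ x = x → γ = 1) (hα : α ∈ Γ)
    (hαl : ∀ i, α.linearIsometryEquiv (b i) = (![1, 1, -1] : Fin 3 → ℝ) i • b i) (hβ : β ∈ Γ)
    (hβl : ∀ i, β.linearIsometryEquiv (b i) = (![-1, 1, -1] : Fin 3 → ℝ) i • b i) :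
    (∃ a₁ a₂ a₃, IsTypeB₃ Γ a₁ a₂ a₃) ∨ ∃ a₁ a₂ a₃, IsTypeB₄ Γ a₁ a₂ a₃ := by
  by_cases hm : ∃ m : ℤ, b.repr (α 0) 1 = m
  · obtain ⟨m, hm⟩ := hm
    exact h.isTypeB₃_or_isTypeB₄_of_integral hfree hα hαl hβ hβl hm
  have hαd := isDiag_of_linear 0 hαl
  have hβd := isDiag_of_linear 0 hβl
  rw [sub_zero] at hαd hβd
  obtain ⟨l, hl⟩ := h.screw_component hfree hβ hβd
  have hsq : (2 * b.repr (α 0) 0) • b 0 + (2 * b.repr (α 0) 1) • b 1 ∈ translationLattice Γ :=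
    (hαd.mul hαd).mem_translationLattice (Γ.mul_mem hα hα)
      (fun i => by fin_cases i <;> simp) (fun i => by fin_cases i <;> simp <;> ring)
  have hint : ∃ j : ℤ, 2 * b.repr (α 0) 1 = j := by
    have hd :=
      (isDiag_translation ((2 * b.repr (α 0) 0) • b 0 + (2 * b.repr (α 0) 1) • b 1)).mul hβd
    obtain ⟨j, hj⟩ := h.screw_component hfree (Γ.mul_mem hsq hβ)
      (hd.congr (ε' := ![-1, 1, -1]) (fun i => by simp) fun _ => rfl)
    refine ⟨j - l, ?_⟩
    simp at hj
    push_cast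
    linarith
  obtain ⟨j, hj⟩ := hint
  obtain ⟨k, hk⟩ := exists_eq_add_half hj (by push Not at hm; exact hm)
  refine h.swap.isTypeB₃_or_isTypeB₄_of_integral (m := k + l + 1) hfree (Γ.mul_mem hα hβ)
    (fun i => ?_) hβ (fun i => ?_) ?_
  · rw [Module.Basis.reindex_apply]
    have h1 := (hαd.mul hβd).linear ((Equiv.swap (0 : Fin 3) 2).symm i)
    rw [h1]
    congr 1
    fin_cases i <;> simp
    rw [show Equiv.swap (0 : Fin 3) 2 1 = 1 by decide]
    simp
  · rw [Module.Basis.reindex_apply, hβl]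
    fin_cases i <;> rfl
  · have h1 := (hαd.mul hβd) 0 1
    rw [sub_zero, sub_zero, map_zero b.repr] at h1
    simp only [Finsupp.coe_zero, Pi.zero_apply, mul_zero, zero_add, Matrix.cons_val, one_mul, hk,
      hl] at h1
    rw [Module.Basis.repr_reindex_apply, show (Equiv.swap (0 : Fin 3) 2).symm 1 = 1 by decide, h1]
    push_cast
    ring

end

section

/-! ### The classification -/

/-- The non-orientable groups belong to the four families: to the first two when the linear parts
are the identity and one reflection, to the last two when they include a rotation of angle `π`. -/
theorem IsBieberbach.exists_type {Γ : Subgroup (EucIsom 3)} (hΓ : IsBieberbach Γ)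
    (hno : IsNonOrientable Γ) :
    (∃ a₁ a₂ a₃, IsTypeB₁ Γ a₁ a₂ a₃) ∨ (∃ a₁ a₂ d, IsTypeB₂ Γ a₁ a₂ d) ∨
      (∃ a₁ a₂ a₃, IsTypeB₃ Γ a₁ a₂ a₃) ∨ (∃ a₁ a₂ a₃, IsTypeB₄ Γ a₁ a₂ a₃) := by
  obtain ⟨e, hsign, α, hα, hαe⟩ := exists_orthonormalBasis_diagonal hΓ.free hno
  obtain ⟨r₀, hr₀, hd⟩ := hΓ.discrete.exists_pos
  obtain ⟨R, hR⟩ := exists_norm_add_le (b := e.toBasis) hΓ.cocompact (by simpa using hsign)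
  have hspan (x : Euc 3) (hx : x ≠ 0) := exists_inner_ne_zero hR hx
  have hrepr (v : Euc 3) (i : Fin 3) : e.toBasis.repr v i = inner ℝ v (e i) := by
    rw [e.coe_toBasis_repr_apply, e.repr_apply_apply, real_inner_comm]
  by_cases hex : ∃ β ∈ Γ, ∀ i, β.linearIsometryEquiv (e i) = (![-1, 1, -1] : Fin 3 → ℝ) i • e i
  · obtain ⟨β, hβ, hβe⟩ := hex
    -- the differences or sums of a translation and its conjugates are parallel to the frame
    have hgen (i : Fin 3) : ∃ r : ℝ, r ≠ 0 ∧ r • e i ∈ translationLattice Γ ∧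
        ∀ s : ℝ, s • r • e i ∈ translationLattice Γ → ∃ k : ℤ, s = k := by
      obtain ⟨v, hv, hvi⟩ := hspan (e i) (e.orthonormal.ne_zero i)
      refine exists_generator hr₀ hd (e.orthonormal.ne_zero i) (t := 2 * inner ℝ v (e i))
        (mul_ne_zero two_ne_zero hvi) ?_
      have hαv := repr_linear (b := e.toBasis) (by simpa using hαe)
      have hβv := repr_linear (b := e.toBasis) (by simpa using hβe)
      have h1 := linear_mem_translationLattice hα hv
      have h2 := linear_mem_translationLattice hβ hv
      have h3 := linear_mem_translationLattice hα h2
      rw [← hrepr, ← e.coe_toBasis]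
      fin_cases i
      · convert sub_mem hv h3 using 1
        refine e.toBasis.repr.injective (Finsupp.ext fun j => ?_)
        rw [map_sub, Finsupp.sub_apply, hαv, hβv, map_smul, Module.Basis.repr_self]
        fin_cases j <;> simp
        ring
      · convert add_mem hv h2 using 1
        refine e.toBasis.repr.injective (Finsupp.ext fun j => ?_)
        rw [map_add, Finsupp.add_apply, hβv, map_smul, Module.Basis.repr_self]
        fin_cases j <;> simp
        ring
      · convert sub_mem hv h1 using 1
        refine e.toBasis.repr.injective (Finsupp.ext fun j => ?_)
        rw [map_sub, Finsupp.sub_apply, hαv, map_smul, Module.Basis.repr_self]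
        fin_cases j <;> simp
        ring
    choose r hr hmem hint using hgen
    set b := e.toBasis.isUnitSMul fun i => (hr i).isUnit
    have hb (i : Fin 3) : b i = r i • e i := by
      rw [Module.Basis.isUnitSMul_apply, e.coe_toBasis]
    have hlin {γ : EucIsom 3} {ε : Fin 3 → ℝ} (h : ∀ i, γ.linearIsometryEquiv (e i) = ε i • e i)
        (i : Fin 3) : γ.linearIsometryEquiv (b i) = ε i • b i := by
      rw [hb, map_smul, h, smul_comm]
    have hframe : IsOrthogonalFrame Γ b := by
      refine ⟨fun i => hb i ▸ hmem i, fun i j hij => ?_, fun i s hs => ?_, fun γ hγ => ?_⟩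
      · rw [hb, hb, real_inner_smul_left, real_inner_smul_right, e.orthonormal.inner_eq_zero hij,
          mul_zero, mul_zero]
      · rw [hb] at hs
        exact hint i s hs
      · obtain ⟨s, t, hs, ht, hst⟩ := hsign γ hγ
        exact ⟨s, t, hs, ht, hlin hst⟩
    exact Or.inr (Or.inr (hframe.isTypeB₃_or_isTypeB₄ hΓ.free hα (hlin hαe) hβ (hlin hβe)))
  · -- otherwise every element preserves the third vector up to sign, and its orthogonal plane
    have hnormal {γ : EucIsom 3} {t : ℝ}
        (h : ∀ i, γ.linearIsometryEquiv (e i) = (![1, 1, t] : Fin 3 → ℝ) i • e i) :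
        IsNormalSign (e 2) γ t := by
      refine ⟨h 2, fun v hv => e.toBasis.repr.injective (Finsupp.ext fun i => ?_)⟩
      rw [repr_linear (b := e.toBasis) (by simpa using h)]
      fin_cases i
      · simp
      · simp
      · have h1 := hrepr v 2
        rw [real_inner_comm, hv] at h1
        simp [h1]
    have hsign' (γ : EucIsom 3) (hγ : γ ∈ Γ) :
        ∃ t : ℝ, (t = 1 ∨ t = -1) ∧ IsNormalSign (e 2) γ t := by
      obtain ⟨s, t, hs, ht, hst⟩ := hsign γ hγ
      rcases hs with rfl | rfl
      · exact ⟨t, ht, hnormal hst⟩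
      · exfalso
        rcases ht with rfl | rfl
        · refine hex ⟨α * γ, Γ.mul_mem hα hγ, fun i => ?_⟩
          change α.linearIsometryEquiv (γ.linearIsometryEquiv (e i)) = _
          rw [hst, map_smul, hαe, smul_smul]
          fin_cases i <;> simp
        · exact hex ⟨γ, hγ, hst⟩
    have hαn := hnormal hαe
    obtain ⟨f₀, f₁, s, hs, hf⟩ :=
      exists_isAdaptedFrame (e.orthonormal.ne_zero 2) hr₀ hd hspan hα hαn
    obtain ⟨g₀, g₁, hg, γ, hγ, hγn, p, hp⟩ := hf.exists_glide hΓ.free hα (hαn.smul hs)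
    have := hg.isTypeB₁_or_isTypeB₂ hΓ.free (fun γ hγ => (hsign' γ hγ).imp fun t ht =>
      ⟨ht.1, ht.2.smul hs⟩) hγ hγn hp
    rcases this with h | h
    exacts [Or.inl h, Or.inr (Or.inl h)]

end

end FlatBoundary

end

theorem mainTheorem7 :
    -- every non-orientable three-dimensional Bieberbach manifold is a totally geodesic boundary
    (∀ Γ : Subgroup (EucIsom 3), FlatBoundary.IsBieberbach Γ → FlatBoundary.IsNonOrientable Γ →
      FlatBoundary.IsGeodesicBoundary Γ) ∧
    -- the non-orientable Bieberbach groups are exactly the groups of the four types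
    (∀ Γ : Subgroup (EucIsom 3),
      (FlatBoundary.IsBieberbach Γ ∧ FlatBoundary.IsNonOrientable Γ) ↔
        ((∃ a₁ a₂ a₃, FlatBoundary.IsTypeB₁ Γ a₁ a₂ a₃) ∨
          (∃ a₁ a₂ d, FlatBoundary.IsTypeB₂ Γ a₁ a₂ d) ∨
          (∃ a₁ a₂ a₃, FlatBoundary.IsTypeB₃ Γ a₁ a₂ a₃) ∨
          (∃ a₁ a₂ a₃, FlatBoundary.IsTypeB₄ Γ a₁ a₂ a₃))) ∧
    -- explicit admissible translations
    (∀ (Γ : Subgroup (EucIsom 3)) (a₁ a₂ a₃ : Euc 3), FlatBoundary.IsTypeB₁ Γ a₁ a₂ a₃ →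
      FlatBoundary.InducesAdmissible Γ (FlatBoundary.translation ((1 / 2 : ℝ) • a₁))) ∧
    (∀ (Γ : Subgroup (EucIsom 3)) (a₁ a₂ d : Euc 3), FlatBoundary.IsTypeB₂ Γ a₁ a₂ d →
      FlatBoundary.InducesAdmissible Γ (FlatBoundary.translation ((2 : ℝ) • d)) ∧
      FlatBoundary.InducesAdmissible Γ (FlatBoundary.translation ((1 / 2 : ℝ) • (a₁ + a₂)))) ∧
    (∀ (Γ : Subgroup (EucIsom 3)) (a₁ a₂ a₃ : Euc 3), FlatBoundary.IsTypeB₃ Γ a₁ a₂ a₃ →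
      FlatBoundary.InducesAdmissible Γ (FlatBoundary.translation ((1 / 2 : ℝ) • a₃))) ∧
    (∀ (Γ : Subgroup (EucIsom 3)) (a₁ a₂ a₃ : Euc 3), FlatBoundary.IsTypeB₄ Γ a₁ a₂ a₃ →
      FlatBoundary.InducesAdmissible Γ (FlatBoundary.translation ((1 / 2 : ℝ) • a₃))) := by
  refine ⟨fun Γ hΓ hno => ?_, fun Γ => ⟨fun h => h.1.exists_type h.2, ?_⟩,
    fun Γ a₁ a₂ a₃ h => h.isAdmissibleLift.inducesAdmissible,
    fun Γ a₁ a₂ d h =>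
      ⟨h.isAdmissibleLift.inducesAdmissible, h.isAdmissibleLift_sum.inducesAdmissible⟩,
    fun Γ a₁ a₂ a₃ h => h.isAdmissibleLift.inducesAdmissible,
    fun Γ a₁ a₂ a₃ h => h.isAdmissibleLift.inducesAdmissible⟩
  · rcases hΓ.exists_type hno with ⟨_, _, _, h⟩ | ⟨_, _, _, h⟩ | ⟨_, _, _, h⟩ | ⟨_, _, _, h⟩
    all_goals exact h.isAdmissibleLift.isGeodesicBoundary hΓ
  · rintro (⟨_, _, _, h⟩ | ⟨_, _, _, h⟩ | ⟨_, _, _, h⟩ | ⟨_, _, _, h⟩)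
    all_goals
      obtain ⟨b, p, hs, -⟩ := h.exists_isStdGroup
      exact ⟨hs.isBieberbach, hs.isNonOrientable⟩
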